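/- Let $K$ be an algebraically closed field, let $v\in K^*$ with $\delta=v+v^{-1}\neq 0$, and let $n\ge 3$. **The algebras.** An affine $n$-diagram consists of two infinite rows of nodes $\mathbb Z\times\{0,1\}$ and non-intersecting edges in the strip $\mathbb R\times[0,1]$, invariant under translation by $n$: every node is an endpoint of exactly one edge, and any edge not joining two nodes is an infinite horizontal line meeting no node, of which there are finitely many. Diagrams are taken up to translation-invariant isotopy fixing the nodes, and are viewed on a cylinder. $D_n$ is the $K$-algebra with basis the affine $n$-diagrams and product $AB=\delta^xC$, where $C$ is obtained by putting $A$ on top of $B$, identifying the middle nodes, and removing the $x$ contractible closed loops (loops around the cylinder are kept as infinite horizontal lines). Let $u\in D_n$ be the diagram joining each bottom node $j$ to the top node $j+1$. For $q\in K^*$ let $\omega(q)$ be the ideal of $D_n$ generated by $u^n-q$, let $I_0$ be the ideal spanned by the diagrams in which no edge joins the two rows (zero for $n$ odd), and put $D_n(q)=D_n/(\omega(q)+I_0)$. **Standard modules.** An edge joining the two rows is called a through-string. For $t>0$ a diagram with $t$ through-strings (counted on the cylinder) is determined by its horizontal edges $S_1$ in the top row, its horizontal edges $S_2$ in the bottom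 row and its winding number $w\in\mathbb Z$, and is denoted $[S_1,S_2,w]$; for $f=\sum_k f_kX^k\in K[X]$ put $f(S_1,S_2)=\sum_k f_k[S_1,S_2,k]$. Let $0<t\le n$ with $t\equiv n\pmod 2$, let $X^t-q=\prod_{i=1}^t(X-r_i)$ for some labelling of the roots, and put $f^{(j)}=\prod_{i>j}(X-r_i)$ for $1\le j\le t$. The standard module $W(t,j)$ of $D_n(q)$ is the span, for a fixed $T$, of the cosets of all $f^{(j)}(S,T)$ modulo the span of all diagrams with fewer than $t$ through-strings and all $f^{(i)}(S_1,S_2)$ with $i<j$. Up to isomorphism it depends only on $t$ and the root $r_j$. A standard module for $D_n(q)$ is a module isomorphic to one of these; it is regarded as a $D_n$-module through $D_n\to D_n(q)$. **Theorem.** Let $q,q'\in K^*$, let $M$ be a simple standard module for $D_n(q)$ and let $M'$ be a simple standard module for $D_n(q')$. (a) If $\mathrm{Ext}^1_{D_n(q)}(M,M)=0$, then $\mathrm{Ext}^1_{D_n}(M,M)\cong K$ as a $K$-vector space. (b) Suppose $M\not\cong M'$ as $D_n$-modules. If $q\neq q'$, or if $q=q'$ and $\mathrm{Ext}^1_{D_n(q)}(M,M')=0$,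 then $\mathrm{Ext}^1_{D_n}(M,M')=0$. -/

import Mathlib

universe u

namespace AffineTL

/-! ### Affine diagrams -/

/-- The boundary order of the strip `ℝ × [0,1]`. The node `Sum.inl i` is the `i`-th node of the top
row, `Sum.inr i` is the `i`-th node of the bottom row; the boundary is read from left to right along
the top row, then from right to left along the bottom row. -/
def Before : ℤ ⊕ ℤ → ℤ ⊕ ℤ → Prop
  | Sum.inl i, Sum.inl j => i < j
  | Sum.inl _, Sum.inr _ => True
  | Sum.inr _, Sum.inl _ => False
  | Sum.inr i, Sum.inr j => j < i

/-- Horizontal translation of the nodes of a diagram. -/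
def translate (k : ℤ) : ℤ ⊕ ℤ → ℤ ⊕ ℤ := Sum.map (fun i => i + k) (fun i => i + k)

/-- An affine `n`-diagram up to isotopy. An isotopy class is given by the pairing of the nodes
by the edges, together with the number of infinite horizontal lines; the edges can be drawn in the
strip without intersections if and only if no two of them interleave along the boundary (`planar`)
and there is no infinite horizontal line when some edge joins the two rows. -/
@[ext] structure Diagram (n : ℕ) where
  /-- the other endpoint of the edge at a node -/
  other : ℤ ⊕ ℤ → ℤ ⊕ ℤ
  other_other : ∀ x, other (other x) = x
  other_ne : ∀ x, other x ≠ x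
  other_translate : ∀ x, other (translate n x) = translate n (other x)
  planar : ∀ x y, ¬ (Before x y ∧ Before y (other x) ∧ Before (other x) (other y))
  /-- the number of infinite horizontal lines -/
  lines : ℕ
  lines_eq_zero : ∀ i j, other (Sum.inl i) = Sum.inr j → lines = 0

/-! ### Stacking: nodes in several rows, strands and loops -/

/-- A pairing of the nodes of two rows, placed between the rows `r` and `s` of a bigger array. -/
def place {ρ : Type} (r s : ρ) : ℤ ⊕ ℤ → ρ × ℤ := Sum.elim (fun i => (r, i)) (fun i => (s, i))

/-- The edges of a diagram placed between the rows `r` and `s`: a node of these rows is sent to the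
other endpoint of its edge, all other nodes are fixed. -/
def act {ρ : Type} [DecidableEq ρ] (f : ℤ ⊕ ℤ → ℤ ⊕ ℤ) (r s : ρ) (p : ρ × ℤ) : ρ × ℤ :=
  if p.1 = r then place r s (f (Sum.inl p.2))
  else if p.1 = s then place r s (f (Sum.inr p.2)) else p

/-- Two nodes are connected if a path of edges leads from one to the other. -/
def Conn {P : Type} (S : Set (P → P)) : P → P → Prop :=
  Relation.ReflTransGen (fun p q => ∃ g ∈ S, q = g p)

/-- Horizontal translation in an array of rows of nodes. -/
def tr {ρ : Type} (k : ℤ) (p : ρ × ℤ) : ρ × ℤ := (p.1, p.2 + k)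

/-- Connectedness on the cylinder, i.e. up to translation by multiples of `n`. -/
def CylConn {ρ : Type} (n : ℕ) (S : Set (ρ × ℤ → ρ × ℤ)) (p q : ρ × ℤ) : Prop :=
  ∃ m : ℤ, Conn S p (tr (m * n) q)

/-- The connected component of `p` winds around the cylinder. -/
def Winds {ρ : Type} (n : ℕ) (S : Set (ρ × ℤ → ρ × ℤ)) (p : ρ × ℤ) : Prop :=
  ∃ m : ℤ, m ≠ 0 ∧ Conn S p (tr (m * n) p)

/-- The components on the cylinder (as sets of nodes) which only meet the inner rows `I`, that is,
the closed loops; those which wind around the cylinder if `w` is true, and those which are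
contractible if `w` is false. -/
def loopSet {ρ : Type} (n : ℕ) (S : Set (ρ × ℤ → ρ × ℤ)) (I : Set ρ) (w : Prop) :
    Set (Set (ρ × ℤ)) :=
  {c | ∃ p, c = {q | CylConn n S p q} ∧ (∀ q, Conn S p q → q.1 ∈ I) ∧ (Winds n S p ↔ w)}

/-- The edges obtained by putting a diagram with pairing `f` on top of one with pairing `g`: the
rows are `0` (top), `1` (middle) and `2` (bottom). -/
def stack (f g : ℤ ⊕ ℤ → ℤ ⊕ ℤ) : Set (Fin 3 × ℤ → Fin 3 × ℤ) := {act f 0 1, act g 1 2}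

/-- The number of contractible loops formed when `A` is put on top of `B`. -/
noncomputable def Diagram.loops {n : ℕ} (A B : Diagram n) : ℕ :=
  (loopSet n (stack A.other B.other) {1} False).ncard

/-- The number of loops around the cylinder formed when `A` is put on top of `B`. -/
noncomputable def Diagram.newLines {n : ℕ} (A B : Diagram n) : ℕ :=
  (loopSet n (stack A.other B.other) {1} True).ncard

/-! ### Strands end exactly twice -/

section Dihedral

variable {P : Type}

theorem conn_symm {S : Set (P → P)} (hS : ∀ g ∈ S, Function.Involutive g) {p q : P}
    (h : Conn S p q) : Conn S q p := by
  induction h with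
  | refl => exact Relation.ReflTransGen.refl
  | tail _ hs ih =>
    obtain ⟨g, hg, rfl⟩ := hs
    exact Relation.ReflTransGen.head ⟨g, hg, (hS g hg _).symm⟩ ih

theorem conn_step {S : Set (P → P)} {g : P → P} (hg : g ∈ S) (p : P) : Conn S p (g p) :=
  Relation.ReflTransGen.single ⟨g, hg, rfl⟩

theorem conn_mono {S S' : Set (P → P)} (hS : S ⊆ S') {p q : P} (h : Conn S p q) : Conn S' p q := by
  induction h with
  | refl => exact Relation.ReflTransGen.refl
  | tail _ hs ih =>
    obtain ⟨g, hg, rfl⟩ := hs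
    exact ih.tail ⟨g, hS hg, rfl⟩

theorem pair_involutive {a b : P → P} (ha : Function.Involutive a) (hb : Function.Involutive b) :
    ∀ g ∈ ({a, b} : Set (P → P)), Function.Involutive g := by
  rintro g (rfl | rfl) <;> assumption

/-- Reflection of a strand starting at a fixed point of `b`. -/
theorem reflect_b (a b : Equiv.Perm P) (ha : a * a = 1) (hb : b * b = 1) {x : P} (hx : b x = x)
    (k : ℤ) : b (((b * a) ^ k) x) = ((b * a) ^ (-k)) x := by
  have hbi : b⁻¹ = b := inv_eq_of_mul_eq_one_left hb
  have hai : a⁻¹ = a := inv_eq_of_mul_eq_one_left ha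
  have h1 : b * (b * a) ^ k * b⁻¹ = (b * a) ^ (-k) := by
    rw [← conj_zpow, zpow_neg, ← inv_zpow]
    congr 1
    rw [mul_inv_rev, hai, hbi, ← mul_assoc, hb, one_mul]
  rw [← h1, hbi]
  simp [Equiv.Perm.mul_apply, hx]

theorem reflect_a (a b : Equiv.Perm P) (ha : a * a = 1) (hb : b * b = 1) {x : P} (hx : b x = x)
    (k : ℤ) : a (((b * a) ^ k) x) = ((b * a) ^ (-(1 + k))) x := by
  rw [← reflect_b a b ha hb hx, zpow_one_add, Equiv.Perm.mul_apply, Equiv.Perm.mul_apply,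
    ← Equiv.Perm.mul_apply b b, hb]
  rfl

/-- Along a strand starting at a fixed point of `b`, all nodes are `(b a)^k x`. -/
theorem conn_zpow (a b : Equiv.Perm P) (ha : a * a = 1) (hb : b * b = 1) {x y : P} (hx : b x = x)
    (h : Conn {⇑a, ⇑b} x y) : ∃ k : ℤ, y = ((b * a) ^ k) x := by
  induction h with
  | refl => exact ⟨0, by simp⟩
  | tail _ hs ih =>
    obtain ⟨k, rfl⟩ := ih
    obtain ⟨g, hg, rfl⟩ := hs
    rcases hg with rfl | rfl
    · exact ⟨_, reflect_a a b ha hb hx k⟩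
    · exact ⟨_, reflect_b a b ha hb hx k⟩

theorem zpow_eq_iff (π : Equiv.Perm P) (x : P) (k l : ℤ) :
    (π ^ k) x = (π ^ l) x ↔ (MulAction.period π x : ℤ) ∣ k - l := by
  rw [← MulAction.zpow_smul_eq_iff_period_dvd, Equiv.Perm.smul_def, sub_eq_neg_add, zpow_add,
    Equiv.Perm.mul_apply, zpow_neg, Equiv.Perm.inv_eq_iff_eq]

theorem two_ends_aux (a b : Equiv.Perm P) (ha : a * a = 1) (hb : b * b = 1) {x y z : P}
    (hx : b x = x) (hy : a y = y ∨ b y = y) (hz : a z = z ∨ b z = z)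
    (hxy : Conn {⇑a, ⇑b} x y) (hxz : Conn {⇑a, ⇑b} x z) (nxy : y ≠ x) (nxz : z ≠ x) : y = z := by
  obtain ⟨k, rfl⟩ := conn_zpow a b ha hb hx hxy
  obtain ⟨l, rfl⟩ := conn_zpow a b ha hb hx hxz
  rw [reflect_a a b ha hb hx, reflect_b a b ha hb hx, zpow_eq_iff, zpow_eq_iff] at hy hz
  have e0 : ∀ k : ℤ, ((b * a) ^ k) x = x ↔ (MulAction.period (b * a) x : ℤ) ∣ k := by
    intro k
    have := zpow_eq_iff (b * a) x k 0
    simpa using this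
  rw [Ne, e0] at nxy nxz
  rw [zpow_eq_iff]
  generalize (MulAction.period (b * a) x : ℤ) = h at *
  have par : ∀ k : ℤ, h ∣ -(1 + k) - k → Odd h := by
    rintro k ⟨c, hc⟩
    have : Odd (h * c) := ⟨-k - 1, by omega⟩
    exact (Int.odd_mul.mp this).1
  have half : ∀ k : ℤ, Odd h → h ∣ 2 * k → h ∣ k := by
    intro k ho hd
    have : IsCoprime h 2 := by
      obtain ⟨c, hc⟩ := ho
      exact ⟨1, -c, by rw [hc]; ring⟩
    exact this.dvd_of_dvd_mul_left hd
  have ev : ∀ k : ℤ, h ∣ -k - k → h ∣ 2 * k := by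
    intro k hk
    have : 2 * k = -(-k - k) := by ring
    rw [this]
    exact hk.neg_right
  rcases hy with hy | hy <;> rcases hz with hz | hz
  · refine half _ (par k hy) ?_
    have : 2 * (k - l) = (-(1 + l) - l) - (-(1 + k) - k) := by ring
    rw [this]
    exact dvd_sub hz hy
  · exact absurd (half l (par k hy) (ev l hz)) nxz
  · exact absurd (half k (par l hz) (ev k hy)) nxy
  · obtain ⟨c, hc⟩ := ev k hy
    obtain ⟨d, hd⟩ := ev l hz
    have hodd : ∀ k c : ℤ, ¬ h ∣ k → 2 * k = h * c → ∃ e, c = 2 * e + 1 := by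
      intro k c hk hc
      rcases Int.even_or_odd c with ⟨e, he⟩ | ⟨e, he⟩
      · exact absurd ⟨e, by subst he; linarith⟩ hk
      · exact ⟨e, he⟩
    obtain ⟨e, rfl⟩ := hodd k c nxy hc
    obtain ⟨e', rfl⟩ := hodd l d nxz hd
    exact ⟨e - e', by linarith⟩

/-- A strand has at most two ends. -/
theorem two_ends {a b : P → P} (ha : Function.Involutive a) (hb : Function.Involutive b) {x y z : P}
    (hx : a x = x ∨ b x = x) (hy : a y = y ∨ b y = y) (hz : a z = z ∨ b z = z)
    (hxy : Conn {a, b} x y) (hxz : Conn {a, b} x z) (nxy : y ≠ x) (nxz : z ≠ x) : y = z := by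
  have ea : ha.toPerm * ha.toPerm = 1 := Equiv.ext fun x => ha x
  have eb : hb.toPerm * hb.toPerm = 1 := Equiv.ext fun x => hb x
  rcases hx with hx | hx
  · rw [Set.pair_comm] at hxy hxz
    exact two_ends_aux hb.toPerm ha.toPerm eb ea hx hy.symm hz.symm hxy hxz nxy nxz
  · exact two_ends_aux ha.toPerm hb.toPerm ea eb hx hy hz hxy hxz nxy nxz

theorem conn_zpow_self (a b : Equiv.Perm P) (ha : a * a = 1) (hb : b * b = 1) {x : P}
    (hx : b x = x) (k : ℤ) : Conn {⇑a, ⇑b} x (((b * a) ^ k) x) := by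
  have nat : ∀ k : ℕ, Conn {⇑a, ⇑b} x (((b * a) ^ (k : ℤ)) x) := by
    intro k
    induction k with
    | zero => exact Relation.ReflTransGen.refl
    | succ k ih =>
      rw [Nat.cast_succ, add_comm, zpow_one_add, Equiv.Perm.mul_apply, Equiv.Perm.mul_apply]
      exact (ih.trans (conn_step (by simp) _)).trans (conn_step (by simp) _)
  obtain ⟨m, rfl | rfl⟩ := k.eq_nat_or_neg
  · exact nat m
  · rw [← reflect_b a b ha hb hx]
    exact (nat m).trans (conn_step (by simp) _)

theorem other_end_aux (a b : Equiv.Perm P) (ha : a * a = 1) (hb : b * b = 1) {x : P}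
    (hx : b x = x) (hax : a x ≠ x) {N : ℕ} (hN : 0 < N) (hp : ((b * a) ^ N) x = x) :
    ∃ y, y ≠ x ∧ (a y = y ∨ b y = y) ∧ Conn {⇑a, ⇑b} x y := by
  have e0 : ∀ k : ℤ, ((b * a) ^ k) x = x ↔ (MulAction.period (b * a) x : ℤ) ∣ k := by
    intro k
    have := zpow_eq_iff (b * a) x k 0
    simpa using this
  have hdvd : (MulAction.period (b * a) x : ℤ) ∣ N := (e0 N).1 (by simpa using hp)
  have hh : 0 < MulAction.period (b * a) x := by
    rcases Nat.eq_zero_or_pos (MulAction.period (b * a) x) with h | h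
    · rw [h] at hdvd; simp at hdvd; omega
    · exact h
  have h1 : MulAction.period (b * a) x ≠ 1 := by
    intro h1
    have := (e0 1).2 (by rw [h1]; simp)
    rw [zpow_one, Equiv.Perm.mul_apply] at this
    apply hax
    have h2 : b (b (a x)) = a x := by
      rw [← Equiv.Perm.mul_apply b b, hb]; rfl
    rw [← h2, this, hx]
  refine ⟨((b * a) ^ ((MulAction.period (b * a) x / 2 : ℕ) : ℤ)) x, ?_, ?_,
    conn_zpow_self a b ha hb hx _⟩
  · rw [Ne, e0]
    intro hd
    have := Int.le_of_dvd (by omega) hd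
    omega
  · rw [reflect_a a b ha hb hx, reflect_b a b ha hb hx, zpow_eq_iff, zpow_eq_iff]
    generalize MulAction.period (b * a) x = h at *
    rcases Nat.even_or_odd h with ⟨c, hc⟩ | ⟨c, hc⟩
    · right; exact ⟨-1, by omega⟩
    · left; exact ⟨-1, by omega⟩

end Dihedral

/-! ### Translations and periodicity -/

section Period

variable {ρ : Type}

theorem tr_zero (p : ρ × ℤ) : tr 0 p = p := by simp [tr]

theorem tr_tr (k l : ℤ) (p : ρ × ℤ) : tr k (tr l p) = tr (k + l) p := by
  simp only [tr, Prod.mk.injEq, true_and]; ring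

/-- A map commuting with the translation by `n`. -/
def Comm (n : ℕ) (g : ρ × ℤ → ρ × ℤ) : Prop := ∀ p, g (tr n p) = tr n (g p)

theorem Comm.zmul {n : ℕ} {g : ρ × ℤ → ρ × ℤ} (hg : Comm n g) (m : ℤ) (p : ρ × ℤ) :
    g (tr (m * n) p) = tr (m * n) (g p) := by
  induction m generalizing p with
  | zero => simp [tr_zero]
  | succ m ih =>
    have : ((m : ℤ) + 1) * (n : ℤ) = n + m * n := by ring
    rw [this, ← tr_tr, hg, ih, tr_tr]
  | pred m ih =>
    have h : (-(m : ℤ) - 1) * (n : ℤ) = -n + (-m) * n := by ring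
    have e : ∀ q : ρ × ℤ, g (tr (-(n : ℤ)) q) = tr (-(n : ℤ)) (g q) := by
      intro q
      have h2 := hg (tr (-(n : ℤ)) q)
      rw [tr_tr, add_neg_cancel, tr_zero] at h2
      rw [h2, tr_tr, neg_add_cancel, tr_zero]
    rw [h, ← tr_tr, e, ih, tr_tr]

theorem conn_tr {n : ℕ} {S : Set (ρ × ℤ → ρ × ℤ)} (hS : ∀ g ∈ S, Comm n g) (m : ℤ)
    {p q : ρ × ℤ} (h : Conn S p q) : Conn S (tr (m * n) p) (tr (m * n) q) := by
  induction h with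
  | refl => exact Relation.ReflTransGen.refl
  | tail _ hs ih =>
    obtain ⟨g, hg, rfl⟩ := hs
    exact ih.tail ⟨g, hg, ((hS g hg).zmul m _).symm⟩

theorem comm_pow {n : ℕ} {π : Equiv.Perm (ρ × ℤ)} (hπ : Comm n π) (k : ℕ) (m : ℤ) (p : ρ × ℤ) :
    (π ^ k) (tr (m * n) p) = tr (m * n) ((π ^ k) p) := by
  induction k generalizing p with
  | zero => simp
  | succ k ih => rw [pow_succ, Equiv.Perm.mul_apply, hπ.zmul, ih, Equiv.Perm.mul_apply]

theorem exists_period [Finite ρ] {n : ℕ} [NeZero n] (a b : Equiv.Perm (ρ × ℤ)) (ha : a * a = 1)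
    (hb : b * b = 1) (ca : Comm n a) (cb : Comm n b) {x : ρ × ℤ} (hx : b x = x) :
    ∃ N, 0 < N ∧ ((b * a) ^ N) x = x := by
  have hc : Comm n (b * a : Equiv.Perm (ρ × ℤ)) := fun p => by
    rw [Equiv.Perm.mul_apply, Equiv.Perm.mul_apply, ca, cb]
  obtain ⟨k, l, hkl, he⟩ := Finite.exists_ne_map_eq_of_infinite
    (fun k : ℕ => ((((b * a) ^ k) x).1, (((((b * a) ^ k) x).2 : ℤ) : ZMod n)))
  wlog h : k < l generalizing k l
  · exact this l k hkl.symm he.symm (by omega)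
  rw [Prod.mk.injEq, ZMod.intCast_eq_intCast_iff_dvd_sub] at he
  obtain ⟨h1, m, h2⟩ := he
  have e1 : ((b * a) ^ l) x = tr (m * n) (((b * a) ^ k) x) := by
    ext
    · exact h1.symm
    · simp only [tr]; linarith
  have e2 : ((b * a) ^ (l - k)) x = tr (m * n) x := by
    apply ((b * a) ^ k).injective
    rw [comm_pow hc, ← e1, ← Equiv.Perm.mul_apply, ← pow_add, Nat.add_sub_cancel' h.le]
  have e3 : ((b * a) ^ (-((l - k : ℕ) : ℤ))) x = tr (m * n) x := by
    rw [← reflect_b a b ha hb hx, zpow_natCast, e2, cb.zmul, hx]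
  rw [zpow_neg, zpow_natCast, Equiv.Perm.inv_eq_iff_eq] at e3
  have e4 : x = tr (m * n) (tr (m * n) x) := by
    rw [comm_pow hc, e2] at e3
    exact e3
  have hm : m = 0 := by
    have := congrArg Prod.snd e4
    simp only [tr] at this
    have hn := NeZero.ne n
    have : m * n = 0 := by linarith
    rcases mul_eq_zero.1 this with h | h
    · exact h
    · exact absurd (by exact_mod_cast h) hn
  exact ⟨l - k, by omega, by rw [e2, hm, zero_mul, tr_zero]⟩

/-- A strand has another end. -/
theorem other_end [Finite ρ] {n : ℕ} [NeZero n] {a b : ρ × ℤ → ρ × ℤ} (ha : Function.Involutive a)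
    (hb : Function.Involutive b) (ca : Comm n a) (cb : Comm n b) {x : ρ × ℤ}
    (hx : a x = x ∨ b x = x) (hx' : ¬ (a x = x ∧ b x = x)) :
    ∃ y, y ≠ x ∧ (a y = y ∨ b y = y) ∧ Conn {a, b} x y := by
  have ea : ha.toPerm * ha.toPerm = 1 := Equiv.ext fun x => ha x
  have eb : hb.toPerm * hb.toPerm = 1 := Equiv.ext fun x => hb x
  rcases hx with hx | hx
  · obtain ⟨N, hN, h⟩ := exists_period hb.toPerm ha.toPerm eb ea cb ca hx
    obtain ⟨y, h1, h2, h3⟩ := other_end_aux hb.toPerm ha.toPerm eb ea hx (fun h => hx' ⟨hx, h⟩) hN h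
    exact ⟨y, h1, h2.symm, by rw [Set.pair_comm]; exact h3⟩
  · obtain ⟨N, hN, h⟩ := exists_period ha.toPerm hb.toPerm ea eb ca cb hx
    exact other_end_aux ha.toPerm hb.toPerm ea eb hx (fun h => hx' ⟨h, hx⟩) hN h

/-- A strand with an end is finite. -/
theorem strand_finite [Finite ρ] {n : ℕ} [NeZero n] {a b : ρ × ℤ → ρ × ℤ}
    (ha : Function.Involutive a) (hb : Function.Involutive b) (ca : Comm n a) (cb : Comm n b)
    {x : ρ × ℤ} (hx : a x = x ∨ b x = x) : {y | Conn {a, b} x y}.Finite := by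
  have main : ∀ a b : Equiv.Perm (ρ × ℤ), a * a = 1 → b * b = 1 → Comm n a → Comm n b →
      b x = x → {y | Conn {⇑a, ⇑b} x y}.Finite := by
    intro a b ha hb ca cb hx
    obtain ⟨N, hN, h⟩ := exists_period a b ha hb ca cb hx
    refine (Set.finite_range fun i : Fin N => ((b * a) ^ ((i : ℕ) : ℤ)) x).subset ?_
    intro y hy
    obtain ⟨k, rfl⟩ := conn_zpow a b ha hb hx hy
    have h1 : 0 ≤ k % N := Int.emod_nonneg _ (by omega)
    have h2 : k % N < N := Int.emod_lt_of_pos _ (by omega)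
    refine ⟨⟨(k % N).toNat, by omega⟩, ?_⟩
    simp only [Int.toNat_of_nonneg h1]
    rw [zpow_eq_iff]
    have hd : (MulAction.period (b * a) x : ℤ) ∣ N := by
      rw [← MulAction.zpow_smul_eq_iff_period_dvd, zpow_natCast]; exact h
    refine hd.trans ⟨-(k / N), ?_⟩
    have := Int.emod_add_mul_ediv k N
    linarith
  have ea : ha.toPerm * ha.toPerm = 1 := Equiv.ext fun x => ha x
  have eb : hb.toPerm * hb.toPerm = 1 := Equiv.ext fun x => hb x
  rcases hx with hx | hx
  · rw [Set.pair_comm]; exact main hb.toPerm ha.toPerm eb ea cb ca hx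
  · exact main ha.toPerm hb.toPerm ea eb ca cb hx

end Period
end AffineTL

namespace AffineTL

section Act

set_option linter.unusedSectionVars false

variable {ρ : Type} [DecidableEq ρ] {n : ℕ}

theorem place_injective {r s : ρ} (h : r ≠ s) : Function.Injective (place r s) := by
  rintro (i | i) (j | j) e <;> simp_all [place]

theorem exists_place (r s : ρ) {p : ρ × ℤ} (h : p.1 = r ∨ p.1 = s) : ∃ x, p = place r s x := by
  obtain ⟨a, i⟩ := p
  rcases h with rfl | rfl
  · exact ⟨Sum.inl i, rfl⟩
  · exact ⟨Sum.inr i, rfl⟩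

theorem place_fst (r s : ρ) (x : ℤ ⊕ ℤ) : (place r s x).1 = r ∨ (place r s x).1 = s := by
  rcases x with i | i <;> simp [place]

theorem act_place (f : ℤ ⊕ ℤ → ℤ ⊕ ℤ) {r s : ρ} (h : r ≠ s) (x : ℤ ⊕ ℤ) :
    act f r s (place r s x) = place r s (f x) := by
  rcases x with i | i <;> simp [place, act, h.symm]

theorem act_of_ne (f : ℤ ⊕ ℤ → ℤ ⊕ ℤ) {r s : ρ} {p : ρ × ℤ} (h1 : p.1 ≠ r) (h2 : p.1 ≠ s) :
    act f r s p = p := by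
  simp [act, h1, h2]

theorem act_eq_self_iff (A : Diagram n) {r s : ρ} (h : r ≠ s) (p : ρ × ℤ) :
    act A.other r s p = p ↔ p.1 ≠ r ∧ p.1 ≠ s := by
  constructor
  · intro e
    by_contra hc
    obtain ⟨x, rfl⟩ := exists_place r s (p := p) (by tauto)
    rw [act_place _ h] at e
    exact A.other_ne x (place_injective h e)
  · rintro ⟨h1, h2⟩
    exact act_of_ne _ h1 h2

theorem act_involutive (A : Diagram n) {r s : ρ} (h : r ≠ s) :
    Function.Involutive (act A.other r s) := by
  intro p
  by_cases hp : p.1 = r ∨ p.1 = s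
  · obtain ⟨x, rfl⟩ := exists_place r s hp
    rw [act_place _ h, act_place _ h, A.other_other]
  · push Not at hp
    rw [act_of_ne _ hp.1 hp.2, act_of_ne _ hp.1 hp.2]

theorem tr_place (r s : ρ) (k : ℤ) (x : ℤ ⊕ ℤ) :
    tr k (place r s x) = place r s (translate k x) := by
  rcases x with i | i <;> rfl

theorem act_comm (A : Diagram n) {r s : ρ} (h : r ≠ s) : Comm n (act A.other r s) := by
  intro p
  by_cases hp : p.1 = r ∨ p.1 = s
  · obtain ⟨x, rfl⟩ := exists_place r s hp
    rw [tr_place, act_place _ h, act_place _ h, A.other_translate, tr_place]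
  · push Not at hp
    rw [act_of_ne _ hp.1 hp.2, act_of_ne _ (by exact hp.1) (by exact hp.2)]

/-- `A` between the rows `r`, `s` and `B` between the rows `s`, `t`. -/
def stackAt (f g : ℤ ⊕ ℤ → ℤ ⊕ ℤ) (r s t : ρ) : Set (ρ × ℤ → ρ × ℤ) := {act f r s, act g s t}

theorem stackAt_involutive (A B : Diagram n) {r s t : ρ} (h1 : r ≠ s) (h2 : s ≠ t) :
    ∀ g ∈ stackAt A.other B.other r s t, Function.Involutive g :=
  pair_involutive (act_involutive A h1) (act_involutive B h2)

theorem stackAt_comm (A B : Diagram n) {r s t : ρ} (h1 : r ≠ s) (h2 : s ≠ t) :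
    ∀ g ∈ stackAt A.other B.other r s t, Comm n g := by
  rintro g (rfl | rfl)
  · exact act_comm A h1
  · exact act_comm B h2

theorem outer_fixed (A B : Diagram n) {r s t : ρ} (h1 : r ≠ s) (h2 : s ≠ t) (h3 : r ≠ t)
    {p : ρ × ℤ} (hp : p.1 ≠ s) : act A.other r s p = p ∨ act B.other s t p = p := by
  rw [act_eq_self_iff A h1, act_eq_self_iff B h2]
  by_cases h : p.1 = r
  · right; exact ⟨hp, fun e => h3 (h.symm.trans e)⟩
  · left; exact ⟨h, hp⟩

theorem place_ne_mid {r s t : ρ} (h1 : r ≠ s) (h2 : s ≠ t) (x : ℤ ⊕ ℤ) : (place r t x).1 ≠ s := by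
  rcases place_fst r t x with e | e <;> rw [e]
  · exact h1
  · exact h2.symm

end Act

namespace Diagram

variable {n : ℕ}

theorem stack_eq (f g : ℤ ⊕ ℤ → ℤ ⊕ ℤ) : stack f g = stackAt f g 0 1 2 := rfl

theorem exists_strand [NeZero n] (A B : Diagram n) (x : ℤ ⊕ ℤ) :
    ∃ y, y ≠ x ∧ Conn (stack A.other B.other) (place 0 2 x) (place 0 2 y) := by
  have h1 : (0 : Fin 3) ≠ 1 := by decide
  have h2 : (1 : Fin 3) ≠ 2 := by decide
  have h3 : (0 : Fin 3) ≠ 2 := by decide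
  obtain ⟨p, hp1, hp2, hp3⟩ := other_end (act_involutive A h1) (act_involutive B h2)
    (act_comm A h1) (act_comm B h2) (x := place 0 2 x)
    (outer_fixed A B h1 h2 h3 (place_ne_mid h1 h2 x)) (by
      rw [act_eq_self_iff A h1, act_eq_self_iff B h2]
      rcases place_fst (0 : Fin 3) 2 x with e | e <;> simp [e])
  rw [act_eq_self_iff A h1, act_eq_self_iff B h2] at hp2
  obtain ⟨y, rfl⟩ := exists_place (0 : Fin 3) 2 (p := p) (by
    obtain ⟨r, i⟩ := p
    fin_cases r <;> simp_all)
  exact ⟨y, fun e => hp1 (by rw [e]), hp3⟩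

/-- The pairing of the outer nodes when `A` is put on top of `B`: a node is joined to the other
end of its strand. -/
noncomputable def strandEnd [NeZero n] (A B : Diagram n) (x : ℤ ⊕ ℤ) : ℤ ⊕ ℤ :=
  Classical.choose (exists_strand A B x)

theorem strandEnd_ne [NeZero n] (A B : Diagram n) (x : ℤ ⊕ ℤ) : strandEnd A B x ≠ x :=
  (Classical.choose_spec (exists_strand A B x)).1

theorem conn_strandEnd [NeZero n] (A B : Diagram n) (x : ℤ ⊕ ℤ) :
    Conn (stack A.other B.other) (place 0 2 x) (place 0 2 (strandEnd A B x)) :=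
  (Classical.choose_spec (exists_strand A B x)).2

section Transport

set_option linter.unusedSectionVars false

variable {ρ : Type} [DecidableEq ρ]

/-- Relabelling of the three rows. -/
def rows (r s t : ρ) : Fin 3 × ℤ → ρ × ℤ := fun p => (![r, s, t] p.1, p.2)

theorem rows_act01 (f : ℤ ⊕ ℤ → ℤ ⊕ ℤ) {r s t : ρ} (h1 : r ≠ s) (h2 : s ≠ t) (h3 : r ≠ t)
    (p : Fin 3 × ℤ) : act f r s (rows r s t p) = rows r s t (act f 0 1 p) := by
  have e : ∀ x, rows r s t (place 0 1 x) = place r s x := by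
    rintro (i | i) <;> rfl
  by_cases hp : p.1 = 0 ∨ p.1 = 1
  · obtain ⟨x, rfl⟩ := exists_place (0 : Fin 3) 1 hp
    rw [act_place _ (by decide), e, e, act_place _ h1]
  · push Not at hp
    have h : p.1 = 2 := by omega
    rw [act_of_ne _ hp.1 hp.2, act_of_ne] <;> simp [rows, h, h3.symm, h2.symm]

theorem rows_act12 (f : ℤ ⊕ ℤ → ℤ ⊕ ℤ) {r s t : ρ} (h1 : r ≠ s) (h2 : s ≠ t) (h3 : r ≠ t)
    (p : Fin 3 × ℤ) : act f s t (rows r s t p) = rows r s t (act f 1 2 p) := by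
  have e : ∀ x, rows r s t (place 1 2 x) = place s t x := by
    rintro (i | i) <;> rfl
  by_cases hp : p.1 = 1 ∨ p.1 = 2
  · obtain ⟨x, rfl⟩ := exists_place (1 : Fin 3) 2 hp
    rw [act_place _ (by decide), e, e, act_place _ h2]
  · push Not at hp
    have h : p.1 = 0 := by omega
    rw [act_of_ne _ hp.1 hp.2, act_of_ne] <;> simp [rows, h, h3, h1]

theorem rows_place (r s t : ρ) (x : ℤ ⊕ ℤ) : rows r s t (place 0 2 x) = place r t x := by
  rcases x with i | i <;> rfl

theorem rows_injective {r s t : ρ} (h1 : r ≠ s) (h2 : s ≠ t) (h3 : r ≠ t) :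
    Function.Injective (rows r s t) := by
  rintro ⟨a, i⟩ ⟨b, j⟩ h
  simp only [rows, Prod.mk.injEq] at h
  obtain ⟨h, rfl⟩ := h
  fin_cases a <;> fin_cases b <;> simp_all [eq_comm]

theorem conn_rows (f g : ℤ ⊕ ℤ → ℤ ⊕ ℤ) {r s t : ρ} (h1 : r ≠ s) (h2 : s ≠ t) (h3 : r ≠ t)
    (p : Fin 3 × ℤ) (q : ρ × ℤ) : Conn (stackAt f g r s t) (rows r s t p) q ↔
      ∃ q', q = rows r s t q' ∧ Conn (stack f g) p q' := by
  constructor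
  · intro h
    induction h with
    | refl => exact ⟨p, rfl, Relation.ReflTransGen.refl⟩
    | tail _ hs ih =>
      obtain ⟨q', rfl, hq⟩ := ih
      obtain ⟨k, rfl | rfl, rfl⟩ := hs
      · exact ⟨_, rows_act01 f h1 h2 h3 q', hq.trans (conn_step (by simp [stack]) _)⟩
      · exact ⟨_, rows_act12 g h1 h2 h3 q', hq.trans (conn_step (by simp [stack]) _)⟩
  · rintro ⟨q', rfl, h⟩
    induction h with
    | refl => exact Relation.ReflTransGen.refl
    | tail _ hs ih =>
      obtain ⟨k, rfl | rfl, rfl⟩ := hs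
      · exact ih.tail ⟨_, Or.inl rfl, (rows_act01 f h1 h2 h3 _).symm⟩
      · exact ih.tail ⟨_, Or.inr rfl, (rows_act12 g h1 h2 h3 _).symm⟩

/-- Characterization of the strands of a stack. -/
theorem conn_outer [NeZero n] (A B : Diagram n) {r s t : ρ} (h1 : r ≠ s) (h2 : s ≠ t)
    (h3 : r ≠ t) {p q : ρ × ℤ} (hp : p.1 ≠ s) (hq : q.1 ≠ s) :
    Conn (stackAt A.other B.other r s t) p q ↔ q = p ∨ q = act (strandEnd A B) r t p := by
  have key : ∀ x, Conn (stackAt A.other B.other r s t) (place r t x)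
      (place r t (strandEnd A B x)) := fun x => by
    rw [← rows_place r s t, conn_rows _ _ h1 h2 h3]
    exact ⟨_, (rows_place r s t _).symm, conn_strandEnd A B x⟩
  constructor
  · intro h
    by_cases hr : p.1 = r ∨ p.1 = t
    · obtain ⟨x, rfl⟩ := exists_place r t hr
      rw [act_place _ h3]
      by_contra hc
      push Not at hc
      exact hc.2 (two_ends (act_involutive A h1) (act_involutive B h2)
        (outer_fixed A B h1 h2 h3 hp) (outer_fixed A B h1 h2 h3 hq)
        (outer_fixed A B h1 h2 h3 (place_ne_mid h1 h2 _)) h (key x) hc.1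
        (fun e => strandEnd_ne A B x (place_injective h3 e)))
    · push Not at hr
      left
      have : ∀ q', Conn (stackAt A.other B.other r s t) p q' → q' = p := by
        intro q' h'
        induction h' with
        | refl => rfl
        | tail _ hs ih =>
          obtain ⟨k, rfl | rfl, rfl⟩ := hs
          · rw [ih, act_of_ne _ hr.1 hp]
          · rw [ih, act_of_ne _ hp hr.2]
      exact this q h
  · rintro (rfl | rfl)
    · exact Relation.ReflTransGen.refl
    · by_cases hr : p.1 = r ∨ p.1 = t
      · obtain ⟨x, rfl⟩ := exists_place r t hr
        rw [act_place _ h3]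
        exact key x
      · push Not at hr
        rw [act_of_ne _ hr.1 hr.2]
        exact Relation.ReflTransGen.refl

end Transport

end Diagram
end AffineTL

namespace AffineTL

/-! ### Stacked diagrams are planar: a parity argument -/

section Parity

open Classical in
/-- `1` if `x` comes before `y` along the boundary and `0` otherwise, modulo two. -/
noncomputable def sgn (x y : ℤ ⊕ ℤ) : ZMod 2 := if Before x y then 1 else 0

theorem sgn_inl_inr (i j : ℤ) : sgn (Sum.inl i) (Sum.inr j) = 1 := by simp [sgn, Before]

theorem sgn_inr_inl (i j : ℤ) : sgn (Sum.inr i) (Sum.inl j) = 0 := by simp [sgn, Before]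

theorem sgn_inl_inl (i j : ℤ) : sgn (Sum.inl i) (Sum.inl j) = if i < j then 1 else 0 := by
  by_cases h : i < j <;> simp [sgn, Before, h]

theorem sgn_inr_inr (i j : ℤ) : sgn (Sum.inr i) (Sum.inr j) = if j < i then 1 else 0 := by
  by_cases h : j < i <;> simp [sgn, Before, h]

theorem before_irrefl (x : ℤ ⊕ ℤ) : ¬ Before x x := by
  rcases x with i | i <;> simp [Before]

theorem before_trans {x y z : ℤ ⊕ ℤ} (h : Before x y) (h' : Before y z) : Before x z := by
  rcases x with i | i <;> rcases y with j | j <;> rcases z with k | k <;>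
    simp_all [Before]
  all_goals omega

theorem before_total {x y : ℤ ⊕ ℤ} (h : x ≠ y) : Before x y ∨ Before y x := by
  rcases x with i | i <;> rcases y with j | j <;> simp_all [Before]
  all_goals omega

theorem before_asymm {x y : ℤ ⊕ ℤ} (h : Before x y) : ¬ Before y x :=
  fun h' => before_irrefl x (before_trans h h')

theorem zmod2_add_self (a : ZMod 2) : a + a = 0 := by
  revert a; decide

variable {n : ℕ} (A B : Diagram n)

/-- Two different edges of a diagram separate each other an even number of times. -/
theorem sgn_edges {x y : ℤ ⊕ ℤ} (h1 : y ≠ x) (h2 : y ≠ A.other x) :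
    (sgn x y + sgn x (A.other y)) + (sgn (A.other x) y + sgn (A.other x) (A.other y)) = 0 := by
  have p1 := A.planar x y
  have p2 := A.planar x (A.other y)
  have p3 := A.planar (A.other x) y
  have p4 := A.planar (A.other x) (A.other y)
  have p5 := A.planar y x
  have p6 := A.planar y (A.other x)
  have p7 := A.planar (A.other y) x
  have p8 := A.planar (A.other y) (A.other x)
  rw [A.other_other] at p2 p3 p4 p6 p7 p8
  rw [A.other_other] at p4 p8
  have h3 : A.other y ≠ x := fun e => h2 (by rw [← e, A.other_other])
  have h4 : A.other y ≠ A.other x := fun e => h1 (by rw [← A.other_other y, e, A.other_other])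
  have o1 := A.other_ne x
  have o2 := A.other_ne y
  generalize A.other x = x' at *
  generalize A.other y = y' at *
  rcases x with i | i <;> rcases x' with i' | i' <;> rcases y with j | j <;>
    rcases y' with j' | j' <;>
    simp only [sgn_inl_inr, sgn_inr_inl, sgn_inl_inl, sgn_inr_inr, Before,
      Sum.inl.injEq, Sum.inr.injEq, ne_eq, reduceCtorEq, not_false_eq_true, true_and, and_true,
      false_and, and_false] at * <;>
    (try split_ifs) <;> first | decide | (exfalso; omega)

theorem sum_sgn_other (U : Finset (ℤ ⊕ ℤ)) (hU : ∀ x ∈ U, A.other x ∈ U) {y : ℤ ⊕ ℤ}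
    (hy : y ∉ U) : ∑ x ∈ U, sgn x (A.other y) = ∑ x ∈ U, sgn x y := by
  have h : ∑ x ∈ U, (sgn x y + sgn x (A.other y)) = 0 := by
    refine Finset.sum_involution (fun x _ => A.other x) ?_ (fun x _ _ => A.other_ne x) hU
      (fun x _ => A.other_other x)
    intro x hx
    exact sgn_edges A (fun e => hy (e ▸ hx)) (fun e => hy (e ▸ hU x hx))
  rw [Finset.sum_add_distrib, CharTwo.add_eq_zero] at h
  exact h.symm

theorem card_even (U : Finset (ℤ ⊕ ℤ)) (hU : ∀ x ∈ U, A.other x ∈ U) : (U.card : ZMod 2) = 0 := by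
  have h : ∑ x ∈ U, (1 : ZMod 2) = 0 :=
    Finset.sum_involution (fun x _ => A.other x) (fun x _ => by decide)
      (fun x _ _ => A.other_ne x) hU (fun x _ => A.other_other x)
  simpa using h

/-- The parity of the number of times a node is separated from the start of the boundary by a
finite union of strands, given by its sets `X r` of nodes in the row `r`. -/
noncomputable def level (X : Fin 3 → Finset ℤ) (p : Fin 3 × ℤ) : ZMod 2 :=
  if p.1 = 2 then ∑ x ∈ (X 1).disjSum (X 2), sgn x (Sum.inr p.2)
  else if p.1 = 1 then ∑ x ∈ (X 0).disjSum (X 1), sgn x (Sum.inr p.2)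
  else ∑ x ∈ (X 0).disjSum (X 1), sgn x (Sum.inl p.2)

theorem mem_disjSum_place (r s : Fin 3) (X : Fin 3 → Finset ℤ) (x : ℤ ⊕ ℤ) :
    x ∈ (X r).disjSum (X s) ↔ (place r s x).2 ∈ X (place r s x).1 := by
  rcases x with i | i <;> simp [place]

theorem level_place01 (X : Fin 3 → Finset ℤ) (y : ℤ ⊕ ℤ) :
    level X (place 0 1 y) = ∑ x ∈ (X 0).disjSum (X 1), sgn x y := by
  rcases y with i | i <;> simp [level, place]

/-- `X` describes a union of components of the stack of `A` and `B`. -/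
def Closed (X : Fin 3 → Finset ℤ) : Prop :=
  ∀ g ∈ stack A.other B.other, ∀ p : Fin 3 × ℤ, p.2 ∈ X p.1 → (g p).2 ∈ X (g p).1

variable {A B} {X : Fin 3 → Finset ℤ}

theorem Closed.left (hX : Closed A B X) :
    ∀ x ∈ (X 0).disjSum (X 1), A.other x ∈ (X 0).disjSum (X 1) := by
  intro x hx
  rw [mem_disjSum_place] at hx ⊢
  have := hX _ (Or.inl rfl) _ hx
  rwa [act_place _ (by decide)] at this

theorem Closed.right (hX : Closed A B X) :
    ∀ x ∈ (X 1).disjSum (X 2), B.other x ∈ (X 1).disjSum (X 2) := by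
  intro x hx
  rw [mem_disjSum_place] at hx ⊢
  have := hX _ (Or.inr rfl) _ hx
  rwa [act_place _ (by decide)] at this

theorem Closed.card01 (hX : Closed A B X) : ((X 0).card : ZMod 2) = (X 1).card := by
  have := card_even A _ hX.left
  rwa [Finset.card_disjSum, Nat.cast_add, CharTwo.add_eq_zero] at this

theorem Closed.card12 (hX : Closed A B X) : ((X 1).card : ZMod 2) = (X 2).card := by
  have := card_even B _ hX.right
  rwa [Finset.card_disjSum, Nat.cast_add, CharTwo.add_eq_zero] at this

theorem level_place12 (hX : Closed A B X) (y : ℤ ⊕ ℤ)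
    (hy : (place (1 : Fin 3) 2 y).2 ∉ X (place (1 : Fin 3) 2 y).1) :
    level X (place 1 2 y) = ∑ x ∈ (X 1).disjSum (X 2), sgn x y := by
  rcases y with i | i
  · have e : ∑ k ∈ X 1, sgn (Sum.inr k) (Sum.inr i) + ∑ k ∈ X 1, sgn (Sum.inl k) (Sum.inl i)
        = ((X 1).card : ZMod 2) := by
      rw [← Finset.sum_add_distrib, Finset.sum_congr rfl (g := fun _ => (1 : ZMod 2))]
      · simp
      · intro k hk
        have : k ≠ i := fun e => hy (by simpa [place, ← e] using hk)
        rcases lt_or_gt_of_ne this with h | h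
        · simp [sgn, Before, h, h.not_gt]
        · simp [sgn, Before, h, h.not_gt]
    simp only [level, place, Finset.sum_disjSum, Sum.elim_inl, sgn_inl_inr, sgn_inr_inl]
    simp only [Fin.isValue, Fin.reduceEq, if_false, if_true, Finset.sum_const, nsmul_eq_mul, mul_one, smul_zero,
      add_zero]
    rw [hX.card01, ← e, add_assoc, add_comm, add_assoc, zmod2_add_self, add_zero]
  · simp [level, place]

theorem level_conn (hX : Closed A B X) {p q : Fin 3 × ℤ} (hp : p.2 ∉ X p.1)
    (h : Conn (stack A.other B.other) p q) : q.2 ∉ X q.1 ∧ level X q = level X p := by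
  have inv : ∀ g ∈ stack A.other B.other, Function.Involutive g :=
    stackAt_involutive A B (r := (0 : Fin 3)) (by decide) (by decide)
  induction h with
  | refl => exact ⟨hp, rfl⟩
  | @tail q' _ _ hs ih =>
    obtain ⟨g, hg, rfl⟩ := hs
    have hn : (g q').2 ∉ X (g q').1 := fun h => ih.1 (by
      have := hX g hg _ h
      rwa [inv g hg] at this)
    refine ⟨hn, ?_⟩
    rw [← ih.2]
    rcases hg with rfl | rfl
    · by_cases hr : q'.1 = 0 ∨ q'.1 = 1
      · obtain ⟨y, rfl⟩ := exists_place (0 : Fin 3) 1 hr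
        rw [act_place _ (by decide), level_place01, level_place01]
        exact sum_sgn_other A _ hX.left (fun h => ih.1 ((mem_disjSum_place _ _ _ _).1 h))
      · push Not at hr
        rw [act_of_ne _ hr.1 hr.2]
    · by_cases hr : q'.1 = 1 ∨ q'.1 = 2
      · obtain ⟨y, rfl⟩ := exists_place (1 : Fin 3) 2 hr
        rw [act_place _ (by decide)] at hn ⊢
        rw [level_place12 hX _ hn, level_place12 hX _ ih.1]
        exact sum_sgn_other B _ hX.right (fun h => ih.1 ((mem_disjSum_place _ _ _ _).1 h))
      · push Not at hr
        rw [act_of_ne _ hr.1 hr.2]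

theorem level_place02 (hX : Closed A B X) (y : ℤ ⊕ ℤ) :
    level X (place 0 2 y) = ∑ x ∈ (X 0).disjSum (X 2), sgn x y := by
  rcases y with i | i
  · simp [level, place, Finset.sum_disjSum, sgn_inr_inl]
  · simp [level, place, Finset.sum_disjSum, sgn_inl_inr, hX.card01]

/-- The finite component of an outer node. -/
theorem exists_closed [NeZero n] (A B : Diagram n) (x : ℤ ⊕ ℤ) : ∃ X, Closed A B X ∧
    ∀ p : Fin 3 × ℤ, p.2 ∈ X p.1 ↔ Conn (stack A.other B.other) (place 0 2 x) p := by
  have hf := strand_finite (act_involutive A (r := (0 : Fin 3)) (s := 1) (by decide))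
    (act_involutive B (r := (1 : Fin 3)) (s := 2) (by decide)) (act_comm A (by decide))
    (act_comm B (by decide)) (x := place 0 2 x)
    (outer_fixed A B (by decide) (by decide) (by decide)
      (place_ne_mid (by decide) (by decide) x))
  have hfr : ∀ r : Fin 3, {i : ℤ | Conn (stack A.other B.other) (place 0 2 x) (r, i)}.Finite :=
    fun r => hf.preimage (f := fun i : ℤ => (r, i)) (fun i _ j _ h => by simpa using h)
  have hmem : ∀ p : Fin 3 × ℤ, p.2 ∈ (fun r => (hfr r).toFinset) p.1 ↔
      Conn (stack A.other B.other) (place 0 2 x) p := fun p => by simp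
  refine ⟨fun r => (hfr r).toFinset, ?_, hmem⟩
  intro g hg p hp
  rw [hmem] at hp ⊢
  exact hp.trans (conn_step hg p)

end Parity

namespace Diagram

set_option linter.unusedSectionVars false

variable {n : ℕ} [NeZero n] (A B : Diagram n)

theorem conn02_iff (x y : ℤ ⊕ ℤ) : Conn (stack A.other B.other) (place 0 2 x) (place 0 2 y) ↔
    y = x ∨ y = strandEnd A B x := by
  have := conn_outer A B (r := (0 : Fin 3)) (s := 1) (t := 2) (by decide) (by decide) (by decide)
    (p := place 0 2 x) (q := place 0 2 y) (place_ne_mid (by decide) (by decide) _)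
    (place_ne_mid (by decide) (by decide) _)
  rw [stack_eq, this, act_place _ (by decide)]
  have hi := place_injective (r := (0 : Fin 3)) (s := 2) (by decide)
  rw [hi.eq_iff, hi.eq_iff]

theorem conn02_symm {x y : ℤ ⊕ ℤ}
    (h : Conn (stack A.other B.other) (place 0 2 x) (place 0 2 y)) :
    Conn (stack A.other B.other) (place 0 2 y) (place 0 2 x) :=
  conn_symm (stackAt_involutive A B (r := (0 : Fin 3)) (by decide) (by decide)) h

theorem eq_strandEnd {x y : ℤ ⊕ ℤ} (h : y ≠ x)
    (hc : Conn (stack A.other B.other) (place 0 2 x) (place 0 2 y)) : strandEnd A B x = y :=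
  (((conn02_iff A B x y).1 hc).resolve_left h).symm

theorem strandEnd_strandEnd (x : ℤ ⊕ ℤ) : strandEnd A B (strandEnd A B x) = x :=
  eq_strandEnd A B (strandEnd_ne A B x).symm (conn02_symm A B (conn_strandEnd A B x))

theorem translate_injective (k : ℤ) : Function.Injective (translate k) := by
  rintro (i | i) (j | j) h <;> simp_all [translate]

theorem strandEnd_translate (x : ℤ ⊕ ℤ) :
    strandEnd A B (translate n x) = translate n (strandEnd A B x) := by
  refine eq_strandEnd A B (fun e => strandEnd_ne A B x (translate_injective _ e)) ?_
  have := conn_tr (stackAt_comm A B (r := (0 : Fin 3)) (by decide) (by decide)) 1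
    (conn_strandEnd A B x)
  rwa [one_mul, tr_place, tr_place] at this

theorem sum_outer {X : Fin 3 → Finset ℤ} {x : ℤ ⊕ ℤ}
    (hX : ∀ p : Fin 3 × ℤ, p.2 ∈ X p.1 ↔ Conn (stack A.other B.other) (place 0 2 x) p)
    (y : ℤ ⊕ ℤ) :
    ∑ z ∈ (X 0).disjSum (X 2), sgn z y = sgn x y + sgn (strandEnd A B x) y := by
  have : (X 0).disjSum (X 2) = {x, strandEnd A B x} := by
    ext z
    rw [mem_disjSum_place, hX, conn02_iff]
    simp
  rw [this, Finset.sum_pair (strandEnd_ne A B x).symm]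

theorem strandEnd_planar (x y : ℤ ⊕ ℤ) :
    ¬ (Before x y ∧ Before y (strandEnd A B x) ∧ Before (strandEnd A B x) (strandEnd A B y)) := by
  rintro ⟨h1, h2, h3⟩
  obtain ⟨X, hX, hm⟩ := exists_closed A B x
  have hy : (place (0 : Fin 3) 2 y).2 ∉ X (place (0 : Fin 3) 2 y).1 := by
    rw [hm, conn02_iff]
    rintro (rfl | rfl)
    · exact before_irrefl _ h1
    · exact before_irrefl _ h2
  have h := (level_conn hX hy (conn_strandEnd A B y)).2
  rw [level_place02 hX, level_place02 hX, sum_outer A B hm, sum_outer A B hm] at h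
  simp [sgn, h1, before_asymm h2, h3, before_trans h1 (before_trans h2 h3)] at h

theorem strandEnd_of_inl {i j : ℤ} (h : A.other (Sum.inl i) = Sum.inl j) :
    strandEnd A B (Sum.inl i) = Sum.inl j := by
  refine eq_strandEnd A B (fun e => A.other_ne _ (h.trans e)) ?_
  have := conn_step (S := stack A.other B.other) (Or.inl rfl) (place 0 1 (Sum.inl i))
  rwa [act_place _ (by decide), h] at this

theorem strandEnd_of_inr {i j : ℤ} (h : B.other (Sum.inr i) = Sum.inr j) :
    strandEnd A B (Sum.inr i) = Sum.inr j := by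
  refine eq_strandEnd A B (fun e => B.other_ne _ (h.trans e)) ?_
  have := conn_step (S := stack A.other B.other) (Or.inr rfl) (place 1 2 (Sum.inr i))
  rwa [act_place _ (by decide), h] at this

theorem winds_iter {ρ : Type} {S : Set (ρ × ℤ → ρ × ℤ)} (hc : ∀ g ∈ S, Comm n g) {m : ℤ}
    {p : ρ × ℤ} (h : Conn S p (tr (m * n) p)) (k : ℕ) : Conn S p (tr ((k * m : ℤ) * n) p) := by
  induction k with
  | zero =>
    simp only [Nat.cast_zero, zero_mul, tr_zero]
    exact Relation.ReflTransGen.refl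
  | succ k ih =>
    have h2 := conn_tr hc m ih
    rw [tr_tr] at h2
    have e : m * n + k * m * n = ((k + 1 : ℕ) * m : ℤ) * n := by push_cast; ring
    rw [e] at h2
    exact h.trans h2

theorem newLines_eq_zero {i j : ℤ} (h : strandEnd A B (Sum.inl i) = Sum.inr j) :
    A.newLines B = 0 := by
  have hS := stackAt_involutive A B (r := (0 : Fin 3)) (s := 1) (t := 2) (by decide) (by decide)
  have hC := stackAt_comm A B (r := (0 : Fin 3)) (s := 1) (t := 2) (by decide) (by decide)
  suffices he : loopSet n (stack A.other B.other) {1} True = ∅ by rw [newLines, he, Set.ncard_empty]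
  rw [Set.eq_empty_iff_forall_notMem]
  rintro c ⟨⟨r, c⟩, -, hrow, hw⟩
  obtain ⟨m, hm, hmc⟩ := hw.2 trivial
  have hr : r = 1 := hrow _ Relation.ReflTransGen.refl
  subst hr
  obtain ⟨X, hX, hXm⟩ := exists_closed A B (Sum.inl i)
  have hp : c ∉ X 1 := by
    intro hc
    have h1 := hrow _ (conn_symm hS ((hXm (1, c)).1 hc))
    exact absurd h1 (by simp [place])
  have h0 : X 0 = {i} := by
    ext k
    have h2 := hXm (place 0 2 (Sum.inl k))
    rw [conn02_iff, h] at h2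
    simpa [place] using h2
  have hlev : ∀ d, level X (1, d) = 1 + ∑ k ∈ X 1, if d < k then 1 else 0 := by
    intro d
    simp [level, Finset.sum_disjSum, sgn_inl_inr, sgn_inr_inr, h0]
  have hcard : ((X 1).card : ZMod 2) = 1 := by
    rw [← hX.card01, h0]
    simp
  have hiter : ∀ m : ℤ, Conn (stack A.other B.other) (1, c) (tr (m * n) (1, c)) → ∀ K : ℕ,
      level X (1, c + K * m * n) = level X (1, c) := by
    intro m hmc K
    exact (level_conn hX (p := (1, c)) hp (winds_iter hC hmc K)).2
  have hmc' : Conn (stack A.other B.other) (1, c) (tr (-m * n) (1, c)) := by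
    have h3 := conn_tr hC (-m) (conn_symm hS hmc)
    rw [tr_tr] at h3
    have e : -m * (n : ℤ) + m * n = 0 := by ring
    rwa [e, tr_zero] at h3
  have hn : (1 : ℤ) ≤ n := by exact_mod_cast NeZero.pos n
  obtain ⟨M, hM⟩ : ∃ M : ℕ, ∀ k ∈ X 1, |k| ≤ M :=
    ⟨(∑ k ∈ X 1, |k|).toNat, fun k hk => (Finset.single_le_sum (f := fun k : ℤ => |k|)
      (fun _ _ => abs_nonneg _) hk).trans (Int.self_le_toNat _)⟩
  have hfar : ∀ m : ℤ, 0 < m → Conn (stack A.other B.other) (1, c) (tr (m * n) (1, c)) →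
      level X (1, c) = 1 := by
    intro m hm hmc
    rw [← hiter m hmc (M + c.natAbs + 1), hlev, Finset.sum_eq_zero, add_zero]
    intro k hk
    have h4 : ((M + c.natAbs + 1 : ℕ) : ℤ) * 1 ≤ ((M + c.natAbs + 1 : ℕ) : ℤ) * (m * n) :=
      mul_le_mul_of_nonneg_left (by nlinarith) (by positivity)
    have h5 := (abs_le.1 (hM k hk)).2
    rw [← mul_assoc] at h4
    rw [if_neg]
    omega
  have hfar' : ∀ m : ℤ, m < 0 → Conn (stack A.other B.other) (1, c) (tr (m * n) (1, c)) →
      level X (1, c) = 0 := by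
    intro m hm hmc
    rw [← hiter m hmc (M + c.natAbs + 1), hlev, Finset.sum_congr rfl (g := fun _ => 1)]
    · rw [Finset.sum_const, nsmul_eq_mul, hcard]
      decide
    intro k hk
    have h4 : ((M + c.natAbs + 1 : ℕ) : ℤ) * (m * n) ≤ ((M + c.natAbs + 1 : ℕ) : ℤ) * (-1) :=
      mul_le_mul_of_nonneg_left (by nlinarith) (by positivity)
    have h5 := (abs_le.1 (hM k hk)).1
    rw [← mul_assoc] at h4
    rw [if_pos]
    omega
  rcases lt_or_gt_of_ne hm with h6 | h6
  · have := (hfar (-m) (by omega) hmc').symm.trans (hfar' m h6 hmc)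
    exact absurd this (by decide)
  · have := (hfar m h6 hmc).symm.trans (hfar' (-m) (by omega) hmc')
    exact absurd this (by decide)

/-- The diagram obtained by putting `A` on top of `B`, identifying the middle rows and removing the
contractible loops. -/
noncomputable def comp : Diagram n where
  other := strandEnd A B
  other_other := strandEnd_strandEnd A B
  other_ne := strandEnd_ne A B
  other_translate := strandEnd_translate A B
  planar := strandEnd_planar A B
  lines := A.lines + B.lines + A.newLines B
  lines_eq_zero := by
    intro i j h
    have hA : A.lines = 0 := by
      rcases e : A.other (Sum.inl i) with k | k
      · rw [strandEnd_of_inl A B e] at h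
        exact absurd h (by simp)
      · exact A.lines_eq_zero _ _ e
    have hB : B.lines = 0 := by
      have h' : strandEnd A B (Sum.inr j) = Sum.inl i := by rw [← h, strandEnd_strandEnd]
      rcases e : B.other (Sum.inr j) with k | k
      · exact B.lines_eq_zero k j (by rw [← e, B.other_other])
      · rw [strandEnd_of_inr A B e] at h'
        exact absurd h' (by simp)
    rw [hA, hB, newLines_eq_zero A B h]

end Diagram
end AffineTL

namespace AffineTL

/-! ### Stacking is associative -/

section Cyl

variable {ρ : Type} {n : ℕ} {S : Set (ρ × ℤ → ρ × ℤ)}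

theorem cyl_of_conn {p q : ρ × ℤ} (h : Conn S p q) : CylConn n S p q :=
  ⟨0, by simpa [tr_zero] using h⟩

theorem cyl_symm (hi : ∀ g ∈ S, Function.Involutive g) (hc : ∀ g ∈ S, Comm n g) {p q : ρ × ℤ}
    (h : CylConn n S p q) : CylConn n S q p := by
  obtain ⟨m, h⟩ := h
  refine ⟨-m, ?_⟩
  have := conn_tr hc (-m) (conn_symm hi h)
  rw [tr_tr] at this
  have e : -m * (n : ℤ) + m * n = 0 := by ring
  rwa [e, tr_zero] at this

theorem cyl_trans (hc : ∀ g ∈ S, Comm n g) {p q x : ρ × ℤ} (h : CylConn n S p q)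
    (h' : CylConn n S q x) : CylConn n S p x := by
  obtain ⟨m, h⟩ := h
  obtain ⟨m', h'⟩ := h'
  refine ⟨m + m', h.trans ?_⟩
  have := conn_tr hc m h'
  rw [tr_tr] at this
  rwa [add_mul]

theorem cyl_class_eq (hi : ∀ g ∈ S, Function.Involutive g) (hc : ∀ g ∈ S, Comm n g) {p q : ρ × ℤ}
    (h : CylConn n S p q) : {x | CylConn n S p x} = {x | CylConn n S q x} := by
  ext x
  exact ⟨fun h' => cyl_trans hc (cyl_symm hi hc h) h', fun h' => cyl_trans hc h h'⟩

theorem winds_of_cyl (hi : ∀ g ∈ S, Function.Involutive g) (hc : ∀ g ∈ S, Comm n g) {p q : ρ × ℤ}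
    (h : CylConn n S p q) (hw : Winds n S p) : Winds n S q := by
  obtain ⟨k, h⟩ := h
  obtain ⟨m, hm, hw⟩ := hw
  refine ⟨m, hm, ?_⟩
  have h1 := (conn_symm hi h).trans (hw.trans (conn_tr hc m h))
  have h2 := conn_tr hc (-k) h1
  simp only [tr_tr] at h2
  have e : -k * (n : ℤ) + k * n = 0 := by ring
  have e' : -k * (n : ℤ) + (m * n + k * n) = m * n := by ring
  rwa [e, e', tr_zero] at h2

theorem loopSet_finite [Finite ρ] [NeZero n] (hi : ∀ g ∈ S, Function.Involutive g)
    (hc : ∀ g ∈ S, Comm n g) (I : Set ρ) (w : Prop) : (loopSet n S I w).Finite := by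
  refine (Set.finite_range fun x : ρ × Fin n =>
    {q | CylConn n S (x.1, ((x.2 : ℕ) : ℤ)) q}).subset ?_
  rintro _ ⟨⟨r, i⟩, rfl, -, -⟩
  have hn : (0 : ℤ) < n := by exact_mod_cast NeZero.pos n
  have h1 := Int.emod_nonneg i hn.ne'
  have h2 := Int.emod_lt_of_pos i hn
  refine ⟨(r, ⟨(i % n).toNat, by omega⟩), ?_⟩
  refine cyl_class_eq hi hc ⟨-(i / n), ?_⟩
  simp only [Int.toNat_of_nonneg h1, tr]
  have : i + -(i / n) * n = i % n := by
    have := Int.emod_add_mul_ediv i n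
    linarith
  rw [this]
  exact Relation.ReflTransGen.refl

theorem conn_row_tr {p q : ρ × ℤ} {I : Set ρ} (h : ∀ x, Conn S p x → x.1 ∈ I)
    (hq : CylConn n S p q) : q.1 ∈ I := by
  obtain ⟨m, hq⟩ := hq
  have := h _ hq
  exact this

end Cyl

namespace Diagram

variable {n : ℕ} [NeZero n]

section Eliminate

set_option linter.unusedSectionVars false

variable {ρ : Type} [DecidableEq ρ] (A B : Diagram n) {r s t : ρ} (h1 : r ≠ s) (h2 : s ≠ t)
  (h3 : r ≠ t) {c : ρ × ℤ → ρ × ℤ} (ci : Function.Involutive c) (cc : Comm n c)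
  (cs : ∀ p, p.1 = s → c p = p)

theorem c_ne (ci : Function.Involutive c) (cs : ∀ p, p.1 = s → c p = p) {p : ρ × ℤ}
    (hp : p.1 ≠ s) : (c p).1 ≠ s := by
  intro h
  have := cs _ h
  rw [ci] at this
  rw [← this] at h
  exact hp h

theorem conn_eliminate (h1 : r ≠ s) (h2 : s ≠ t) (h3 : r ≠ t) (ci : Function.Involutive c)
    (cs : ∀ p, p.1 = s → c p = p) {p q : ρ × ℤ} (hp : p.1 ≠ s) :
    (q.1 ≠ s ∧ Conn (insert c (stackAt A.other B.other r s t)) p q) ↔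
      Conn {act (strandEnd A B) r t, c} p q := by
  constructor
  · rintro ⟨hq, h⟩
    have key : ∀ q, Conn (insert c (stackAt A.other B.other r s t)) p q → ∃ x : ρ × ℤ, x.1 ≠ s ∧
        Conn (stackAt A.other B.other r s t) x q ∧ Conn {act (strandEnd A B) r t, c} p x := by
      intro q h
      induction h with
      | refl => exact ⟨p, hp, Relation.ReflTransGen.refl, Relation.ReflTransGen.refl⟩
      | @tail q' _ _ hs ih =>
        obtain ⟨x, hx, hxq, hpx⟩ := ih
        obtain ⟨g, rfl | hg, rfl⟩ := hs
        · by_cases hq' : q'.1 = s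
          · rw [cs _ hq']
            exact ⟨x, hx, hxq, hpx⟩
          · refine ⟨_, c_ne ci cs hq', Relation.ReflTransGen.refl, ?_⟩
            refine Relation.ReflTransGen.trans ?_ (conn_step (g := g) (by simp) q')
            rcases (conn_outer A B h1 h2 h3 hx hq').1 hxq with rfl | rfl
            · exact hpx
            · exact hpx.trans (conn_step (by simp) _)
        · exact ⟨x, hx, hxq.trans (conn_step hg _), hpx⟩
    obtain ⟨x, hx, hxq, hpx⟩ := key q h
    rcases (conn_outer A B h1 h2 h3 hx hq).1 hxq with rfl | rfl
    · exact hpx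
    · exact hpx.trans (conn_step (by simp) _)
  · intro h
    induction h with
    | refl => exact ⟨hp, Relation.ReflTransGen.refl⟩
    | @tail q' _ _ hs ih =>
      obtain ⟨g, rfl | rfl, rfl⟩ := hs
      · have hn : (act (strandEnd A B) r t q').1 ≠ s := by
          by_cases hr : q'.1 = r ∨ q'.1 = t
          · obtain ⟨x, rfl⟩ := exists_place r t hr
            rw [act_place _ h3]
            exact place_ne_mid h1 h2 _
          · push Not at hr
            rw [act_of_ne _ hr.1 hr.2]
            exact ih.1
        refine ⟨hn, ih.2.trans (conn_mono (Set.subset_insert _ _) ?_)⟩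
        exact (conn_outer A B h1 h2 h3 ih.1 hn).2 (Or.inr rfl)
      · exact ⟨c_ne ci cs ih.1, ih.2.trans (conn_step (by simp) _)⟩

theorem conn_inner (cs : ∀ p, p.1 = s → c p = p) {S : Set (ρ × ℤ → ρ × ℤ)} {p q : ρ × ℤ}
    (hp : ∀ q, Conn S p q → q.1 = s) : Conn (insert c S) p q ↔ Conn S p q := by
  constructor
  · intro h
    induction h with
    | refl => exact Relation.ReflTransGen.refl
    | @tail q' _ _ hs ih =>
      obtain ⟨g, rfl | hg, rfl⟩ := hs
      · rwa [cs _ (hp _ ih)]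
      · exact ih.trans (conn_step hg _)
  · exact conn_mono (Set.subset_insert _ _)

theorem loopSet_eliminate [Finite ρ] (h1 : r ≠ s) (h2 : s ≠ t) (h3 : r ≠ t)
    (ci : Function.Involutive c) (cc : Comm n c) (cs : ∀ p, p.1 = s → c p = p)
    {I : Set ρ} (hI : s ∉ I) (w : Prop) :
    (loopSet n (insert c (stackAt A.other B.other r s t)) (insert s I) w).ncard =
      (loopSet n (stackAt A.other B.other r s t) {s} w).ncard +
      (loopSet n {act (strandEnd A B) r t, c} I w).ncard := by
  set S3 := insert c (stackAt A.other B.other r s t) with hS3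
  set S2 : Set (ρ × ℤ → ρ × ℤ) := {act (strandEnd A B) r t, c} with hS2
  have i3 : ∀ g ∈ S3, Function.Involutive g := by
    rintro g (rfl | hg)
    · exact ci
    · exact stackAt_involutive A B h1 h2 g hg
  have c3 : ∀ g ∈ S3, Comm n g := by
    rintro g (rfl | hg)
    · exact cc
    · exact stackAt_comm A B h1 h2 g hg
  have elim : ∀ p q : ρ × ℤ, p.1 ≠ s → (q.1 ≠ s ∧ Conn S3 p q ↔ Conn S2 p q) :=
    fun p q hp => conn_eliminate A B h1 h2 h3 ci cs hp
  have cylElim : ∀ p q : ρ × ℤ, p.1 ≠ s → (q.1 ≠ s ∧ CylConn n S3 p q ↔ CylConn n S2 p q) := by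
    intro p q hp
    constructor
    · rintro ⟨hq, m, h⟩
      exact ⟨m, (elim p _ hp).1 ⟨hq, h⟩⟩
    · rintro ⟨m, h⟩
      exact ⟨((elim p _ hp).2 h).1, m, ((elim p _ hp).2 h).2⟩
  have windsElim : ∀ p : ρ × ℤ, p.1 ≠ s → (Winds n S3 p ↔ Winds n S2 p) := by
    intro p hp
    constructor
    · rintro ⟨m, hm, h⟩
      exact ⟨m, hm, (elim p _ hp).1 ⟨hp, h⟩⟩
    · rintro ⟨m, hm, h⟩
      exact ⟨m, hm, ((elim p _ hp).2 h).2⟩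
  have hU : {x ∈ loopSet n S3 (insert s I) w | ∀ q ∈ x, q.1 = s} =
      loopSet n (stackAt A.other B.other r s t) {s} w := by
    ext x
    constructor
    · rintro ⟨⟨p, rfl, hrow, hw⟩, hs⟩
      have hs' : ∀ q, Conn (stackAt A.other B.other r s t) p q → q.1 = s := fun q hq =>
        hs q (cyl_of_conn (conn_mono (Set.subset_insert _ _) hq))
      have e : ∀ q, Conn S3 p q ↔ Conn (stackAt A.other B.other r s t) p q :=
        fun q => conn_inner cs hs'
      refine ⟨p, ?_, hs', ?_⟩
      · simp only [CylConn, e]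
      · rw [← hw]; simp only [Winds, e]
    · rintro ⟨p, rfl, hrow, hw⟩
      have e : ∀ q, Conn S3 p q ↔ Conn (stackAt A.other B.other r s t) p q :=
        fun q => conn_inner cs hrow
      refine ⟨⟨p, ?_, fun q hq => Or.inl (hrow q ((e q).1 hq)), ?_⟩, ?_⟩
      · simp only [CylConn, e]
      · rw [← hw]; simp only [Winds, e]
      · exact fun q hq => conn_row_tr hrow hq
  have hV : (fun x : Set (ρ × ℤ) => {q ∈ x | q.1 ≠ s}) ''
      {x ∈ loopSet n S3 (insert s I) w | ¬ ∀ q ∈ x, q.1 = s} = loopSet n S2 I w := by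
    ext y
    constructor
    · rintro ⟨_, ⟨⟨p, rfl, hrow, hw⟩, hs⟩, rfl⟩
      push Not at hs
      obtain ⟨p', hp', hne⟩ := hs
      refine ⟨p', ?_, ?_, ?_⟩
      · have := cyl_class_eq i3 c3 hp'
        ext q
        rw [this]
        simp only [Set.mem_ofPred_eq]
        rw [← cylElim p' q hne, and_comm]
      · intro q hq
        have h4 := (elim p' q hne).2 hq
        have h5 := cyl_trans c3 hp' (cyl_of_conn h4.2)
        exact (conn_row_tr hrow h5).resolve_left h4.1
      · rw [← windsElim p' hne, ← hw]
        exact ⟨winds_of_cyl i3 c3 (cyl_symm i3 c3 hp'), winds_of_cyl i3 c3 hp'⟩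
    · rintro ⟨p, rfl, hrow, hw⟩
      have hp : p.1 ≠ s := fun e => hI (e ▸ hrow p Relation.ReflTransGen.refl)
      refine ⟨_, ⟨⟨p, rfl, ?_, ?_⟩, ?_⟩, ?_⟩
      · intro q hq
        by_cases hqs : q.1 = s
        · exact Or.inl hqs
        · exact Or.inr (hrow q ((elim p q hp).1 ⟨hqs, hq⟩))
      · rw [windsElim p hp, hw]
      · exact fun h => hp (h p (cyl_of_conn Relation.ReflTransGen.refl))
      · ext q
        simp only [Set.mem_ofPred_eq]
        rw [← cylElim p q hp, and_comm]
  have inj : Set.InjOn (fun x : Set (ρ × ℤ) => {q ∈ x | q.1 ≠ s})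
      {x ∈ loopSet n S3 (insert s I) w | ¬ ∀ q ∈ x, q.1 = s} := by
    rintro _ ⟨⟨p, rfl, -, -⟩, hs⟩ _ ⟨⟨p', rfl, -, -⟩, -⟩ he
    push Not at hs
    obtain ⟨x, hx, hne⟩ := hs
    have hx' : x ∈ {q | q ∈ {q | CylConn n S3 p' q} ∧ q.1 ≠ s} := by
      have h0 : x ∈ {q | q ∈ {q | CylConn n S3 p q} ∧ q.1 ≠ s} := ⟨hx, hne⟩
      have he' : {q | q ∈ {q | CylConn n S3 p q} ∧ q.1 ≠ s} =
        {q | q ∈ {q | CylConn n S3 p' q} ∧ q.1 ≠ s} := he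
      rwa [he'] at h0
    exact (cyl_class_eq i3 c3 hx).trans (cyl_class_eq i3 c3 hx'.1).symm
  have fin := loopSet_finite i3 c3 (insert s I) w
  rw [← hU, ← hV, inj.ncard_image, ← Set.ncard_union_eq ?_ (fin.subset (Set.sep_subset _ _))
    (fin.subset (Set.sep_subset _ _))]
  · congr 1
    ext x
    simp only [Set.mem_union, Set.mem_ofPred_eq]
    tauto
  · rw [Set.disjoint_left]
    exact fun x hx hx' => hx'.2 hx.2

theorem loopSet_rows (h1 : r ≠ s) (h2 : s ≠ t) (h3 : r ≠ t) (w : Prop) :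
    (loopSet n (stackAt A.other B.other r s t) {s} w).ncard =
      (loopSet n (stack A.other B.other) {1} w).ncard := by
  have hinj := rows_injective h1 h2 h3
  have cr := conn_rows A.other B.other h1 h2 h3
  have htr : ∀ k p, tr k (rows r s t p) = rows r s t (tr k p) := fun _ _ => rfl
  have cr' : ∀ p q, Conn (stackAt A.other B.other r s t) (rows r s t p) (rows r s t q) ↔
      Conn (stack A.other B.other) p q := by
    intro p q
    rw [cr]
    constructor
    · rintro ⟨q', e, h⟩
      rwa [hinj e]
    · exact fun h => ⟨q, rfl, h⟩
  have hclass : ∀ p, {q | CylConn n (stackAt A.other B.other r s t) (rows r s t p) q} =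
      rows r s t '' {q | CylConn n (stack A.other B.other) p q} := by
    intro p
    ext q
    constructor
    · rintro ⟨m, h⟩
      obtain ⟨q', e, h'⟩ := (cr _ _).1 h
      have e2 : tr (m * n) (tr (-(m * n)) q') = q' := by
        rw [tr_tr, add_neg_cancel, tr_zero]
      refine ⟨tr (-(m * n)) q', ⟨m, by rwa [e2]⟩, ?_⟩
      rw [← htr, ← e, tr_tr, neg_add_cancel, tr_zero]
    · rintro ⟨q', ⟨m, h⟩, rfl⟩
      exact ⟨m, by rw [htr, cr']; exact h⟩
  have hwind : ∀ p, Winds n (stackAt A.other B.other r s t) (rows r s t p) ↔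
      Winds n (stack A.other B.other) p := by
    intro p
    simp only [Winds, htr, cr']
  have hrow : ∀ p : Fin 3 × ℤ, (rows r s t p).1 ∈ ({s} : Set ρ) ↔ p.1 ∈ ({1} : Set (Fin 3)) := by
    rintro ⟨a, i⟩
    fin_cases a <;> simp [rows, h1, h2.symm]
  rw [← Set.ncard_image_of_injective _ (Set.image_injective.2 hinj)]
  congr 1
  ext x
  constructor
  · rintro ⟨p, rfl, hp, hw⟩
    have hps := hp p Relation.ReflTransGen.refl
    obtain ⟨a, i⟩ := p
    obtain rfl : a = s := hps
    have e : ((a, i) : ρ × ℤ) = rows r a t (1, i) := rfl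
    rw [e] at hp hw ⊢
    refine ⟨_, ⟨(1, i), rfl, ?_, ?_⟩, (hclass _).symm⟩
    · exact fun q hq => (hrow q).1 (hp _ ((cr' _ _).2 hq))
    · rw [← hwind, hw]
  · rintro ⟨_, ⟨p, rfl, hp, hw⟩, rfl⟩
    refine ⟨rows r s t p, (hclass p).symm, ?_, ?_⟩
    · intro q hq
      obtain ⟨q', rfl, h⟩ := (cr _ _).1 hq
      exact (hrow _).2 (hp _ h)
    · rw [hwind, hw]

end Eliminate

section Assoc

set_option linter.unusedSectionVars false

variable (A B C : Diagram n)

theorem act_fix_row {ρ : Type} [DecidableEq ρ] (f : ℤ ⊕ ℤ → ℤ ⊕ ℤ) {r s u : ρ} (h1 : u ≠ r)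
    (h2 : u ≠ s) : ∀ p : ρ × ℤ, p.1 = u → act f r s p = p := by
  rintro p rfl
  exact act_of_ne f h1 h2

theorem triple_eq : (insert (act C.other 2 3) (stackAt A.other B.other 0 1 2) :
    Set (Fin 4 × ℤ → Fin 4 × ℤ)) = insert (act A.other 0 1) (stackAt B.other C.other 1 2 3) := by
  ext g
  simp only [stackAt, Set.mem_insert_iff, Set.mem_singleton_iff]
  tauto

theorem comp_other : (comp A B).other = strandEnd A B := rfl

theorem loops_assoc (w : Prop) :
    (loopSet n (stack A.other B.other) {1} w).ncard +
      (loopSet n (stack (comp A B).other C.other) {1} w).ncard =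
    (loopSet n (stack B.other C.other) {1} w).ncard +
      (loopSet n (stack A.other (comp B C).other) {1} w).ncard := by
  have hL := loopSet_eliminate A B (r := (0 : Fin 4)) (s := 1) (t := 2) (by decide) (by decide)
    (by decide) (act_involutive C (r := (2 : Fin 4)) (s := 3) (by decide)) (act_comm C (by decide))
    (act_fix_row _ (by decide) (by decide)) (I := {2}) (by simp) w
  have hR := loopSet_eliminate B C (r := (1 : Fin 4)) (s := 2) (t := 3) (by decide) (by decide)
    (by decide) (act_involutive A (r := (0 : Fin 4)) (s := 1) (by decide)) (act_comm A (by decide))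
    (act_fix_row _ (by decide) (by decide)) (I := {1}) (by simp) w
  rw [triple_eq, Set.pair_comm, hR] at hL
  rw [loopSet_rows A B (by decide) (by decide) (by decide),
    loopSet_rows B C (by decide) (by decide) (by decide)] at hL
  have e1 := loopSet_rows (comp A B) C (r := (0 : Fin 4)) (s := 2) (t := 3) (by decide)
    (by decide) (by decide) w
  have e2 := loopSet_rows A (comp B C) (r := (0 : Fin 4)) (s := 1) (t := 3) (by decide)
    (by decide) (by decide) w
  rw [← e1, ← e2]
  simp only [stackAt, comp_other] at hL ⊢
  rw [Set.pair_comm (act (strandEnd B C) 1 3)] at hL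
  exact hL.symm

theorem strandEnd_assoc (x : ℤ ⊕ ℤ) :
    strandEnd (comp A B) C x = strandEnd A (comp B C) x := by
  have h03 : (0 : Fin 4) ≠ 3 := by decide
  have hne : ∀ y, (place (0 : Fin 4) 3 y).1 ≠ 1 ∧ (place (0 : Fin 4) 3 y).1 ≠ 2 := fun y =>
    ⟨by rcases y with i | i <;> simp [place], by rcases y with i | i <;> simp [place]⟩
  have k1 := (conn_outer (comp A B) C (r := (0 : Fin 4)) (s := 2) (t := 3) (by decide)
    (by decide) h03 (p := place 0 3 x) (q := place 0 3 (strandEnd (comp A B) C x)) (hne _).2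
    (hne _).2).2 (Or.inr (act_place _ h03 x).symm)
  have k2 := ((conn_eliminate A B (r := (0 : Fin 4)) (s := 1) (t := 2) (by decide) (by decide)
    (by decide) (act_involutive C (r := (2 : Fin 4)) (s := 3) (by decide))
    (act_fix_row _ (by decide) (by decide)) (hne _).1).2 k1).2
  rw [triple_eq] at k2
  have k3 := (conn_eliminate B C (r := (1 : Fin 4)) (s := 2) (t := 3) (by decide) (by decide)
    (by decide) (act_involutive A (r := (0 : Fin 4)) (s := 1) (by decide))
    (act_fix_row _ (by decide) (by decide)) (hne _).2).1 ⟨(hne _).2, k2⟩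
  rw [Set.pair_comm] at k3
  have k4 := (conn_outer A (comp B C) (r := (0 : Fin 4)) (s := 1) (t := 3) (by decide)
    (by decide) h03 (hne _).1 (hne _).1).1 k3
  rw [act_place _ h03] at k4
  rcases k4 with h | h
  · exact absurd (place_injective h03 h) (strandEnd_ne _ _ _)
  · exact place_injective h03 h

theorem comp_assoc : comp (comp A B) C = comp A (comp B C) := by
  ext x
  · exact strandEnd_assoc A B C x
  · have := loops_assoc A B C True
    change A.lines + B.lines + A.newLines B + C.lines + (comp A B).newLines C =
      A.lines + (B.lines + C.lines + B.newLines C) + A.newLines (comp B C)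
    simp only [newLines]
    omega

theorem loops_cocycle : A.loops B + (comp A B).loops C = B.loops C + A.loops (comp B C) :=
  loops_assoc A B C False

end Assoc

/-- The identity diagram: every node of the top row is joined to the node below it. -/
def one (n : ℕ) : Diagram n where
  other := Sum.swap
  other_other := Sum.swap_swap
  other_ne := by rintro (i | i) <;> simp
  other_translate := by rintro (i | i) <;> rfl
  planar := by
    rintro (i | i) (j | j) <;> simp [Before] <;> omega
  lines := 0
  lines_eq_zero := fun _ _ _ => rfl

section Unit

set_option linter.unusedSectionVars false

theorem loopSet_left_through (A B : Diagram n) (w : Prop)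
    (h : ∀ i, ∃ j, A.other (Sum.inr i) = Sum.inl j) :
    loopSet n (stack A.other B.other) {1} w = ∅ := by
  rw [Set.eq_empty_iff_forall_notMem]
  rintro _ ⟨⟨r, i⟩, -, hrow, -⟩
  have hr : r = 1 := hrow _ Relation.ReflTransGen.refl
  subst hr
  obtain ⟨j, hj⟩ := h i
  have h1 := conn_step (S := stack A.other B.other) (Or.inl rfl) (place 0 1 (Sum.inr i))
  rw [act_place _ (by decide), hj] at h1
  exact absurd (hrow _ h1) (by simp [place])

theorem loopSet_right_through (A B : Diagram n) (w : Prop)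
    (h : ∀ i, ∃ j, B.other (Sum.inl i) = Sum.inr j) :
    loopSet n (stack A.other B.other) {1} w = ∅ := by
  rw [Set.eq_empty_iff_forall_notMem]
  rintro _ ⟨⟨r, i⟩, -, hrow, -⟩
  have hr : r = 1 := hrow _ Relation.ReflTransGen.refl
  subst hr
  obtain ⟨j, hj⟩ := h i
  have h1 := conn_step (S := stack A.other B.other) (Or.inr rfl) (place 1 2 (Sum.inl i))
  rw [act_place _ (by decide), hj] at h1
  exact absurd (hrow _ h1) (by simp [place])

theorem loops_one (A : Diagram n) : A.loops (one n) = 0 := by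
  rw [loops, loopSet_right_through _ _ _ fun i => ⟨i, rfl⟩, Set.ncard_empty]

theorem one_loops (A : Diagram n) : (one n).loops A = 0 := by
  rw [loops, loopSet_left_through _ _ _ fun i => ⟨i, rfl⟩, Set.ncard_empty]

theorem comp_one (A : Diagram n) : comp A (one n) = A := by
  have key : ∀ x, Conn (stack A.other (one n).other) (place 0 2 x) (place 0 1 x) := by
    rintro (i | i)
    · exact Relation.ReflTransGen.refl
    · have := conn_step (S := stack A.other (one n).other) (Or.inr rfl) (place 1 2 (Sum.inr i))
      rwa [act_place _ (by decide)] at this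
  ext x
  · refine eq_strandEnd _ _ (A.other_ne x) ((key x).trans ?_)
    have h1 := conn_step (S := stack A.other (one n).other) (Or.inl rfl) (place 0 1 x)
    rw [act_place _ (by decide)] at h1
    exact h1.trans (conn_symm (stackAt_involutive A (one n) (r := (0 : Fin 3)) (by decide)
      (by decide)) (key _))
  · change A.lines + 0 + A.newLines (one n) = A.lines
    rw [newLines, loopSet_right_through _ _ _ fun i => ⟨i, rfl⟩, Set.ncard_empty]
    rfl

theorem one_comp (A : Diagram n) : comp (one n) A = A := by
  have key : ∀ x, Conn (stack (one n).other A.other) (place 0 2 x) (place 1 2 x) := by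
    rintro (i | i)
    · have := conn_step (S := stack (one n).other A.other) (Or.inl rfl) (place 0 1 (Sum.inl i))
      rwa [act_place _ (by decide)] at this
    · exact Relation.ReflTransGen.refl
  ext x
  · refine eq_strandEnd _ _ (A.other_ne x) ((key x).trans ?_)
    have h1 := conn_step (S := stack (one n).other A.other) (Or.inr rfl) (place 1 2 x)
    rw [act_place _ (by decide)] at h1
    exact h1.trans (conn_symm (stackAt_involutive (one n) A (r := (0 : Fin 3)) (by decide)
      (by decide)) (key _))
  · change 0 + A.lines + (one n).newLines A = A.lines
    rw [newLines, loopSet_left_through _ _ _ fun i => ⟨i, rfl⟩, Set.ncard_empty]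
    omega

end Unit

/-- The diagram `u`: the node `j` of the bottom row is joined to the node `j + 1` of the top row. -/
def rot (n : ℕ) : Diagram n where
  other := Sum.elim (fun i => Sum.inr (i - 1)) (fun i => Sum.inl (i + 1))
  other_other := by rintro (i | i) <;> simp
  other_ne := by rintro (i | i) <;> simp
  other_translate := by
    rintro (i | i) <;> simp only [translate, Sum.map_inl, Sum.map_inr, Sum.elim_inl, Sum.elim_inr] <;>
      congr 1 <;> ring
  planar := by
    rintro (i | i) (j | j) <;> simp [Before] <;> omega
  lines := 0
  lines_eq_zero := fun _ _ _ => rfl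

/-- The number `t` of through-strings of a diagram: the number of edges joining the two rows,
up to translation by `n`. -/
def through (A : Diagram n) : ℕ :=
  ((Finset.range n).filter fun i : ℕ => (A.other (Sum.inl (i : ℤ))).isRight).card

/-- The two diagrams have the same edges between nodes of the bottom row. -/
def SameBottom (A B : Diagram n) : Prop :=
  ∀ i j, A.other (Sum.inr i) = Sum.inr j ↔ B.other (Sum.inr i) = Sum.inr j

/-- The two diagrams have the same edges between nodes of the top row. -/
def SameTop (A B : Diagram n) : Prop :=
  ∀ i j, A.other (Sum.inl i) = Sum.inl j ↔ B.other (Sum.inl i) = Sum.inl j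

/-- If `A` is the diagram with horizontal edges `S₁`, `S₂` and winding number `w`, then `B` is the
diagram with the same horizontal edges and winding number `w + 1`: each through-string of `B` has
the same bottom node as in `A`, but its top node is moved to the right to the next top node of a
through-string. -/
def IsTwist (A B : Diagram n) : Prop :=
  SameTop A B ∧ SameBottom A B ∧ ∀ i j, A.other (Sum.inr j) = Sum.inl i →
    ∃ i', B.other (Sum.inr j) = Sum.inl i' ∧ i < i' ∧
      ∀ k, i < k → k < i' → ∃ l, A.other (Sum.inl k) = Sum.inl l

end Diagram

/-! ### The algebra `D_n` and its quotients -/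

/-- The algebra `D_n` over `K` with loop parameter `δ`: the vector space with basis the affine
`n`-diagrams. -/
def DAlg (K : Type*) [Field K] (_δ : K) (n : ℕ) : Type _ := Diagram n →₀ K

namespace DAlg

variable {K : Type*} [Field K] {δ : K} {n : ℕ}

noncomputable instance : AddCommGroup (DAlg K δ n) := inferInstanceAs (AddCommGroup (Diagram n →₀ K))

noncomputable instance : Module K (DAlg K δ n) := inferInstanceAs (Module K (Diagram n →₀ K))

/-- The basis element given by a diagram. -/
noncomputable def of (δ : K) (A : Diagram n) : DAlg K δ n := Finsupp.single A 1

/-- The linear extension of a map on diagrams. -/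
noncomputable def lin {M : Type*} [AddCommGroup M] [Module K M] (f : Diagram n → M) :
    DAlg K δ n →ₗ[K] M := Finsupp.linearCombination K f

theorem lin_of {M : Type*} [AddCommGroup M] [Module K M] (f : Diagram n → M) (A : Diagram n) :
    lin f (of δ A) = f A := by
  exact (Finsupp.linearCombination_single K 1 A).trans (one_smul K _)

theorem hom_ext {M : Type*} [AddCommGroup M] [Module K M] {f g : DAlg K δ n →ₗ[K] M}
    (h : ∀ A, f (of δ A) = g (of δ A)) : f = g :=
  Finsupp.lhom_ext' fun A => LinearMap.ext_ring (h A)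

section Mul

set_option linter.unusedSectionVars false

variable [NeZero n]

/-- The bilinear extension of the stacking product `A B = δ ^ x C`, where `x` is the number of
contractible loops and `C` is the resulting diagram. -/
noncomputable def mulHom (δ : K) (n : ℕ) [NeZero n] :
    DAlg K δ n →ₗ[K] DAlg K δ n →ₗ[K] DAlg K δ n :=
  lin fun A => lin fun B => δ ^ A.loops B • of δ (A.comp B)

noncomputable instance : Mul (DAlg K δ n) := ⟨fun x y => mulHom δ n x y⟩

noncomputable instance : One (DAlg K δ n) := ⟨of δ (Diagram.one n)⟩

theorem mul_def (x y : DAlg K δ n) : x * y = mulHom δ n x y := rfl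

theorem one_def : (1 : DAlg K δ n) = of δ (Diagram.one n) := rfl

theorem of_mul_of (A B : Diagram n) : of δ A * of δ B = δ ^ A.loops B • of δ (A.comp B) := by
  rw [mul_def, mulHom, lin_of, lin_of]

theorem assoc_aux (x y z : DAlg K δ n) : x * y * z = x * (y * z) := by
  have h1 : ∀ A B : Diagram n, ∀ z : DAlg K δ n,
      of δ A * of δ B * z = of δ A * (of δ B * z) := by
    intro A B z
    have h : mulHom δ n (of δ A * of δ B) = (mulHom δ n (of δ A)).comp (mulHom δ n (of δ B)) :=
      hom_ext fun C => by
        rw [LinearMap.comp_apply, ← mul_def, ← mul_def, ← mul_def, of_mul_of, of_mul_of B C,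
          mul_def, mul_def, map_smul, map_smul, LinearMap.smul_apply, ← mul_def, ← mul_def,
          of_mul_of, of_mul_of, smul_smul, smul_smul, ← pow_add, ← pow_add, Diagram.loops_cocycle,
          Diagram.comp_assoc]
    exact LinearMap.congr_fun h z
  have h2 : ∀ A : Diagram n, ∀ y z : DAlg K δ n, of δ A * y * z = of δ A * (y * z) := by
    intro A y z
    have h : ((mulHom δ n).flip z).comp (mulHom δ n (of δ A)) =
        (mulHom δ n (of δ A)).comp ((mulHom δ n).flip z) := hom_ext fun B => h1 A B z
    exact LinearMap.congr_fun h y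
  have h : ((mulHom δ n).flip z).comp ((mulHom δ n).flip y) = (mulHom δ n).flip (y * z) :=
    hom_ext fun A => h2 A y z
  exact LinearMap.congr_fun h x

noncomputable instance : Ring (DAlg K δ n) :=
  { (inferInstance : AddCommGroup (DAlg K δ n)) with
    mul := (· * ·)
    one := 1
    left_distrib := fun x y z => by simp only [mul_def, map_add]
    right_distrib := fun x y z => by simp only [mul_def, map_add, LinearMap.add_apply]
    zero_mul := fun x => by simp only [mul_def, map_zero, LinearMap.zero_apply]
    mul_zero := fun x => by simp only [mul_def, map_zero]
    mul_assoc := assoc_aux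
    one_mul := fun x => by
      have h : mulHom δ n 1 = LinearMap.id := hom_ext fun A => by
        rw [← mul_def, one_def, of_mul_of, Diagram.one_loops, Diagram.one_comp, pow_zero, one_smul]
        rfl
      exact LinearMap.congr_fun h x
    mul_one := fun x => by
      have h : (mulHom δ n).flip 1 = LinearMap.id := hom_ext fun A => by
        rw [LinearMap.flip_apply, ← mul_def, one_def, of_mul_of, Diagram.loops_one,
          Diagram.comp_one, pow_zero, one_smul]
        rfl
      exact LinearMap.congr_fun h x }

noncomputable instance : Algebra K (DAlg K δ n) :=
  Algebra.ofModule (fun r x y => by simp only [mul_def, map_smul, LinearMap.smul_apply])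
    (fun r x y => by simp only [mul_def, map_smul])

end Mul

end DAlg

section Jones

variable {K : Type*} [Field K]

/-- The ideal `ω(q)` of `D_n`, generated by `u ^ n - q`. -/
noncomputable def omega (δ q : K) (n : ℕ) [NeZero n] : TwoSidedIdeal (DAlg K δ n) :=
  TwoSidedIdeal.span {DAlg.of δ (Diagram.rot n) ^ n - algebraMap K (DAlg K δ n) q}

/-- The ideal `I_0` of `D_n`, generated (indeed spanned) by the diagrams without through-strings.
It is zero if `n` is odd. -/
noncomputable def idealZero (δ : K) (n : ℕ) [NeZero n] : TwoSidedIdeal (DAlg K δ n) :=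
  TwoSidedIdeal.span {x | ∃ A : Diagram n, A.through = 0 ∧ x = DAlg.of δ A}

/-- The algebra `D_n(q) = D_n / (ω(q) + I_0)`. -/
abbrev JonesAlg (δ q : K) (n : ℕ) [NeZero n] : Type _ :=
  DAlg K δ n ⧸ (omega δ q n ⊔ idealZero δ n).asIdeal

/-- The projection of `D_n` onto `D_n(q)`. -/
noncomputable abbrev toJones (δ q : K) (n : ℕ) [NeZero n] : DAlg K δ n →+* JonesAlg δ q n :=
  Ideal.Quotient.mk (omega δ q n ⊔ idealZero δ n).asIdeal

/-- A sequence `[S₁, S₂, w]`, `[S₁, S₂, w + 1]`, `[S₁, S₂, w + 2]`, … of diagrams with `t`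
through-strings. -/
def IsTwistChain {n : ℕ} (t : ℕ) (β : ℕ → Diagram n) : Prop :=
  ∀ k, (β k).through = t ∧ (β k).IsTwist (β (k + 1))

/-- The element of `D_n(q)` obtained from a polynomial by substituting the `k`-th diagram of a
sequence for `X ^ k`. -/
noncomputable def subst {δ : K} (q : K) {n : ℕ} [NeZero n] (f : Polynomial K)
    (β : ℕ → Diagram n) : JonesAlg δ q n :=
  toJones δ q n (f.sum fun k c => c • DAlg.of δ (β k))

/-- The polynomial `∏_{i > j} (X - r_i)`. -/
noncomputable def cellPoly {t : ℕ} (r : Fin t → K) (j : Fin t) : Polynomial K :=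
  ∏ i ∈ Finset.Ioi j, (Polynomial.X - Polynomial.C (r i))

/-- The span of the cell basis elements with label smaller than `(t, j)`, where the roots of
`X ^ t - q` are labelled by `r`: it contains the diagrams with less than `t` through-strings and the
elements `f(S₁, S₂)` for `f = ∏_{k > i} (X - r_k)`, `i < j`. -/
noncomputable def lowerIdeal (δ q : K) (n : ℕ) [NeZero n] {t : ℕ} (r : Fin t → K) (j : Fin t) :
    Submodule (JonesAlg δ q n) (JonesAlg δ q n) :=
  Submodule.span (JonesAlg δ q n)
    ({x | ∃ A : Diagram n, A.through < t ∧ x = toJones δ q n (DAlg.of δ A)} ∪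
      {x | ∃ i, i < j ∧ ∃ β : ℕ → Diagram n, IsTwistChain t β ∧ x = subst q (cellPoly r i) β})

/-- The standard module `W(t, j)`: the span, modulo the lower ideal, of the cell basis elements
`f(S, T)` with label `(t, j)`, where the horizontal edges `T` in the bottom row are fixed (they are
those of the diagram `T`). Changing the winding number at which a sequence starts only multiplies
the coset of `f(S, T)` by a power of the root `r_j`. -/
noncomputable def standardModule (δ q : K) (n : ℕ) [NeZero n] {t : ℕ} (r : Fin t → K) (j : Fin t)
    (T : Diagram n) : Submodule (JonesAlg δ q n) (JonesAlg δ q n ⧸ lowerIdeal δ q n r j) :=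
  Submodule.span (JonesAlg δ q n)
    {x | ∃ β : ℕ → Diagram n, IsTwistChain t β ∧ (β 0).SameBottom T ∧
      x = Submodule.Quotient.mk (subst q (cellPoly r j) β)}

/-- `M` is (isomorphic to) a standard module of the cellular algebra `D_n(q)`, for some number
`t > 0` of through-strings and some labelling of the roots of `X ^ t - q`. -/
def IsStandard (δ q : K) (n : ℕ) [NeZero n] (M : Type*) [AddCommGroup M]
    [Module (JonesAlg δ q n) M] : Prop :=
  ∃ (t : ℕ) (r : Fin t → K) (j : Fin t) (T : Diagram n),
    (Polynomial.X ^ t - Polynomial.C q = ∏ i, (Polynomial.X - Polynomial.C (r i))) ∧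
    T.through = t ∧ Nonempty (M ≃ₗ[JonesAlg δ q n] standardModule δ q n r j T)

/-- A module of `D_n(q)`, viewed as a module of `D_n`. -/
noncomputable abbrev restrict {K : Type u} [Field K] {δ q : K} {n : ℕ} [NeZero n]
    (M : ModuleCat.{u} (JonesAlg δ q n)) : ModuleCat.{u} (DAlg K δ n) :=
  (ModuleCat.restrictScalars (toJones δ q n)).obj M

end Jones

end AffineTL

open AffineTL

/-! If `M = R m` is cyclic and `L` is the annihilator of `m`, then `Ext¹(M, N)` is the group of
homomorphisms `φ : L → N` modulo the inner ones `l ↦ l y`. For `R = D_n` everything is decided by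
the value of `φ` at the central element `z = uⁿ - q`, which lies in `L` because it kills `M`.
Centrality gives `l φ(z) = z φ(l)` for all `l` in `L`.

If `N` comes from `D_n(q')`, then `z` acts on `N` as `q' - q`, and for `q ≠ q'` this identity
already shows that `φ` is inner. If `q = q'`, then `z` kills `N`, so `L` kills `φ(z)` and `m ↦ φ(z)`
defines a homomorphism `M → N`, which is zero between non-isomorphic simple modules. A `φ` with
`φ(z) = 0` vanishes on the whole kernel of `D_n → D_n(q)`: on `ω(q)` by centrality, and on `I_0`
because each diagram `A` of `I_0` equals `A e` for some `e` in `I_0` (here `δ ≠ 0` enters). It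
therefore descends to `D_n(q)`, where it is inner if `Ext¹` vanishes (`exists_of_ext_subsingleton`).

For `M = N` standard, fix the bottom half `T`, with `t` through-strings and idempotent `e`. Modulo
fewer through-strings, the diagrams with this half carry a right action of a twist `τ` raising the
winding number by one. It has no nonzero eigenvectors, since it moves every through-string strictly
to the right, and `uⁿ` acts as `τ^t`, so `z` acts as `∏ (τ - r_i)`. The lower ideal then amounts to
the multiples of `∏_{i ≥ j} (τ - r_i)`, the generator is the coset of `e ∏_{i > j} (τ - r_i)`, and
cancelling the latter product shows that `d` kills it exactly when `d e ≡ w e (τ - r_j)` for some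
`w` (`mem_lowerIdeal_iff`).

In a simple standard module one has `e M = K m` (`exists_idem_smul`). Hence `φ(z)` is a scalar
multiple of `m`, and if `Ext¹` over `D_n(q)` vanishes the self-extensions over `D_n` have dimension
at most one. Deforming `r_j` to first order gives the homomorphism `l ↦ w m`. It is not inner
(`exists_not_inner`): it takes the value `m` at `τ - r_j e`, an element which annihilates `M`. So
the dimension is exactly one. -/

namespace AffineTL

open CategoryTheory

/-! ### First extension groups of a cyclic module -/

section ExtCyclic

open Abelian

variable {R : Type u} [Ring R] {M N : ModuleCat.{u} R}

/-- The annihilator of an element of a module. -/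
abbrev annih (R : Type*) [Ring R] {M : Type*} [AddCommGroup M] [Module R M] (m : M) :
    Submodule R R := LinearMap.ker (LinearMap.toSpanSingleton R M m)

theorem mem_annih {R : Type*} [Ring R] {M : Type*} [AddCommGroup M] [Module R M] {m : M} {x : R} :
    x ∈ annih R m ↔ x • m = 0 := by
  simp [annih]

/-- The presentation of a cyclic module. -/
def cyclicSeq (m : M) : ShortComplex (ModuleCat.{u} R) :=
  ShortComplex.mk (ModuleCat.ofHom (annih R m).subtype)
    (ModuleCat.ofHom (LinearMap.toSpanSingleton R M m)) (by
      ext x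
      exact x.2)

theorem cyclicSeq_shortExact {m : M} (hm : ∀ x : M, ∃ r : R, r • m = x) :
    (cyclicSeq m).ShortExact := by
  refine ShortComplex.ShortExact.mk' ?_ ?_ ?_
  · rw [ShortComplex.moduleCat_exact_iff]
    intro x hx
    exact ⟨⟨x, hx⟩, rfl⟩
  · exact (ModuleCat.mono_iff_injective _).2 Subtype.val_injective
  · exact (ModuleCat.epi_iff_surjective _).2 hm

/-- A homomorphism from the annihilator, as a morphism from the first term of the presentation. -/
def homFst {m : M} (φ : annih R m →ₗ[R] N) : (cyclicSeq m).X₁ ⟶ N := ModuleCat.ofHom φ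

/-- The morphism from the middle term of the presentation sending the generator to `n`. -/
def homSnd (m : M) (n : N) : (cyclicSeq m).X₂ ⟶ N :=
  ModuleCat.ofHom (LinearMap.toSpanSingleton R N n)

/-- A class of extensions of the cyclic module generated by `m`, given by a homomorphism from the
annihilator of `m`. -/
noncomputable def extOf {m : M} (hm : ∀ x : M, ∃ r : R, r • m = x) (φ : annih R m →ₗ[R] N) :
    Ext M N 1 :=
  (cyclicSeq_shortExact hm).extClass.comp (Ext.mk₀ (homFst φ)) (add_zero 1)

/-- The middle term `R` of the presentation is projective, so its first extension group vanishes and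
the connecting map in the long exact sequence is onto. -/
theorem extOf_surjective {m : M} (hm : ∀ x : M, ∃ r : R, r • m = x) :
    Function.Surjective (extOf (N := N) hm) := by
  intro x
  have hproj : Projective (cyclicSeq m).X₂ := inferInstanceAs (Projective (ModuleCat.of R R))
  obtain ⟨y, hy⟩ := Ext.contravariant_sequence_exact₃ (cyclicSeq_shortExact hm) N x
    (Ext.eq_zero_of_projective _) (n₀ := 0) rfl
  obtain ⟨f, rfl⟩ := Ext.addEquiv₀.symm.surjective y
  exact ⟨f.hom, hy⟩

/-- Exactness one place earlier: the connecting map kills exactly the homomorphisms that extend to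
`R`, and a homomorphism from `R` is determined by the image `n` of `1`. -/
theorem extOf_eq_zero_iff {m : M} (hm : ∀ x : M, ∃ r : R, r • m = x) (φ : annih R m →ₗ[R] N) :
    extOf hm φ = 0 ↔ ∃ n : N, ∀ l, φ l = (l : R) • n := by
  constructor
  · intro h
    obtain ⟨y, hy⟩ := Ext.contravariant_sequence_exact₁ (cyclicSeq_shortExact hm) N
      (Ext.mk₀ (homFst φ)) rfl h
    obtain ⟨f, rfl⟩ := Ext.addEquiv₀.symm.surjective y
    change (Ext.mk₀ (cyclicSeq m).f).comp (Ext.mk₀ f) _ = _ at hy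
    rw [Ext.mk₀_comp_mk₀] at hy
    have hy := (Ext.mk₀_bijective _ _).1 hy
    let f' : R →ₗ[R] N := f.hom
    refine ⟨f' 1, fun l => ?_⟩
    have e : f' (l : R) = φ l := LinearMap.congr_fun (congrArg ModuleCat.Hom.hom hy) l
    rw [← e, ← f'.map_smul, smul_eq_mul, mul_one]
  · rintro ⟨n, hn⟩
    have e : homFst φ = (cyclicSeq m).f ≫ homSnd m n := by
      ext l
      exact hn l
    rw [extOf, e, ← Ext.mk₀_comp_mk₀, ShortComplex.ShortExact.extClass_comp_assoc]
    rfl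

/-- Turns the vanishing of extensions into a question about homomorphisms on a left ideal; it is
used both over `D_n` and over `D_n(q)`. -/
theorem ext_subsingleton_iff {m : M} (hm : ∀ x : M, ∃ r : R, r • m = x) :
    Subsingleton (Ext M N 1) ↔ ∀ φ : annih R m →ₗ[R] N, ∃ n : N, ∀ l, φ l = (l : R) • n := by
  constructor
  · intro h φ
    exact (extOf_eq_zero_iff hm φ).1 (Subsingleton.elim _ _)
  · intro h
    have key : ∀ x : Ext M N 1, x = 0 := fun x => by
      obtain ⟨φ, rfl⟩ := extOf_surjective hm x
      exact (extOf_eq_zero_iff hm φ).2 (h φ)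
    exact ⟨fun x y => (key x).trans (key y).symm⟩

/-- A criterion for the first extension group to be a line. -/
theorem ext_linearEquiv {K : Type u} [Field K] [Algebra K R] {m : M}
    (hm : ∀ x : M, ∃ r : R, r • m = x) (φ₀ : annih R m →ₗ[R] N)
    (h₀ : ¬ ∃ n : N, ∀ l, φ₀ l = (l : R) • n)
    (h : ∀ φ : annih R m →ₗ[R] N, ∃ (c : K) (n : N), ∀ l,
      φ l = algebraMap K R c • φ₀ l + (l : R) • n) :
    Nonempty (Ext M N 1 ≃ₗ[K] K) := by
  rw [← extOf_eq_zero_iff hm] at h₀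
  have hsmul : ∀ c : K, c • extOf hm φ₀ = (cyclicSeq_shortExact hm).extClass.comp
      (Ext.mk₀ (c • homFst φ₀)) (add_zero 1) := by
    intro c
    rw [Ext.mk₀_smul]
    exact (Ext.comp_smul _ _ _ _).symm
  refine ⟨(LinearEquiv.ofBijective (LinearMap.toSpanSingleton K _ (extOf hm φ₀)) ⟨?_, ?_⟩).symm⟩
  · rw [← LinearMap.ker_eq_bot, LinearMap.ker_toSpanSingleton K h₀]
  · intro x
    obtain ⟨φ, rfl⟩ := extOf_surjective hm x
    obtain ⟨c, n, hc⟩ := h φ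
    refine ⟨c, ?_⟩
    have e : homFst φ = c • homFst φ₀ + (cyclicSeq m).f ≫ homSnd m n := by
      ext l
      exact hc l
    rw [LinearMap.toSpanSingleton_apply, hsmul, extOf, e, Ext.mk₀_add, ← Ext.mk₀_comp_mk₀,
      Ext.comp_add, ShortComplex.ShortExact.extClass_comp_assoc, add_zero]

end ExtCyclic
end AffineTL

namespace AffineTL

/-! ### Periodic sets of integers -/

section Periodic

variable {n : ℕ} {p q : ℤ → Prop}

theorem periodic_mul (hp : ∀ i, p (i + n) ↔ p i) (m i : ℤ) : p (i + m * n) ↔ p i := by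
  induction m generalizing i with
  | zero => simp
  | succ m ih =>
    have : i + ((m : ℤ) + 1) * n = i + m * n + n := by ring
    rw [this, hp, ih]
  | pred m ih =>
    have : i + -(m : ℤ) * n = i + (-(m : ℤ) - 1) * n + n := by ring
    rw [← ih i, this, hp]

theorem exists_next [NeZero n] (hp : ∀ i, p (i + n) ↔ p i) {i : ℤ} (hi : p i) :
    ∃ j, p j ∧ i < j ∧ ∀ k, i < k → k < j → ¬ p k := by
  have hn : (0 : ℤ) < n := by exact_mod_cast NeZero.pos n
  obtain ⟨j, ⟨h1, h2⟩, h3⟩ := Int.exists_least_of_bdd (P := fun k => i < k ∧ p k)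
    ⟨i, fun z hz => hz.1.le⟩ ⟨i + n, by omega, (hp i).2 hi⟩
  exact ⟨j, h2, h1, fun k hk hkj hpk => absurd (h3 k ⟨hk, hpk⟩) (by omega)⟩

theorem exists_prev [NeZero n] (hp : ∀ i, p (i + n) ↔ p i) {i : ℤ} (hi : p i) :
    ∃ j, p j ∧ j < i ∧ ∀ k, j < k → k < i → ¬ p k := by
  have hn : (0 : ℤ) < n := by exact_mod_cast NeZero.pos n
  obtain ⟨j, ⟨h1, h2⟩, h3⟩ := Int.exists_greatest_of_bdd (P := fun k => k < i ∧ p k)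
    ⟨i, fun z hz => hz.1.le⟩ ⟨i - n, by omega, by rw [← hp]; simpa using hi⟩
  exact ⟨j, h2, h1, fun k hk hkj hpk => absurd (h3 k ⟨hkj, hpk⟩) (by omega)⟩

open Classical in
/-- The number of elements of a periodic set in a period. -/
noncomputable def count (n : ℕ) (p : ℤ → Prop) : ℕ :=
  ((Finset.range n).filter fun i : ℕ => p i).card

theorem emod_spec [NeZero n] (i : ℤ) : ∃ m : ℤ, ∃ a ∈ Finset.range n, i = (a : ℕ) + m * n := by
  have hn : (0 : ℤ) < n := by exact_mod_cast NeZero.pos n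
  have h1 := Int.emod_nonneg i hn.ne'
  have h2 := Int.emod_lt_of_pos i hn
  refine ⟨i / n, (i % n).toNat, by simp; omega, ?_⟩
  rw [Int.toNat_of_nonneg h1]
  linarith [Int.emod_add_mul_ediv i n]

theorem eq_of_range {a b : ℕ} (ha : a ∈ Finset.range n) (hb : b ∈ Finset.range n) {m : ℤ}
    (h : (b : ℤ) = a + m * n) : a = b := by
  simp only [Finset.mem_range] at ha hb
  have hm : m = 0 := by
    rcases lt_trichotomy m 0 with h1 | h1 | h1
    · have : m * n ≤ -1 * n := mul_le_mul_of_nonneg_right (by omega) (by omega)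
      omega
    · exact h1
    · have : 1 * (n : ℤ) ≤ m * n := mul_le_mul_of_nonneg_right (by omega) (by omega)
      omega
  subst hm
  omega

/-- Reduction modulo `n` turns `f` into an injection between the elements of one period: if two
values agree modulo `n`, translating one argument makes them equal. -/
theorem count_le [NeZero n] (hp : ∀ i, p (i + n) ↔ p i) (hq : ∀ i, q (i + n) ↔ q i) (f : ℤ → ℤ)
    (hf : ∀ i, p i → ∀ m : ℤ, f (i + m * n) = f i + m * n) (hpq : ∀ i, p i → q (f i))
    (hinj : ∀ i j, p i → p j → f i = f j → i = j) : count n p ≤ count n q := by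
  classical
  choose m a ha hia using emod_spec (n := n)
  refine Finset.card_le_card_of_injOn (fun i => a (f i)) ?_ ?_
  · intro i hi
    simp only [Finset.coe_filter, Set.mem_ofPred_eq] at hi ⊢
    refine ⟨ha _, ?_⟩
    have := hpq _ hi.2
    rw [hia (f i), periodic_mul hq] at this
    exact this
  · intro i hi j hj hij
    simp only [Finset.coe_filter, Set.mem_ofPred_eq] at hi hj hij
    have h1 : f j = f (i + (m (f j) - m (f i)) * n) := by
      rw [hf _ hi.2]
      have e1 := hia (f i)
      have e2 := hia (f j)
      rw [hij] at e1
      linarith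
    have h2 := hinj _ _ hj.2 ((periodic_mul hp _ _).2 hi.2) h1
    exact eq_of_range hi.1 hj.1 h2

theorem count_le_of_imp (h : ∀ i, p i → q i) : count n p ≤ count n q := by
  classical
  refine Finset.card_le_card fun i hi => ?_
  simp only [Finset.mem_filter] at hi ⊢
  exact ⟨hi.1, h _ hi.2⟩

/-- Within one period this is an inclusion of finite sets of equal cardinality; periodicity carries
the equality to all integers. It is what turns "no through-string is lost" into equality of halves.
-/
theorem iff_of_count_le [NeZero n] (hp : ∀ i, p (i + n) ↔ p i) (hq : ∀ i, q (i + n) ↔ q i)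
    (h : ∀ i, p i → q i) (hc : count n q ≤ count n p) (i : ℤ) : q i → p i := by
  classical
  have he := Finset.eq_of_subset_of_card_le (s := (Finset.range n).filter fun i : ℕ => p i)
    (t := (Finset.range n).filter fun i : ℕ => q i) (fun i hi => by
      simp only [Finset.mem_filter] at hi ⊢
      exact ⟨hi.1, h _ hi.2⟩) hc
  obtain ⟨m, a, ha, rfl⟩ := emod_spec (n := n) i
  rw [periodic_mul hp, periodic_mul hq]
  intro hqa
  have : a ∈ (Finset.range n).filter fun i : ℕ => p i := he ▸ Finset.mem_filter.2 ⟨ha, hqa⟩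
  exact (Finset.mem_filter.1 this).2

theorem exists_of_count_pos (h : 0 < count n p) : ∃ i, p i := by
  classical
  obtain ⟨i, hi⟩ := Finset.card_pos.1 h
  exact ⟨i, (Finset.mem_filter.1 hi).2⟩

theorem count_pos [NeZero n] (hp : ∀ i, p (i + n) ↔ p i) {i : ℤ} (hi : p i) : 0 < count n p := by
  by_contra hc
  have := iff_of_count_le (p := fun _ => False) (fun _ => Iff.rfl) hp (fun _ h => h.elim)
    (by omega) i hi
  exact this

open Classical in
/-- The number of elements of a set between two integers. -/
noncomputable def countBetween (p : ℤ → Prop) (a b : ℤ) : ℕ := ((Finset.Ico a b).filter p).card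

theorem countBetween_add {a b c : ℤ} (h1 : a ≤ b) (h2 : b ≤ c) :
    countBetween p a c = countBetween p a b + countBetween p b c := by
  classical
  rw [countBetween, countBetween, countBetween, ← Finset.card_union_of_disjoint,
    ← Finset.filter_union, Finset.Ico_union_Ico_eq_Ico h1 h2]
  exact Finset.disjoint_filter_filter (Finset.Ico_disjoint_Ico_consecutive a b c)

theorem countBetween_next {a b : ℤ} (ha : p a) (hab : a < b) (h : ∀ k, a < k → k < b → ¬ p k) :
    countBetween p a b = 1 := by
  classical
  rw [countBetween, Finset.card_eq_one]
  refine ⟨a, Finset.ext fun k => ?_⟩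
  simp only [Finset.mem_filter, Finset.mem_Ico, Finset.mem_singleton]
  constructor
  · rintro ⟨⟨h1, h2⟩, h3⟩
    by_contra hne
    exact h k (by omega) h2 h3
  · rintro rfl
    exact ⟨⟨le_rfl, hab⟩, ha⟩

/-- Sliding the window by one step loses an element exactly when it gains the translate of that
element, so the count can be made at `a = 0`. -/
theorem countBetween_period (hp : ∀ i, p (i + n) ↔ p i) (a : ℤ) :
    countBetween p a (a + n) = count n p := by
  classical
  have hshift : ∀ a b : ℤ, countBetween p (a + n) (b + n) = countBetween p a b := by
    intro a b
    have e : (Finset.Ico (a + n) (b + n)).filter p =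
        ((Finset.Ico a b).filter p).map (addRightEmbedding (n : ℤ)) := by
      ext k
      simp only [Finset.mem_filter, Finset.mem_Ico, Finset.mem_map, addRightEmbedding_apply]
      constructor
      · rintro ⟨⟨h1, h2⟩, h3⟩
        exact ⟨k - n, ⟨⟨by omega, by omega⟩, by rw [← hp]; simpa using h3⟩, by omega⟩
      · rintro ⟨l, ⟨⟨h1, h2⟩, h3⟩, rfl⟩
        exact ⟨⟨by omega, by omega⟩, (hp l).2 h3⟩
    rw [countBetween, countBetween, e, Finset.card_map]
  have hstep : ∀ a : ℤ, countBetween p (a + 1) (a + 1 + n) = countBetween p a (a + n) := by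
    intro a
    have h1 := countBetween_add (p := p) (a := a) (b := a + n) (c := a + 1 + n) (by omega) (by omega)
    have h2 := countBetween_add (p := p) (a := a) (b := a + 1) (c := a + 1 + n) (by omega) (by omega)
    have h3 := hshift a (a + 1)
    omega
  have hzero : countBetween p 0 (0 + n) = count n p := by
    rw [countBetween, count, ← Finset.card_map (Nat.castEmbedding (R := ℤ))]
    congr 1
    ext k
    simp only [Finset.mem_filter, Finset.mem_Ico, Finset.mem_map, Nat.castEmbedding_apply,
      Finset.mem_range]
    constructor
    · rintro ⟨⟨h1, h2⟩, h3⟩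
      refine ⟨k.toNat, ⟨by omega, ?_⟩, by omega⟩
      rwa [Int.toNat_of_nonneg h1]
    · rintro ⟨l, ⟨h1, h2⟩, rfl⟩
      exact ⟨⟨by omega, by omega⟩, h2⟩
  rw [← hzero]
  induction a with
  | zero => rfl
  | succ a ih => rw [hstep, ih]
  | pred a ih => rw [← ih, ← hstep]; congr 1 <;> ring

theorem eq_of_countBetween {a b c : ℤ} (hb : p b) (hc : p c) (hab : a ≤ b) (hac : a ≤ c)
    (h : countBetween p a b = countBetween p a c) : b = c := by
  classical
  have key : ∀ b c : ℤ, p b → a ≤ b → countBetween p a b = countBetween p a c → ¬ b < c := by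
    intro b c hb hab h hlt
    rw [countBetween_add hab hlt.le] at h
    have : 0 < countBetween p b c :=
      Finset.card_pos.2 ⟨b, Finset.mem_filter.2 ⟨Finset.mem_Ico.2 ⟨le_rfl, hlt⟩, hb⟩⟩
    omega
  have := key b c hb hab h
  have := key c b hc hac h.symm
  omega

end Periodic
end AffineTL

namespace AffineTL
namespace Diagram

variable {n : ℕ}

/-! ### Through-strings -/

/-- A through-string ends at the bottom node `j`. -/
def BotThrough (A : Diagram n) (j : ℤ) : Prop := ∃ i, A.other (Sum.inr j) = Sum.inl i

/-- A through-string ends at the top node `i`. -/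
def TopThrough (A : Diagram n) (i : ℤ) : Prop := ∃ j, A.other (Sum.inl i) = Sum.inr j

variable {A B C : Diagram n} {i i' j j' : ℤ}

theorem other_symm {x y : ℤ ⊕ ℤ} (h : A.other x = y) : A.other y = x := by
  rw [← h, A.other_other]

theorem not_botThrough : ¬ A.BotThrough j ↔ ∃ k, A.other (Sum.inr j) = Sum.inr k := by
  rcases h : A.other (Sum.inr j) with k | k <;> simp [BotThrough, h]

theorem not_topThrough : ¬ A.TopThrough i ↔ ∃ k, A.other (Sum.inl i) = Sum.inl k := by
  rcases h : A.other (Sum.inl i) with k | k <;> simp [TopThrough, h]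

theorem other_translate_mul (A : Diagram n) (m : ℤ) (x : ℤ ⊕ ℤ) :
    A.other (translate (m * n) x) = translate (m * n) (A.other x) := by
  have h := (act_comm A (r := (0 : Fin 2)) (s := 1) (by decide)).zmul m (place 0 1 x)
  rw [tr_place, act_place _ (by decide), act_place _ (by decide), tr_place] at h
  exact place_injective (by decide) h

theorem other_inr_add (h : A.other (Sum.inr j) = Sum.inl i) (m : ℤ) :
    A.other (Sum.inr (j + m * n)) = Sum.inl (i + m * n) := by
  have := A.other_translate_mul m (Sum.inr j)
  rw [h] at this
  exact this

theorem other_inr_add' (h : A.other (Sum.inr j) = Sum.inr i) (m : ℤ) :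
    A.other (Sum.inr (j + m * n)) = Sum.inr (i + m * n) := by
  have := A.other_translate_mul m (Sum.inr j)
  rw [h] at this
  exact this

theorem other_inl_add (h : A.other (Sum.inl j) = Sum.inr i) (m : ℤ) :
    A.other (Sum.inl (j + m * n)) = Sum.inr (i + m * n) := by
  have := A.other_translate_mul m (Sum.inl j)
  rw [h] at this
  exact this

theorem botThrough_periodic (A : Diagram n) (j : ℤ) : A.BotThrough (j + n) ↔ A.BotThrough j := by
  constructor
  · rintro ⟨i, h⟩
    have := other_inr_add h (-1)
    exact ⟨_, by simpa using this⟩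
  · rintro ⟨i, h⟩
    have := other_inr_add h 1
    exact ⟨_, by simpa using this⟩

theorem topThrough_periodic (A : Diagram n) (j : ℤ) : A.TopThrough (j + n) ↔ A.TopThrough j := by
  constructor
  · rintro ⟨i, h⟩
    have := other_inl_add h (-1)
    exact ⟨_, by simpa using this⟩
  · rintro ⟨i, h⟩
    have := other_inl_add h 1
    exact ⟨_, by simpa using this⟩

theorem through_eq_count_top (A : Diagram n) : A.through = count n A.TopThrough := by
  classical
  rw [through, count]
  congr 1
  refine Finset.filter_congr fun i _ => ?_
  rcases h : A.other (Sum.inl (i : ℤ)) with k | k <;> simp [TopThrough, h]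

/-- Following a through-string from end to end is an equivariant bijection between top and bottom
ends, so it may be used in both directions in `count_le`. -/
theorem through_eq_count_bot [NeZero n] (A : Diagram n) : A.through = count n A.BotThrough := by
  rw [through_eq_count_top]
  -- The horizontal position of the other end of the edge at `x`, in whichever row that end lies.
  have hex : ∀ x, ∃ y, ∀ i, A.other x = Sum.inl i ∨ A.other x = Sum.inr i → y = i := fun x => by
    rcases A.other x with k | k
    · exact ⟨k, by rintro i (h | h) <;> simp_all⟩
    · exact ⟨k, by rintro i (h | h) <;> simp_all⟩
  choose g hg using hex
  apply le_antisymm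
  · refine count_le A.topThrough_periodic A.botThrough_periodic (fun i => g (Sum.inl i)) ?_ ?_ ?_
    · rintro i ⟨j, h⟩ m
      simp only [hg _ _ (Or.inr h), hg _ _ (Or.inr (other_inl_add h m))]
    · rintro i ⟨j, h⟩
      simp only [hg _ _ (Or.inr h)]
      exact ⟨i, other_symm h⟩
    · rintro i i' ⟨j, h⟩ ⟨j', h'⟩ e
      simp only [hg _ _ (Or.inr h), hg _ _ (Or.inr h')] at e
      subst e
      exact Sum.inl_injective ((other_symm h).symm.trans (other_symm h'))
  · refine count_le A.botThrough_periodic A.topThrough_periodic (fun i => g (Sum.inr i)) ?_ ?_ ?_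
    · rintro i ⟨j, h⟩ m
      simp only [hg _ _ (Or.inl h), hg _ _ (Or.inl (other_inr_add h m))]
    · rintro i ⟨j, h⟩
      simp only [hg _ _ (Or.inl h)]
      exact ⟨i, other_symm h⟩
    · rintro i i' ⟨j, h⟩ ⟨j', h'⟩ e
      simp only [hg _ _ (Or.inl h), hg _ _ (Or.inl h')] at e
      subst e
      exact Sum.inr_injective ((other_symm h).symm.trans (other_symm h'))

/-- Through-strings do not cross. -/
theorem through_lt (h : A.other (Sum.inr j) = Sum.inl i) (h' : A.other (Sum.inr j') = Sum.inl i')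
    (hj : j < j') : i < i' := by
  by_contra hc
  have hne : i ≠ i' := by
    rintro rfl
    have := (other_symm h).symm.trans (other_symm h')
    simp only [Sum.inr.injEq] at this
    omega
  have := A.planar (Sum.inl i') (Sum.inl i)
  rw [other_symm h, other_symm h'] at this
  exact this ⟨by change i' < i; omega, trivial, hj⟩

theorem through_lt_iff (h : A.other (Sum.inr j) = Sum.inl i)
    (h' : A.other (Sum.inr j') = Sum.inl i') : i < i' ↔ j < j' := by
  refine ⟨fun hi => ?_, through_lt h h'⟩
  rcases lt_trichotomy j j' with h1 | h1 | h1
  · exact h1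
  · subst h1
    rw [h] at h'
    simp only [Sum.inl.injEq] at h'
    omega
  · have := through_lt h' h h1
    omega

theorem SameBottom.botThrough (h : A.SameBottom B) (j : ℤ) : A.BotThrough j ↔ B.BotThrough j := by
  rw [← not_iff_not, not_botThrough, not_botThrough]
  exact exists_congr fun k => h j k

theorem SameTop.topThrough (h : A.SameTop B) (j : ℤ) : A.TopThrough j ↔ B.TopThrough j := by
  rw [← not_iff_not, not_topThrough, not_topThrough]
  exact exists_congr fun k => h j k

theorem SameBottom.symm (h : A.SameBottom B) : B.SameBottom A := fun i j => (h i j).symm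

theorem SameTop.symm (h : A.SameTop B) : B.SameTop A := fun i j => (h i j).symm

theorem SameBottom.trans (h : A.SameBottom B) (h' : B.SameBottom C) : A.SameBottom C :=
  fun i j => (h i j).trans (h' i j)

theorem SameTop.trans (h : A.SameTop B) (h' : B.SameTop C) : A.SameTop C :=
  fun i j => (h i j).trans (h' i j)

theorem SameBottom.through_eq [NeZero n] (h : A.SameBottom B) : A.through = B.through := by
  rw [through_eq_count_bot, through_eq_count_bot]
  congr 1
  exact funext fun j => propext (h.botThrough j)

theorem SameTop.through_eq (h : A.SameTop B) : A.through = B.through := by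
  rw [through_eq_count_top, through_eq_count_top]
  congr 1
  exact funext fun j => propext (h.topThrough j)

theorem exists_botThrough [NeZero n] (h : 0 < A.through) : ∃ j, A.BotThrough j := by
  rw [through_eq_count_bot] at h
  exact exists_of_count_pos h

theorem through_pos [NeZero n] (h : A.BotThrough j) : 0 < A.through := by
  rw [through_eq_count_bot]
  exact count_pos A.botThrough_periodic h

theorem lines_of_through_pos [NeZero n] (h : 0 < A.through) : A.lines = 0 := by
  obtain ⟨j, i, h⟩ := exists_botThrough h
  exact A.lines_eq_zero _ _ (other_symm h)

/-- One implication between arcs suffices: a node without an arc of `A` ends a through-string of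
`A`, hence one of `B`, so `B` cannot have an additional arc there. -/
theorem sameBottom_of_imp (h : ∀ j k, A.other (Sum.inr j) = Sum.inr k →
    B.other (Sum.inr j) = Sum.inr k) (ht : ∀ j, A.BotThrough j → B.BotThrough j) :
    A.SameBottom B := by
  refine fun j k => ⟨h j k, fun hB => ?_⟩
  by_cases hA : A.BotThrough j
  · obtain ⟨i, hi⟩ := ht j hA
    rw [hB] at hi
    simp at hi
  · obtain ⟨l, hl⟩ := not_botThrough.1 hA
    rw [← hB, h j l hl, hl]

theorem sameTop_of_imp (h : ∀ j k, A.other (Sum.inl j) = Sum.inl k →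
    B.other (Sum.inl j) = Sum.inl k) (ht : ∀ j, A.TopThrough j → B.TopThrough j) :
    A.SameTop B := by
  refine fun j k => ⟨h j k, fun hB => ?_⟩
  by_cases hA : A.TopThrough j
  · obtain ⟨i, hi⟩ := ht j hA
    rw [hB] at hi
    simp at hi
  · obtain ⟨l, hl⟩ := not_topThrough.1 hA
    rw [← hB, h j l hl, hl]

/-- A diagram with through-strings is determined by its halves and the map from the bottom ends to
the top ends. -/
theorem ext_of_through [NeZero n] (hA : 0 < A.through) (ht : A.SameTop B) (hb : A.SameBottom B)
    (h : ∀ i j, A.other (Sum.inr j) = Sum.inl i → B.other (Sum.inr j) = Sum.inl i) : A = B := by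
  ext x
  · rcases x with i | j
    · rcases hx : A.other (Sum.inl i) with k | k
      · exact ((ht i k).1 hx).symm
      · exact (other_symm (h _ _ (other_symm hx))).symm
    · rcases hx : A.other (Sum.inr j) with k | k
      · exact (h _ _ hx).symm
      · exact ((hb j k).1 hx).symm
  · rw [lines_of_through_pos hA, lines_of_through_pos (ht.through_eq ▸ hA)]

/-! ### The halves of a product -/

section Comp

variable [NeZero n] (A B : Diagram n)

theorem comp_inl {i j : ℤ} (h : A.other (Sum.inl i) = Sum.inl j) :
    (comp A B).other (Sum.inl i) = Sum.inl j := strandEnd_of_inl A B h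

theorem comp_inr {i j : ℤ} (h : B.other (Sum.inr i) = Sum.inr j) :
    (comp A B).other (Sum.inr i) = Sum.inr j := strandEnd_of_inr A B h

theorem comp_inr_inl {i j k : ℤ} (h : B.other (Sum.inr j) = Sum.inl k)
    (h' : A.other (Sum.inr k) = Sum.inl i) : (comp A B).other (Sum.inr j) = Sum.inl i := by
  refine eq_strandEnd A B (by simp) ?_
  have h1 := conn_step (S := stack A.other B.other) (Or.inr rfl) (place 1 2 (Sum.inr j))
  rw [act_place _ (by decide), h] at h1
  have h2 := conn_step (S := stack A.other B.other) (Or.inl rfl) (place 0 1 (Sum.inr k))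
  rw [act_place _ (by decide), h'] at h2
  exact h1.trans h2

variable {A B}

theorem botThrough_of_comp {j : ℤ} (h : (comp A B).BotThrough j) : B.BotThrough j := by
  by_contra hc
  obtain ⟨k, hk⟩ := not_botThrough.1 hc
  obtain ⟨i, hi⟩ := h
  rw [comp_inr A B hk] at hi
  simp at hi

theorem topThrough_of_comp {j : ℤ} (h : (comp A B).TopThrough j) : A.TopThrough j := by
  by_contra hc
  obtain ⟨k, hk⟩ := not_topThrough.1 hc
  obtain ⟨i, hi⟩ := h
  rw [comp_inl A B hk] at hi
  simp at hi

variable (A B)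

theorem through_comp_le_right : (comp A B).through ≤ B.through := by
  rw [through_eq_count_bot, through_eq_count_bot]
  exact count_le_of_imp fun _ => botThrough_of_comp

theorem through_comp_le_left : (comp A B).through ≤ A.through := by
  rw [through_eq_count_top, through_eq_count_top]
  exact count_le_of_imp fun _ => topThrough_of_comp

variable {A B}

/-- Bottom arcs of `B` survive in the product, and the bottom through ends of the product are among
those of `B`. If no through-string is lost, the two sets of ends coincide. -/
theorem sameBottom_comp (h : B.through ≤ (comp A B).through) : B.SameBottom (comp A B) := by
  rw [through_eq_count_bot, through_eq_count_bot] at h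
  exact sameBottom_of_imp (fun j k => comp_inr A B)
    (iff_of_count_le (botThrough_periodic _) (botThrough_periodic _)
      (fun _ => botThrough_of_comp) h)

theorem sameTop_comp (h : A.through ≤ (comp A B).through) : A.SameTop (comp A B) := by
  rw [through_eq_count_top, through_eq_count_top] at h
  exact sameTop_of_imp (fun j k => comp_inl A B)
    (iff_of_count_le (topThrough_periodic _) (topThrough_periodic _)
      (fun _ => topThrough_of_comp) h)

omit [NeZero n] in
/-- The loops of a product only depend on the halves which are glued. -/
theorem loopSet_subset {A' B' : Diagram n} (hA : A.SameBottom A') (hB : B.SameTop B') (w : Prop) :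
    loopSet n (stack A.other B.other) {1} w ⊆ loopSet n (stack A'.other B'.other) {1} w := by
  have step : ∀ i : ℤ, (act A.other (0 : Fin 3) 1 (1, i)).1 = 1 →
      (act B.other (1 : Fin 3) 2 (1, i)).1 = 1 →
      act A.other (0 : Fin 3) 1 (1, i) = act A'.other 0 1 (1, i) ∧
      act B.other (1 : Fin 3) 2 (1, i) = act B'.other 1 2 (1, i) := by
    intro i
    have eA : ∀ D : Diagram n, act D.other (0 : Fin 3) 1 (1, i) =
        place 0 1 (D.other (Sum.inr i)) := fun D => act_place D.other (by decide) (Sum.inr i)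
    have eB : ∀ D : Diagram n, act D.other (1 : Fin 3) 2 (1, i) =
        place 1 2 (D.other (Sum.inl i)) := fun D => act_place D.other (by decide) (Sum.inl i)
    rw [eA, eA, eB, eB]
    intro h1 h2
    rcases h3 : A.other (Sum.inr i) with k | k
    · rw [h3] at h1
      exact absurd h1 (by simp [place])
    rcases h4 : B.other (Sum.inl i) with l | l
    · rw [(hA i k).1 h3, (hB i l).1 h4]
      exact ⟨rfl, rfl⟩
    · rw [h4] at h2
      exact absurd h2 (by simp [place])
  rintro _ ⟨p, rfl, hrow, hw⟩
  have stay : ∀ q, Conn (stack A.other B.other) p q → q.1 = 1 ∧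
      act A.other (0 : Fin 3) 1 q = act A'.other 0 1 q ∧
      act B.other (1 : Fin 3) 2 q = act B'.other 1 2 q := by
    intro q hq
    have h1 : q.1 = 1 := hrow q hq
    obtain ⟨r, i⟩ := q
    obtain rfl : r = 1 := h1
    exact ⟨rfl, step i (hrow _ (hq.trans (conn_step (Or.inl rfl) _)))
      (hrow _ (hq.trans (conn_step (Or.inr rfl) _)))⟩
  have hconn : ∀ q, Conn (stack A.other B.other) p q ↔ Conn (stack A'.other B'.other) p q := by
    intro q
    constructor
    · intro h
      induction h with
      | refl => exact Relation.ReflTransGen.refl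
      | tail hq hs ih =>
        obtain ⟨g, rfl | rfl, rfl⟩ := hs
        · rw [(stay _ hq).2.1]
          exact ih.trans (conn_step (Or.inl rfl) _)
        · rw [(stay _ hq).2.2]
          exact ih.trans (conn_step (Or.inr rfl) _)
    · intro h
      induction h with
      | refl => exact Relation.ReflTransGen.refl
      | tail _ hs ih =>
        obtain ⟨g, rfl | rfl, rfl⟩ := hs
        · rw [← (stay _ ih).2.1]
          exact ih.trans (conn_step (Or.inl rfl) _)
        · rw [← (stay _ ih).2.2]
          exact ih.trans (conn_step (Or.inr rfl) _)
  refine ⟨p, ?_, fun q hq => hrow q ((hconn q).2 hq), ?_⟩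
  · simp only [CylConn, hconn]
  · rw [← hw]
    simp only [Winds, hconn]

omit [NeZero n] in
theorem loops_congr {A' B' : Diagram n} (hA : A.SameBottom A') (hB : B.SameTop B') :
    A.loops B = A'.loops B' := by
  rw [loops, loops, (loopSet_subset hA hB False).antisymm (loopSet_subset hA.symm hB.symm False)]

end Comp

end Diagram
end AffineTL

/-! ### Shifts of the through ends and reflected diagrams -/

namespace AffineTL

/-- A monotone periodic permutation of a periodic set of integers. -/
structure Shift (n : ℕ) (p : ℤ → Prop) where
  /-- the permutation -/
  fwd : ℤ → ℤ
  /-- its inverse -/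
  bwd : ℤ → ℤ
  fwd_mem : ∀ i, p i → p (fwd i)
  bwd_mem : ∀ i, p i → p (bwd i)
  bwd_fwd : ∀ i, p i → bwd (fwd i) = i
  fwd_bwd : ∀ i, p i → fwd (bwd i) = i
  fwd_add : ∀ i, p i → fwd (i + n) = fwd i + n
  bwd_add : ∀ i, p i → bwd (i + n) = bwd i + n
  mono : ∀ i j, p i → p j → i < j → fwd i < fwd j

namespace Shift

variable {n : ℕ} {p : ℤ → Prop}

/-- The identity. -/
def id (n : ℕ) (p : ℤ → Prop) : Shift n p where
  fwd i := i
  bwd i := i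
  fwd_mem _ h := h
  bwd_mem _ h := h
  bwd_fwd _ _ := rfl
  fwd_bwd _ _ := rfl
  fwd_add _ _ := rfl
  bwd_add _ _ := rfl
  mono _ _ _ _ h := h

/-- The next element. -/
theorem exists_succ [NeZero n] (hp : ∀ i, p (i + n) ↔ p i) :
    ∃ s : Shift n p, ∀ i, p i → i < s.fwd i ∧ ∀ k, i < k → k < s.fwd i → ¬ p k := by
  have hf : ∀ i, ∃ j, p i → p j ∧ i < j ∧ ∀ k, i < k → k < j → ¬ p k := fun i => by
    by_cases h : p i
    · obtain ⟨j, hj⟩ := exists_next hp h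
      exact ⟨j, fun _ => hj⟩
    · exact ⟨0, fun h' => absurd h' h⟩
  have hb : ∀ i, ∃ j, p i → p j ∧ j < i ∧ ∀ k, j < k → k < i → ¬ p k := fun i => by
    by_cases h : p i
    · obtain ⟨j, hj⟩ := exists_prev hp h
      exact ⟨j, fun _ => hj⟩
    · exact ⟨0, fun h' => absurd h' h⟩
  choose f hf using hf
  choose b hb using hb
  -- The next and the previous element are unique. That the two maps are inverse to each other and
  -- periodic follows from this alone.
  have uniq : ∀ i j j', p j → i < j → (∀ k, i < k → k < j → ¬ p k) → p j' → i < j' →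
      (∀ k, i < k → k < j' → ¬ p k) → j = j' := by
    intro i j j' h1 h2 h3 h4 h5 h6
    by_contra hne
    rcases lt_or_gt_of_ne hne with h | h
    · exact h6 j h2 h h1
    · exact h3 j' h5 h h4
  have uniq' : ∀ i j j', p j → j < i → (∀ k, j < k → k < i → ¬ p k) → p j' → j' < i →
      (∀ k, j' < k → k < i → ¬ p k) → j = j' := by
    intro i j j' h1 h2 h3 h4 h5 h6
    by_contra hne
    rcases lt_or_gt_of_ne hne with h | h
    · exact h3 j' h h5 h4
    · exact h6 j h h2 h1
  have shift : ∀ k, ¬ p (k - n) → ¬ p k := fun k h h' => h (by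
    rw [← hp]
    simpa using h')
  refine ⟨⟨f, b, fun i h => (hf i h).1, fun i h => (hb i h).1, fun i h => ?_, fun i h => ?_,
    fun i h => ?_, fun i h => ?_, fun i j hi hj hij => ?_⟩, fun i h => (hf i h).2⟩
  · obtain ⟨h1, h2, h3⟩ := hf i h
    obtain ⟨h4, h5, h6⟩ := hb _ h1
    exact uniq' _ _ _ h4 h5 h6 h h2 h3
  · obtain ⟨h1, h2, h3⟩ := hb i h
    obtain ⟨h4, h5, h6⟩ := hf _ h1
    exact uniq _ _ _ h4 h5 h6 h h2 h3
  · obtain ⟨h1, h2, h3⟩ := hf i h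
    obtain ⟨h4, h5, h6⟩ := hf _ ((hp i).2 h)
    exact uniq _ _ _ h4 h5 h6 ((hp _).2 h1) (by omega) fun k hk hk' =>
      shift k (h3 _ (by omega) (by omega))
  · obtain ⟨h1, h2, h3⟩ := hb i h
    obtain ⟨h4, h5, h6⟩ := hb _ ((hp i).2 h)
    exact uniq' _ _ _ h4 h5 h6 ((hp _).2 h1) (by omega) fun k hk hk' =>
      shift k (h3 _ (by omega) (by omega))
  · have h1 := (hf i hi).2.2 j hij
    have h2 := (hf j hj).2.1
    by_contra hc
    exact h1 (by change ¬ f i < f j at hc; omega) hj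

end Shift

namespace Diagram

variable {n : ℕ}

/-- The diagram whose halves are the bottom half of `T` and its reflection; its through-strings are
given by a permutation of the ends of the through-strings of `T`. -/
def mirror (T : Diagram n) (s : Shift n T.BotThrough) : Diagram n where
  other := Sum.elim
    (fun i => Sum.elim (fun _ => Sum.inr (s.bwd i)) Sum.inl (T.other (Sum.inr i)))
    (fun j => Sum.elim (fun _ => Sum.inl (s.fwd j)) Sum.inr (T.other (Sum.inr j)))
  other_other := by
    rintro (i | i) <;> rcases h : T.other (Sum.inr i) with k | k
    · obtain ⟨l, hl⟩ := s.bwd_mem i ⟨k, h⟩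
      simp [h, hl, s.fwd_bwd i ⟨k, h⟩]
    · simp [h, other_symm h]
    · obtain ⟨l, hl⟩ := s.fwd_mem i ⟨k, h⟩
      simp [h, hl, s.bwd_fwd i ⟨k, h⟩]
    · simp [h, other_symm h]
  other_ne := by
    rintro (i | i) <;> rcases h : T.other (Sum.inr i) with k | k <;> simp [h]
    all_goals
      rintro rfl
      exact T.other_ne _ h
  other_translate := by
    have e : ∀ i : ℤ, T.other (Sum.inr (i + n)) = translate n (T.other (Sum.inr i)) :=
      fun i => T.other_translate (Sum.inr i)
    rintro (i | i) <;> rcases h : T.other (Sum.inr i) with k | k <;>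
      simp [e, h, translate]
    · exact s.bwd_add i ⟨k, h⟩
    · exact s.fwd_add i ⟨k, h⟩
  planar := by
    -- No through-string of `T` ends under an arc of `T`.
    have arc : ∀ {a c b k}, T.other (Sum.inr a) = Sum.inr c → T.other (Sum.inr b) = Sum.inl k →
        ¬ (a < b ∧ b < c) := by
      rintro a c b k h h' ⟨h1, h2⟩
      have := T.planar (Sum.inl k) (Sum.inr c)
      rw [other_symm h, other_symm h'] at this
      exact this ⟨trivial, h2, h1⟩
    -- Two arcs of `T` do not interleave. Both facts also serve the reflected half; pairs of
    -- through-strings are left, where `s` is monotone.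
    have arcs : ∀ {a c b d}, T.other (Sum.inr a) = Sum.inr c → T.other (Sum.inr b) = Sum.inr d →
        ¬ (a < b ∧ b < c ∧ c < d) := by
      rintro a c b d h h' ⟨h1, h2, h3⟩
      have := T.planar (Sum.inr d) (Sum.inr c)
      rw [other_symm h, other_symm h'] at this
      exact this ⟨h3, h2, h1⟩
    rintro (a | a) (b | b) <;> rcases ha : T.other (Sum.inr a) with c | c <;>
      rcases hb : T.other (Sum.inr b) with d | d <;>
      simp only [Sum.elim_inl, Sum.elim_inr, ha, hb, Before, true_and, and_true, false_and,
        and_false, not_false_eq_true]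
    · rintro ⟨h1, h2⟩
      have h3 := s.mono _ _ (s.bwd_mem b ⟨d, hb⟩) (s.bwd_mem a ⟨c, ha⟩) h2
      rw [s.fwd_bwd _ ⟨c, ha⟩, s.fwd_bwd _ ⟨d, hb⟩] at h3
      omega
    · exact arc ha hb
    · exact arcs ha hb
    · intro h
      obtain ⟨l, hl⟩ := s.bwd_mem a ⟨c, ha⟩
      exact arc (other_symm hb) hl ⟨h.2, h.1⟩
    · rintro ⟨h1, h2, h3⟩
      exact arcs (other_symm hb) (other_symm ha) ⟨h3, h2, h1⟩
  lines := 0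
  lines_eq_zero := fun _ _ _ => rfl

variable {T A : Diagram n} {s : Shift n T.BotThrough} {i j k : ℤ}

theorem mirror_inr_inr (h : T.other (Sum.inr j) = Sum.inr k) :
    (mirror T s).other (Sum.inr j) = Sum.inr k := by
  simp [mirror, h]

theorem mirror_inl_inl (h : T.other (Sum.inr j) = Sum.inr k) :
    (mirror T s).other (Sum.inl j) = Sum.inl k := by
  simp [mirror, h]

theorem mirror_inr_inl (h : T.BotThrough j) :
    (mirror T s).other (Sum.inr j) = Sum.inl (s.fwd j) := by
  obtain ⟨i, h⟩ := h
  simp [mirror, h]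

theorem mirror_inl_inr (h : T.BotThrough j) :
    (mirror T s).other (Sum.inl j) = Sum.inr (s.bwd j) := by
  obtain ⟨i, h⟩ := h
  simp [mirror, h]

theorem sameBottom_mirror (T : Diagram n) (s : Shift n T.BotThrough) :
    T.SameBottom (mirror T s) :=
  sameBottom_of_imp (fun _ _ h => mirror_inr_inr h) fun _ h => ⟨_, mirror_inr_inl h⟩

theorem sameTop_mirror (T : Diagram n) (s s' : Shift n T.BotThrough) :
    (mirror T s).SameTop (mirror T s') := by
  refine sameTop_of_imp (fun j k h => ?_) (fun j h => ?_)
  · by_cases hT : T.BotThrough j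
    · rw [mirror_inl_inr hT] at h
      simp at h
    · obtain ⟨l, hl⟩ := not_botThrough.1 hT
      rw [mirror_inl_inl hl] at h ⊢
      exact h
  · by_cases hT : T.BotThrough j
    · exact ⟨_, mirror_inl_inr hT⟩
    · obtain ⟨l, hl⟩ := not_botThrough.1 hT
      obtain ⟨m, h⟩ := h
      rw [mirror_inl_inl hl] at h
      simp at h

section Comp

variable [NeZero n]

theorem through_mirror (T : Diagram n) (s : Shift n T.BotThrough) :
    (mirror T s).through = T.through := (sameBottom_mirror T s).through_eq.symm

theorem comp_mirror_inr_inl (hj : T.BotThrough j)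
    (h : A.other (Sum.inr (s.fwd j)) = Sum.inl i) :
    (comp A (mirror T s)).other (Sum.inr j) = Sum.inl i :=
  comp_inr_inl A _ (mirror_inr_inl hj) h

theorem sameBottom_comp_mirror (hA : A.SameBottom T) :
    T.SameBottom (comp A (mirror T s)) := by
  refine sameBottom_of_imp (fun j k h => comp_inr _ _ (mirror_inr_inr h)) (fun j h => ?_)
  obtain ⟨i, hi⟩ := (hA.botThrough _).2 (s.fwd_mem j h)
  exact ⟨i, comp_mirror_inr_inl h hi⟩

theorem sameTop_comp_mirror (hA : A.SameBottom T) : A.SameTop (comp A (mirror T s)) :=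
  sameTop_comp (by rw [hA.through_eq, (sameBottom_comp_mirror (s := s) hA).through_eq])

/-- Each bottom arc of `A` is glued to its own reflection, so every closed component in the middle
row consists of just two nodes and cannot wind around the cylinder. -/
theorem newLines_mirror (hA : A.SameBottom T) : A.newLines (mirror T s) = 0 := by
  rw [newLines]
  suffices he : loopSet n (stack A.other (mirror T s).other) {1} True = ∅ by
    rw [he, Set.ncard_empty]
  rw [Set.eq_empty_iff_forall_notMem]
  rintro _ ⟨⟨r, i⟩, -, hrow, hw⟩
  obtain rfl : r = 1 := hrow _ Relation.ReflTransGen.refl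
  obtain ⟨m, hm, hmc⟩ := hw.2 trivial
  have e1 : ∀ i : ℤ, act A.other (0 : Fin 3) 1 (1, i) = place 0 1 (A.other (Sum.inr i)) :=
    fun i => act_place A.other (by decide) (Sum.inr i)
  have e2 : ∀ i : ℤ, act (mirror T s).other (1 : Fin 3) 2 (1, i) =
      place 1 2 ((mirror T s).other (Sum.inl i)) := fun i => act_place _ (by decide) (Sum.inl i)
  by_cases hi : A.BotThrough i
  · obtain ⟨k, hk⟩ := hi
    have := hrow _ (conn_step (Or.inl rfl) _)
    rw [e1, hk] at this
    exact absurd this (by simp [place])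
  · obtain ⟨k, hk⟩ := not_botThrough.1 hi
    have hT := (hA i k).1 hk
    have key : ∀ q, Conn (stack A.other (mirror T s).other) (1, i) q →
        q = (1, i) ∨ q = (1, k) := by
      intro q hq
      induction hq with
      | refl => exact Or.inl rfl
      | tail _ hs ih =>
        obtain ⟨g, rfl | rfl, rfl⟩ := hs
        · rcases ih with rfl | rfl
          · rw [e1, hk]
            exact Or.inr rfl
          · rw [e1, other_symm hk]
            exact Or.inl rfl
        · rcases ih with rfl | rfl
          · rw [e2, mirror_inl_inl hT]
            exact Or.inr rfl
          · rw [e2, mirror_inl_inl (other_symm hT)]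
            exact Or.inl rfl
    have hn : (n : ℤ) ≠ 0 := by exact_mod_cast NeZero.ne n
    have hmn : m * (n : ℤ) ≠ 0 := mul_ne_zero hm hn
    -- A winding component would contain `i + m n`. This is not `i`; if it were `k`, translating the
    -- arc by `m n` would give `k + m n = i`, hence `2 m n = 0`.
    rcases key _ hmc with h | h
    · simp only [tr, Prod.mk.injEq, true_and] at h
      omega
    · simp only [tr, Prod.mk.injEq, true_and] at h
      have h2 := other_inr_add' hk m
      rw [h, other_symm hk] at h2
      simp only [Sum.inr.injEq] at h2
      omega

/-- Gluing a bottom half to its reflection only produces contractible loops, and through-strings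
continue straight. The case without through-strings, where infinite lines may be present, is
included because the ideal `I_0` needs it. -/
theorem comp_mirror_id (hA : A.SameBottom T) : comp A (mirror T (Shift.id n _)) = A := by
  have hb := hA.trans (sameBottom_comp_mirror (s := Shift.id n _) hA)
  have ht := sameTop_comp_mirror (s := Shift.id n _) hA
  ext x
  · rcases x with i | j
    · by_cases hi : A.TopThrough i
      · obtain ⟨j, hj⟩ := hi
        have h1 := other_symm hj
        rw [hj]
        exact other_symm (comp_mirror_inr_inl (s := Shift.id n _)
          ((hA.botThrough j).1 ⟨i, h1⟩) h1)
      · obtain ⟨k, hk⟩ := not_topThrough.1 hi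
        rw [hk]
        exact (ht i k).1 hk
    · by_cases hj : A.BotThrough j
      · obtain ⟨i, hi⟩ := hj
        rw [hi]
        exact comp_mirror_inr_inl (s := Shift.id n _) ((hA.botThrough j).1 ⟨i, hi⟩) hi
      · obtain ⟨k, hk⟩ := not_botThrough.1 hj
        rw [hk]
        exact (hb j k).1 hk
  · change A.lines + 0 + A.newLines _ = A.lines
    rw [newLines_mirror hA]
    rfl

/-! ### Twists -/

/-- The permutation of the bottom ends of the through-strings moving each of them to the next. -/
noncomputable def succShift (T : Diagram n) : Shift n T.BotThrough :=
  Classical.choose (Shift.exists_succ T.botThrough_periodic)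

theorem succShift_spec (T : Diagram n) (hj : T.BotThrough j) : j < T.succShift.fwd j ∧
    ∀ k, j < k → k < T.succShift.fwd j → ¬ T.BotThrough k :=
  Classical.choose_spec (Shift.exists_succ T.botThrough_periodic) j hj

/-- Through-strings do not cross, so starting from the next bottom end of a through-string means
arriving at the next top end. Right multiplication by one fixed diagram therefore raises the winding
number by one. -/
theorem isTwist_comp (hA : A.SameBottom T) : A.IsTwist (comp A (mirror T T.succShift)) := by
  refine ⟨sameTop_comp_mirror hA, hA.trans (sameBottom_comp_mirror hA), fun i j h => ?_⟩
  have hj : T.BotThrough j := (hA.botThrough j).1 ⟨i, h⟩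
  obtain ⟨h1, h2⟩ := T.succShift_spec hj
  obtain ⟨i', hi'⟩ := (hA.botThrough _).2 (T.succShift.fwd_mem j hj)
  refine ⟨i', comp_mirror_inr_inl hj hi', through_lt h hi' h1, fun k hk hk' => ?_⟩
  rw [← not_topThrough]
  rintro ⟨l, hl⟩
  have hl := other_symm hl
  exact h2 l ((through_lt_iff h hl).1 hk) ((through_lt_iff hl hi').1 hk')
    ((hA.botThrough l).1 ⟨k, hl⟩)

theorem isTwist_mirror (T : Diagram n) :
    (mirror T (Shift.id n _)).IsTwist (mirror T T.succShift) := by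
  refine ⟨sameTop_mirror _ _ _,
    (sameBottom_mirror _ _).symm.trans (sameBottom_mirror _ _), fun i j h => ?_⟩
  have hj : T.BotThrough j := ((sameBottom_mirror T _).botThrough j).2 ⟨i, h⟩
  rw [mirror_inr_inl hj] at h
  obtain rfl : j = i := Sum.inl_injective h
  obtain ⟨h1, h2⟩ := T.succShift_spec hj
  refine ⟨_, mirror_inr_inl hj, h1, fun k hk hk' => ?_⟩
  obtain ⟨l, hl⟩ := not_botThrough.1 (h2 k hk hk')
  exact ⟨l, mirror_inl_inl hl⟩

variable {B B' A' : Diagram n}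

omit [NeZero n] in
theorem IsTwist.through_eq (h : A.IsTwist B) : A.through = B.through := h.1.through_eq

omit [NeZero n] in
theorem IsTwist.topThrough_iff (h : A.IsTwist B) {i : ℤ} : A.TopThrough i ↔ B.TopThrough i :=
  h.1.topThrough i

/-- The next top end is unique, and a diagram with through-strings is determined by its halves and
the matching of its ends. -/
theorem IsTwist.unique (hA : 0 < A.through) (h : A.IsTwist B) (h' : A.IsTwist B') : B = B' := by
  refine ext_of_through (h.through_eq ▸ hA) (h.1.symm.trans h'.1) (h.2.1.symm.trans h'.2.1) ?_
  intro i₁ j h1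
  obtain ⟨i, hi⟩ := (h.2.1.botThrough j).2 ⟨i₁, h1⟩
  obtain ⟨i₂, h2, h3, h4⟩ := h.2.2 i j hi
  obtain ⟨i₃, h5, h6, h7⟩ := h'.2.2 i j hi
  obtain rfl : i₁ = i₂ := Sum.inl_injective (h1.symm.trans h2)
  have t1 := h.topThrough_iff.2 ⟨j, other_symm h1⟩
  have t2 := h'.topThrough_iff.2 ⟨j, other_symm h5⟩
  rw [h5]
  congr 1
  by_contra hne
  rcases lt_or_gt_of_ne hne with hlt | hlt
  · exact not_topThrough.2 (h4 i₃ h6 hlt) t2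
  · exact not_topThrough.2 (h7 i₁ h3 hlt) t1

/-- Dually, the previous top end is unique. This lets coefficients be read off after twisting all
diagrams in a linear combination. -/
theorem IsTwist.injective (hA : 0 < A.through) (h : A.IsTwist B) (h' : A'.IsTwist B) :
    A = A' := by
  refine ext_of_through hA (h.1.trans h'.1.symm) (h.2.1.trans h'.2.1.symm) ?_
  intro i j hi
  obtain ⟨i', hi'⟩ := ((h.2.1.trans h'.2.1.symm).botThrough j).1 ⟨i, hi⟩
  obtain ⟨k, h2, h3, h4⟩ := h.2.2 i j hi
  obtain ⟨k', h5, h6, h7⟩ := h'.2.2 i' j hi'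
  obtain rfl : k = k' := Sum.inl_injective (h2.symm.trans h5)
  have tt := (h.1.trans h'.1.symm).topThrough
  have t1 : A.TopThrough i := ⟨j, other_symm hi⟩
  have t2 : A'.TopThrough i' := ⟨j, other_symm hi'⟩
  rw [hi']
  congr 1
  by_contra hne
  rcases lt_or_gt_of_ne hne with hlt | hlt
  · exact not_topThrough.2 (h7 i hlt h3) ((tt i).1 t1)
  · exact not_topThrough.2 (h4 i' hlt h6) ((tt i').2 t2)

end Comp

end Diagram
end AffineTL

/-! ### Iterated twists of diagrams with given halves -/

namespace AffineTL
namespace Diagram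

variable {n : ℕ} [NeZero n] {T A A' B : Diagram n} {i j k : ℤ}

-- Through-strings keep their order, so going right from a common one they match successively. If at
-- the first disagreement `A` ends at `i` and `A'` further right, then the string of `A'` ending at
-- `i` starts strictly between `j₀` and `j`. There both diagrams agree, so `A` would reach `i` from
-- two bottom nodes.
omit [NeZero n] in
theorem other_eq_of_ge (ht : A.SameTop A') (hb : A.SameBottom A') {i₀ j₀ : ℤ}
    (h : A.other (Sum.inr j₀) = Sum.inl i₀) (h' : A'.other (Sum.inr j₀) = Sum.inl i₀) (N : ℕ) :
    ∀ j, j₀ ≤ j → (j - j₀).toNat = N → A.other (Sum.inr j) = A'.other (Sum.inr j) := by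
  have key : ∀ {A A' : Diagram n}, A.SameTop A' → A.other (Sum.inr j₀) = Sum.inl i₀ →
      A'.other (Sum.inr j₀) = Sum.inl i₀ → ∀ j, j₀ < j →
      (∀ l, j₀ ≤ l → l < j → A.other (Sum.inr l) = A'.other (Sum.inr l)) → ∀ i i',
      A.other (Sum.inr j) = Sum.inl i → A'.other (Sum.inr j) = Sum.inl i' → ¬ i < i' := by
    intro A A' ht h h' j hj ih i i' hi hi' hlt
    obtain ⟨l, hl⟩ := (ht.topThrough i).1 ⟨j, other_symm hi⟩
    have hl := other_symm hl
    have h1 := (through_lt_iff hl hi').1 hlt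
    have h2 := (through_lt_iff h' hl).1 (through_lt h hi hj)
    have h3 := (ih l h2.le h1).trans hl
    have h4 := (other_symm h3).symm.trans (other_symm hi)
    simp only [Sum.inr.injEq] at h4
    omega
  induction N using Nat.strong_induction_on with
  | _ N ih =>
    intro j hj hN
    have ih' : ∀ l, j₀ ≤ l → l < j → A.other (Sum.inr l) = A'.other (Sum.inr l) := fun l h1 h2 =>
      ih _ (by omega) l h1 rfl
    rcases hj.eq_or_lt with rfl | hj
    · rw [h, h']
    rcases hi : A.other (Sum.inr j) with i | k
    · obtain ⟨i', hi'⟩ := (hb.botThrough j).1 ⟨i, hi⟩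
      have h1 := key ht h h' j hj ih' i i' hi hi'
      have h2 := key ht.symm h' h j hj (fun l a b => (ih' l a b).symm) i' i hi' hi
      rw [hi']
      congr 1
      omega
    · exact ((hb j k).1 hi).symm

/-- A diagram with through-strings is determined by its halves and one of its through-strings. -/
theorem ext_of_one_through (ht : A.SameTop A') (hb : A.SameBottom A') {i₀ j₀ : ℤ}
    (h : A.other (Sum.inr j₀) = Sum.inl i₀) (h' : A'.other (Sum.inr j₀) = Sum.inl i₀) : A = A' := by
  refine ext_of_through (through_pos ⟨i₀, h⟩) ht hb fun i j hi => ?_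
  have hn : (0 : ℤ) < n := by exact_mod_cast NeZero.pos n
  -- Since `n ≥ 1`, translating `j` by `|j₀ - j|` periods puts it to the right of `j₀`; the
  -- conclusion is then translated back.
  have h1 := other_eq_of_ge ht hb h h' _ (j + (|j₀ - j| : ℤ) * n)
    (by nlinarith [abs_nonneg (j₀ - j), le_abs_self (j₀ - j)]) rfl
  rw [other_inr_add hi] at h1
  have := other_inr_add h1.symm (-|j₀ - j|)
  simpa using this

/-- Iterated twists. -/
noncomputable def twistIter (T A : Diagram n) (k : ℕ) : Diagram n :=
  (fun A => comp A (mirror T T.succShift))^[k] A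

theorem twistIter_zero (T A : Diagram n) : twistIter T A 0 = A := rfl

theorem twistIter_succ (T A : Diagram n) (k : ℕ) :
    twistIter T A (k + 1) = comp (twistIter T A k) (mirror T T.succShift) :=
  Function.iterate_succ_apply' _ _ _

theorem sameBottom_twistIter (hA : A.SameBottom T) (k : ℕ) : (twistIter T A k).SameBottom T := by
  induction k with
  | zero => exact hA
  | succ k ih =>
    rw [twistIter_succ]
    exact (sameBottom_comp_mirror ih).symm

theorem isTwist_twistIter (hA : A.SameBottom T) (k : ℕ) :
    (twistIter T A k).IsTwist (twistIter T A (k + 1)) := by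
  rw [twistIter_succ]
  exact isTwist_comp (sameBottom_twistIter hA k)

theorem sameTop_twistIter (hA : A.SameBottom T) (k : ℕ) : A.SameTop (twistIter T A k) := by
  induction k with
  | zero => exact fun _ _ => Iff.rfl
  | succ k ih => exact ih.trans (isTwist_twistIter hA k).1

theorem isTwistChain_twistIter (hA : A.SameBottom T) : IsTwistChain T.through (twistIter T A) :=
  fun k => ⟨(sameBottom_twistIter hA k).through_eq, isTwist_twistIter hA k⟩

/-- Twists are unique, so a chain is determined by its first member and substitution into a chain
can be computed with iterated twists. -/
theorem eq_twistIter {t : ℕ} (ht : 0 < t) {β : ℕ → Diagram n} (hβ : IsTwistChain t β)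
    (hT : (β 0).SameBottom T) (k : ℕ) : β k = twistIter T (β 0) k := by
  induction k with
  | zero => rfl
  | succ k ih =>
    have h := (hβ k).2
    have h' := isTwist_twistIter hT k
    rw [← ih] at h'
    exact IsTwist.unique ((hβ k).1 ▸ ht) h h'

/-- A twist moves the top end above `j` to the next top end, which cannot jump over `i'`. The
distance to `i'` decreases until one through-string agrees, and then the diagrams are equal. -/
theorem exists_twistIter_of_le (hT : A.SameBottom T) (hT' : A'.SameBottom T) (ht : A.SameTop A')
    {i i' j : ℤ} (h : A.other (Sum.inr j) = Sum.inl i) (h' : A'.other (Sum.inr j) = Sum.inl i')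
    (hi : i ≤ i') : ∃ k, twistIter T A k = A' := by
  obtain ⟨N, hN⟩ : ∃ N, (i' - i).toNat = N := ⟨_, rfl⟩
  induction N using Nat.strong_induction_on generalizing A i with
  | _ N ih =>
    rcases hi.eq_or_lt with rfl | hlt
    · exact ⟨0, ext_of_one_through ht (hT.trans hT'.symm) h h'⟩
    · have htw := isTwist_comp hT
      obtain ⟨i₁, h1, h2, h3⟩ := htw.2.2 i j h
      have hle : i₁ ≤ i' := by
        by_contra hc
        exact not_topThrough.2 (h3 i' hlt (by omega)) ((ht.topThrough i').2 ⟨j, other_symm h'⟩)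
      obtain ⟨k, hk⟩ := ih _ (by omega) (htw.2.1.symm.trans hT) (htw.1.symm.trans ht) h1 hle rfl
      exact ⟨k + 1, hk⟩

/-- Two diagrams with the same halves are related by iterated twists. -/
theorem exists_twistIter (hpos : 0 < A.through) (hT : A.SameBottom T) (hT' : A'.SameBottom T)
    (ht : A.SameTop A') : ∃ k, twistIter T A k = A' ∨ twistIter T A' k = A := by
  obtain ⟨j, i, h⟩ := exists_botThrough hpos
  obtain ⟨i', h'⟩ := ((hT.trans hT'.symm).botThrough j).1 ⟨i, h⟩
  rcases le_total i i' with hi | hi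
  · obtain ⟨k, hk⟩ := exists_twistIter_of_le hT hT' ht h h' hi
    exact ⟨k, Or.inl hk⟩
  · obtain ⟨k, hk⟩ := exists_twistIter_of_le hT' hT ht.symm h' h hi
    exact ⟨k, Or.inr hk⟩

/-! ### Rotations -/

/-- The rotation by `m`. -/
def rotBy (n : ℕ) (m : ℤ) : Diagram n where
  other := Sum.elim (fun i => Sum.inr (i - m)) (fun i => Sum.inl (i + m))
  other_other := by rintro (i | i) <;> simp
  other_ne := by rintro (i | i) <;> simp
  other_translate := by
    rintro (i | i) <;> simp only [translate, Sum.map_inl, Sum.map_inr, Sum.elim_inl, Sum.elim_inr]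
    · congr 1; ring
    · congr 1; ring
  planar := by
    rintro (i | i) (j | j)
    · simp only [Before, Sum.elim_inl]; omega
    · simp [Before]
    · simp [Before]
    · simp only [Before, Sum.elim_inr]; omega
  lines := 0
  lines_eq_zero := fun _ _ _ => rfl

omit [NeZero n] in
theorem rotBy_inr (m j : ℤ) : (rotBy n m).other (Sum.inr j) = Sum.inl (j + m) := rfl

omit [NeZero n] in
theorem rotBy_inl (m j : ℤ) : (rotBy n m).other (Sum.inl j) = Sum.inr (j - m) := rfl

theorem rotBy_comp_inl_inl (m : ℤ) (h : A.other (Sum.inl i) = Sum.inl k) :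
    (comp (rotBy n m) A).other (Sum.inl (i + m)) = Sum.inl (k + m) := by
  refine eq_strandEnd _ _ (fun e => A.other_ne _ (h.trans ?_)) ?_
  · simp only [Sum.inl.injEq, add_left_inj] at e
    rw [e]
  have h1 := conn_step (S := stack (rotBy n m).other A.other) (Or.inl rfl)
    (place 0 1 (Sum.inl (i + m)))
  rw [act_place _ (by decide), rotBy_inl, add_sub_cancel_right] at h1
  have h2 := conn_step (S := stack (rotBy n m).other A.other) (Or.inr rfl) (place 1 2 (Sum.inl i))
  rw [act_place _ (by decide), h] at h2
  have h3 := conn_step (S := stack (rotBy n m).other A.other) (Or.inl rfl) (place 0 1 (Sum.inr k))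
  rw [act_place _ (by decide), rotBy_inr] at h3
  exact h1.trans (h2.trans h3)

theorem comp_rotBy_inr_inr (m : ℤ) (h : A.other (Sum.inr (i + m)) = Sum.inr (k + m)) :
    (comp A (rotBy n m)).other (Sum.inr i) = Sum.inr k := by
  refine eq_strandEnd _ _ (fun e => A.other_ne _ (h.trans ?_)) ?_
  · simp only [Sum.inr.injEq] at e
    rw [e]
  have h1 := conn_step (S := stack A.other (rotBy n m).other) (Or.inr rfl)
    (place 1 2 (Sum.inr i))
  rw [act_place _ (by decide), rotBy_inr] at h1
  have h2 := conn_step (S := stack A.other (rotBy n m).other) (Or.inl rfl)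
    (place 0 1 (Sum.inr (i + m)))
  rw [act_place _ (by decide), h] at h2
  have h3 := conn_step (S := stack A.other (rotBy n m).other) (Or.inr rfl)
    (place 1 2 (Sum.inl (k + m)))
  rw [act_place _ (by decide), rotBy_inl, add_sub_cancel_right] at h3
  exact h1.trans (h2.trans h3)

theorem rotBy_loops (m : ℤ) (A : Diagram n) : (rotBy n m).loops A = 0 := by
  rw [loops, loopSet_left_through _ _ _ fun i => ⟨_, rfl⟩, Set.ncard_empty]

theorem loops_rotBy (m : ℤ) (A : Diagram n) : A.loops (rotBy n m) = 0 := by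
  rw [loops, loopSet_right_through _ _ _ fun i => ⟨_, rfl⟩, Set.ncard_empty]

theorem rotBy_comp_lines (m : ℤ) (A : Diagram n) : (comp (rotBy n m) A).lines = A.lines := by
  change 0 + A.lines + (rotBy n m).newLines A = A.lines
  rw [newLines, loopSet_left_through _ _ _ fun i => ⟨_, rfl⟩, Set.ncard_empty]
  omega

theorem comp_rotBy_lines (m : ℤ) (A : Diagram n) : (comp A (rotBy n m)).lines = A.lines := by
  change A.lines + 0 + A.newLines (rotBy n m) = A.lines
  rw [newLines, loopSet_right_through _ _ _ fun i => ⟨_, rfl⟩, Set.ncard_empty]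
  rfl

theorem rotBy_comp_inr_inl (m : ℤ) (h : A.other (Sum.inr j) = Sum.inl i) :
    (comp (rotBy n m) A).other (Sum.inr j) = Sum.inl (i + m) :=
  comp_inr_inl _ _ h rfl

theorem comp_rotBy_inr_inl (m : ℤ) (h : A.other (Sum.inr (j + m)) = Sum.inl i) :
    (comp A (rotBy n m)).other (Sum.inr j) = Sum.inl i :=
  comp_inr_inl _ _ rfl h

theorem rotBy_comp_rotBy (a b : ℤ) : comp (rotBy n a) (rotBy n b) = rotBy n (b + a) := by
  have key : ∀ j, (comp (rotBy n a) (rotBy n b)).other (Sum.inr j) = Sum.inl (j + b + a) :=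
    fun j => rotBy_comp_inr_inl a rfl
  ext x
  · rcases x with i | j
    · refine other_symm ?_
      rw [rotBy_inl, key]
      congr 1
      ring
    · rw [key, rotBy_inr]
      congr 1
      ring
  · exact rotBy_comp_lines _ _

omit [NeZero n] in
theorem inl_inl_add (h : A.other (Sum.inl i) = Sum.inl k) (m : ℤ) :
    A.other (Sum.inl (i + m * n)) = Sum.inl (k + m * n) := by
  have := A.other_translate_mul m (Sum.inl i)
  rw [h] at this
  exact this

theorem fullRot_inl_inl (h : A.other (Sum.inl i) = Sum.inl k) :
    (comp (rotBy n n) A).other (Sum.inl i) = Sum.inl k := by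
  have := rotBy_comp_inl_inl (n : ℤ) (inl_inl_add h (-1))
  simpa using this

/-- Diagrams are invariant under translation by `n`: on either side the full rotation leaves the
arcs alone and adds `n` to the top end of each through-string. -/
theorem rotBy_comm (A : Diagram n) : comp (rotBy n n) A = comp A (rotBy n n) := by
  have h1 : ∀ i j, A.other (Sum.inr j) = Sum.inl i →
      (comp (rotBy n n) A).other (Sum.inr j) = Sum.inl (i + n) ∧
      (comp A (rotBy n n)).other (Sum.inr j) = Sum.inl (i + n) := by
    intro i j h
    refine ⟨rotBy_comp_inr_inl _ h, comp_rotBy_inr_inl _ ?_⟩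
    simpa using other_inr_add h 1
  have h2 : ∀ i k, A.other (Sum.inr i) = Sum.inr k →
      (comp A (rotBy n n)).other (Sum.inr i) = Sum.inr k := by
    intro i k h
    refine comp_rotBy_inr_inr _ ?_
    simpa using other_inr_add' h 1
  ext x
  · rcases x with i | j
    · rcases h : A.other (Sum.inl i) with k | k
      · rw [fullRot_inl_inl h, comp_inl _ _ h]
      · have h3 := other_inl_add h (-1)
        have h4 := h1 _ _ (other_symm h3)
        simp only [neg_mul, one_mul, neg_add_cancel_right] at h4
        rw [other_symm h4.1, other_symm h4.2]
    · rcases h : A.other (Sum.inr j) with i | k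
      · rw [(h1 _ _ h).1, (h1 _ _ h).2]
      · rw [comp_inr _ _ h, h2 _ _ h]
  · rw [rotBy_comp_lines, comp_rotBy_lines]

theorem sameTop_fullRot (A : Diagram n) : A.SameTop (comp (rotBy n n) A) := by
  refine sameTop_of_imp (fun _ _ => fullRot_inl_inl) fun i h => ?_
  obtain ⟨j, h⟩ := h
  have h3 := rotBy_comp_inr_inl (n : ℤ) (other_symm (other_inl_add h (-1)))
  simp only [neg_mul, one_mul, neg_add_cancel_right] at h3
  exact ⟨_, other_symm h3⟩

theorem sameBottom_fullRot (A : Diagram n) : A.SameBottom (comp (rotBy n n) A) :=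
  sameBottom_of_imp (fun _ _ => comp_inr _ _) fun _ ⟨_, h⟩ => ⟨_, rotBy_comp_inr_inl _ h⟩

/-- The full rotation is the `t`-fold twist. -/
theorem fullRot_eq_twistIter (hpos : 0 < T.through) (hA : A.SameBottom T) :
    comp (rotBy n n) A = twistIter T A T.through := by
  obtain ⟨j, hj⟩ := exists_botThrough hpos
  obtain ⟨i, h⟩ := (hA.botThrough j).2 hj
  -- After `k` twists the string from `j` has advanced by exactly `k` top ends, counted in the
  -- half-open interval from `i` to `i'`. With as many steps as through-strings this is one period.
  have key : ∀ k, ∃ i', (twistIter T A k).other (Sum.inr j) = Sum.inl i' ∧ i ≤ i' ∧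
      A.TopThrough i' ∧ countBetween A.TopThrough i i' = k := by
    intro k
    induction k with
    | zero => exact ⟨i, h, le_rfl, ⟨j, other_symm h⟩, by simp [countBetween]⟩
    | succ k ih =>
      obtain ⟨i', h1, h2, h3, h4⟩ := ih
      obtain ⟨i'', h5, h6, h7⟩ := (isTwist_twistIter hA k).2.2 _ _ h1
      have ht := sameTop_twistIter hA k
      refine ⟨i'', h5, by omega, ((sameTop_twistIter hA (k + 1)).topThrough _).2
        ⟨j, other_symm h5⟩, ?_⟩
      rw [countBetween_add h2 h6.le, h4, countBetween_next h3 h6]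
      intro l hl hl' hlA
      exact not_topThrough.2 (h7 l hl hl') ((ht.topThrough l).1 hlA)
  obtain ⟨i', h1, h2, h3, h4⟩ := key T.through
  have hn : (0 : ℤ) < n := by exact_mod_cast NeZero.pos n
  have hi : i' = i + n := by
    refine eq_of_countBetween (p := A.TopThrough) h3
      ((A.topThrough_periodic i).2 ⟨j, other_symm h⟩) h2 (by omega) ?_
    rw [h4, countBetween_period A.topThrough_periodic, ← through_eq_count_top, hA.through_eq]
  refine ext_of_one_through ((sameTop_fullRot A).symm.trans (sameTop_twistIter hA _))
    ((sameBottom_fullRot A).symm.trans (hA.trans (sameBottom_twistIter hA _).symm))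
    (rotBy_comp_inr_inl _ h) (hi ▸ h1)

end Diagram
end AffineTL

/-! ### Filtration of `D_n` by through-strings, and projections to a bottom half -/

namespace AffineTL

open Diagram

namespace DAlg

variable {K : Type*} [Field K] {δ : K} {n : ℕ}

/-- An element as a finitely supported function. -/
noncomputable def toFinsupp : DAlg K δ n ≃ₗ[K] (Diagram n →₀ K) := LinearEquiv.refl K _

theorem toFinsupp_of (A : Diagram n) : toFinsupp (of δ A) = Finsupp.single A 1 := rfl

theorem induction {p : DAlg K δ n → Prop} (zero : p 0) (add : ∀ x y, p x → p y → p (x + y))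
    (smul : ∀ (c : K) A, p (c • of δ A)) (x : DAlg K δ n) : p x := by
  refine Finsupp.induction_linear (M := K) (motive := fun f => p (toFinsupp.symm f)) (toFinsupp x) ?_ ?_ ?_
  · exact zero
  · exact fun f g hf hg => add _ _ hf hg
  · intro A c
    have : toFinsupp.symm (Finsupp.single A c) = c • of δ A := by
      rw [LinearEquiv.symm_apply_eq, map_smul, toFinsupp_of, Finsupp.smul_single, smul_eq_mul,
        mul_one]
    rw [this]
    exact smul c A

/-- The span of the diagrams with less than `t` through-strings. -/
noncomputable def low (K : Type*) [Field K] (δ : K) (n t : ℕ) : Submodule K (DAlg K δ n) :=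
  Submodule.span K {x | ∃ A : Diagram n, A.through < t ∧ x = of δ A}

theorem of_mem_low {t : ℕ} {A : Diagram n} (h : A.through < t) : of δ A ∈ low K δ n t :=
  Submodule.subset_span ⟨A, h, rfl⟩

open Classical in
/-- The projection onto the span of the diagrams with the bottom half of `T`. -/
noncomputable def proj (δ : K) (T : Diagram n) : DAlg K δ n →ₗ[K] DAlg K δ n :=
  lin fun A => if A.SameBottom T then of δ A else 0

theorem proj_of {A T : Diagram n} (h : A.SameBottom T) : proj δ T (of δ A) = of δ A := by
  rw [proj, lin_of, if_pos h]

theorem proj_of_not {A T : Diagram n} (h : ¬ A.SameBottom T) : proj δ T (of δ A) = 0 := by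
  rw [proj, lin_of, if_neg h]

theorem proj_proj (T : Diagram n) (x : DAlg K δ n) : proj δ T (proj δ T x) = proj δ T x := by
  refine LinearMap.congr_fun (f := (proj δ T).comp (proj δ T)) (hom_ext fun A => ?_) x
  rw [LinearMap.comp_apply]
  by_cases h : A.SameBottom T
  · rw [proj_of h, proj_of h]
  · rw [proj_of_not h, map_zero]

variable [NeZero n]

/-- Stacking never increases the number of through-strings. With `low_mul` this makes `low` a
two-sided ideal. -/
theorem mul_low (t : ℕ) (a : DAlg K δ n) {x : DAlg K δ n} (hx : x ∈ low K δ n t) :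
    a * x ∈ low K δ n t := by
  induction hx using Submodule.span_induction with
  | mem x h =>
    obtain ⟨A, hA, rfl⟩ := h
    induction a using induction with
    | zero => rw [zero_mul]; exact zero_mem _
    | add x y hx hy => rw [add_mul]; exact add_mem hx hy
    | smul c C =>
      rw [smul_mul_assoc, of_mul_of]
      exact Submodule.smul_mem _ _ (Submodule.smul_mem _ _
        (of_mem_low ((through_comp_le_right C A).trans_lt hA)))
  | zero => rw [mul_zero]; exact zero_mem _
  | add x y _ _ hx hy => rw [mul_add]; exact add_mem hx hy
  | smul c x _ hx => rw [mul_smul_comm]; exact Submodule.smul_mem _ _ hx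

theorem low_mul (t : ℕ) (a : DAlg K δ n) {x : DAlg K δ n} (hx : x ∈ low K δ n t) :
    x * a ∈ low K δ n t := by
  induction hx using Submodule.span_induction with
  | mem x h =>
    obtain ⟨A, hA, rfl⟩ := h
    induction a using induction with
    | zero => rw [mul_zero]; exact zero_mem _
    | add x y hx hy => rw [mul_add]; exact add_mem hx hy
    | smul c C =>
      rw [mul_smul_comm, of_mul_of]
      exact Submodule.smul_mem _ _ (Submodule.smul_mem _ _
        (of_mem_low ((through_comp_le_left A C).trans_lt hA)))
  | zero => rw [zero_mul]; exact zero_mem _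
  | add x y _ _ hx hy => rw [add_mul]; exact add_mem hx hy
  | smul c x _ hx => rw [smul_mul_assoc]; exact Submodule.smul_mem _ _ hx

theorem proj_low {T : Diagram n} {x : DAlg K δ n} (hx : x ∈ low K δ n T.through) :
    proj δ T x = 0 := by
  induction hx using Submodule.span_induction with
  | mem x h =>
    obtain ⟨A, hA, rfl⟩ := h
    exact proj_of_not fun h => hA.ne h.through_eq
  | zero => rw [map_zero]
  | add x y _ _ hx hy => rw [map_add, hx, hy, add_zero]
  | smul c x _ hx => rw [map_smul, hx, smul_zero]

/-- A diagram stacked on `B` either loses through-strings or keeps the bottom half of `B`; neither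
result has the bottom half of `T`. -/
theorem proj_mul_of_not {B T : Diagram n} (h : B.through = T.through) (hB : ¬ B.SameBottom T)
    (a : DAlg K δ n) : proj δ T (a * of δ B) = 0 := by
  induction a using induction with
  | zero => rw [zero_mul, map_zero]
  | add x y hx hy => rw [add_mul, map_add, hx, hy, add_zero]
  | smul c C =>
    rw [smul_mul_assoc, of_mul_of, map_smul, map_smul, proj_of_not, smul_zero, smul_zero]
    intro hC
    exact hB ((sameBottom_comp (by rw [hC.through_eq, h])).trans hC)

/-! ### The idempotent and the twist operator of a bottom half -/

/-- The number of loops formed by the bottom half of `T` and its reflection. -/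
noncomputable def mirrorLoops (T : Diagram n) : ℕ :=
  (mirror T (Shift.id n _)).loops (mirror T (Shift.id n _))

/-- The idempotent of the bottom half of `T`. -/
noncomputable def idem (δ : K) (T : Diagram n) : DAlg K δ n :=
  (δ ^ mirrorLoops T)⁻¹ • of δ (mirror T (Shift.id n _))

/-- Right multiplication by this element twists the diagrams with the bottom half of `T`. -/
noncomputable def twistEl (δ : K) (T : Diagram n) : DAlg K δ n :=
  (δ ^ mirrorLoops T)⁻¹ • of δ (mirror T T.succShift)

variable {T A : Diagram n}

omit [NeZero n] in
theorem loops_mirror (hA : A.SameBottom T) (s : Shift n T.BotThrough) :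
    A.loops (mirror T s) = mirrorLoops T :=
  loops_congr (hA.trans (sameBottom_mirror T _)) (sameTop_mirror T _ _)

/-- The number of loops depends only on the halves that are glued, so it is the same for all `A`
with this bottom half, and the scalar in `idem` cancels the power of `δ`. -/
theorem of_mul_idem (hδ : δ ≠ 0) (hA : A.SameBottom T) : of δ A * idem δ T = of δ A := by
  rw [idem, mul_smul_comm, of_mul_of, loops_mirror hA, smul_smul,
    inv_mul_cancel₀ (pow_ne_zero _ hδ), one_smul, comp_mirror_id hA]

theorem of_mul_twistEl (hδ : δ ≠ 0) (hA : A.SameBottom T) :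
    of δ A * twistEl δ T = of δ (comp A (mirror T T.succShift)) := by
  rw [twistEl, mul_smul_comm, of_mul_of, loops_mirror hA, smul_smul,
    inv_mul_cancel₀ (pow_ne_zero _ hδ), one_smul]

theorem of_mul_twistEl_pow (hδ : δ ≠ 0) (hA : A.SameBottom T) (k : ℕ) :
    of δ A * twistEl δ T ^ k = of δ (twistIter T A k) := by
  induction k with
  | zero => rw [pow_zero, mul_one, twistIter_zero]
  | succ k ih =>
    rw [pow_succ, ← mul_assoc, ih, of_mul_twistEl hδ (sameBottom_twistIter hA k), twistIter_succ]

omit [NeZero n] in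
theorem sameBottom_mirror' (T : Diagram n) (s : Shift n T.BotThrough) :
    (mirror T s).SameBottom T := (sameBottom_mirror T s).symm

theorem idem_mul_idem (hδ : δ ≠ 0) : idem δ T * idem δ T = idem δ T := by
  conv_lhs => rw [idem, smul_mul_assoc]
  rw [← idem, of_mul_idem hδ (sameBottom_mirror' _ _), ← idem]

theorem twistEl_mul_idem (hδ : δ ≠ 0) : twistEl δ T * idem δ T = twistEl δ T := by
  conv_lhs => rw [twistEl, smul_mul_assoc]
  rw [of_mul_idem hδ (sameBottom_mirror' _ _), ← twistEl]

/-- On the left the idempotent multiplies a diagram built from a different shift, so diagrams must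
be compared: both sides are the twist of the reflected diagram, which is unique when there are
through-strings. -/
theorem idem_mul_twistEl (hδ : δ ≠ 0) (hT : 0 < T.through) :
    idem δ T * twistEl δ T = twistEl δ T := by
  conv_lhs => rw [idem, smul_mul_assoc]
  rw [of_mul_twistEl hδ (sameBottom_mirror' _ _), twistEl]
  congr 2
  exact IsTwist.unique (by rwa [through_mirror]) (isTwist_comp (sameBottom_mirror' _ _))
    (isTwist_mirror T)

theorem idem_mul_aeval (hδ : δ ≠ 0) (hT : 0 < T.through) (F : Polynomial K) :
    idem δ T * Polynomial.aeval (twistEl δ T) F = Polynomial.aeval (twistEl δ T) F * idem δ T := by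
  have hc : Commute (idem δ T) (twistEl δ T) :=
    (idem_mul_twistEl hδ hT).trans (twistEl_mul_idem hδ).symm
  induction F using Polynomial.induction_on' with
  | add p q hp hq => rw [map_add, mul_add, add_mul, hp, hq]
  | monomial k c =>
    rw [Polynomial.aeval_monomial]
    exact Commute.mul_right (Algebra.commutes c (idem δ T)).symm (hc.pow_right k)

/-- A diagram times the idempotent either has fewer through-strings than `T` or has exactly the
bottom half of `T`, in which case `proj` fixes it. -/
theorem sub_proj_mem_low {x : DAlg K δ n} (hx : x * idem δ T = x) :
    x - proj δ T x ∈ low K δ n T.through := by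
  rw [← hx]
  clear hx
  induction x using induction with
  | zero => rw [zero_mul, map_zero, sub_zero]; exact zero_mem _
  | add x y hx hy =>
    rw [add_mul, map_add, add_sub_add_comm]
    exact add_mem hx hy
  | smul c C =>
    rw [idem, smul_mul_smul_comm, of_mul_of, smul_smul, map_smul, ← smul_sub]
    refine Submodule.smul_mem _ _ ?_
    by_cases h : (comp C (mirror T (Shift.id n _))).through < T.through
    · rw [proj_of_not fun h' => h.ne h'.through_eq, sub_zero]
      exact of_mem_low h
    · rw [proj_of, sub_self]
      · exact zero_mem _
      · refine ((sameBottom_mirror T _).trans (sameBottom_comp ?_)).symm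
        rw [through_mirror]
        omega

/-- In general `proj` is not compatible with multiplication. For these `x` it is, since `proj δ T x
= 0` forces `x` into the two-sided ideal `low`. -/
theorem proj_mul_eq_zero {x : DAlg K δ n} (hx : x * idem δ T = x)
    (h : proj δ T x = 0) (a b : DAlg K δ n) : proj δ T (a * x * b) = 0 := by
  have := sub_proj_mem_low hx
  rw [h, sub_zero] at this
  exact proj_low (low_mul _ _ (mul_low _ _ this))

/-- The twist of the diagrams with the bottom half of `T`, extended linearly. -/
theorem proj_mul_twistEl (hδ : δ ≠ 0) (x : DAlg K δ n) :
    toFinsupp (proj δ T x * twistEl δ T) =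
      Finsupp.mapDomain (fun A => comp A (mirror T T.succShift)) (toFinsupp (proj δ T x)) := by
  induction x using induction with
  | zero => rw [map_zero, zero_mul, map_zero, Finsupp.mapDomain_zero]
  | add x y hx hy => rw [map_add, add_mul, map_add, map_add, hx, hy, Finsupp.mapDomain_add]
  | smul c A =>
    by_cases h : A.SameBottom T
    · rw [map_smul, proj_of h, smul_mul_assoc, of_mul_twistEl hδ h, map_smul, map_smul,
        toFinsupp_of, toFinsupp_of, Finsupp.mapDomain_smul, Finsupp.mapDomain_single]
    · rw [map_smul, proj_of_not h, smul_zero, zero_mul, map_zero, Finsupp.mapDomain_zero]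

theorem support_proj (x : DAlg K δ n) :
    ↑(toFinsupp (proj δ T x)).support ⊆ {A : Diagram n | A.SameBottom T} := by
  classical
  induction x using induction with
  | zero => simp
  | add x y hx hy =>
    intro A hA
    rw [map_add, map_add] at hA
    rcases Finset.mem_union.1 (Finsupp.support_add hA) with h | h
    · exact hx h
    · exact hy h
  | smul c A =>
    by_cases h : A.SameBottom T
    · rw [map_smul, proj_of h, map_smul, toFinsupp_of, Finsupp.smul_single]
      intro B hB
      have := Finsupp.support_single_subset hB
      rw [Finset.mem_singleton] at this
      exact this ▸ h
    · rw [map_smul, proj_of_not h]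
      simp

/-- The twist has no eigenvectors. -/
theorem proj_eq_zero_of_eigen (hδ : δ ≠ 0) (hT : 0 < T.through) {x : DAlg K δ n} {r : K}
    (h : proj δ T x * twistEl δ T = r • proj δ T x) : proj δ T x = 0 := by
  classical
  by_contra hne
  have hsupp : (toFinsupp (proj δ T x)).support.Nonempty := by
    rw [Finsupp.support_nonempty_iff]
    exact fun h0 => hne (toFinsupp.injective (h0.trans (map_zero _).symm))
  obtain ⟨j, hj⟩ := exists_botThrough hT
  -- Among the diagrams in the support take one whose string from `j` ends furthest to the right.
  -- Its twist goes strictly further; by the eigenvector equation the twist is in the support too,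
  -- also when `r = 0`.
  obtain ⟨A, hA, hmax⟩ := Finset.exists_max_image _
    (fun A : Diagram n => Sum.elim id id (A.other (Sum.inr j))) hsupp
  have hAT := support_proj x hA
  have htw := isTwist_comp hAT
  obtain ⟨i, hi⟩ := (hAT.botThrough j).2 hj
  obtain ⟨i', hi', hlt, -⟩ := htw.2.2 i j hi
  have hcoef := congrArg (fun f : Diagram n →₀ K => f (comp A (mirror T T.succShift)))
    ((proj_mul_twistEl hδ x).symm.trans (congrArg toFinsupp h))
  simp only [map_smul] at hcoef
  rw [Finsupp.mapDomain_apply' _ _ (support_proj x) ?_ hAT] at hcoef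
  · have hmem : comp A (mirror T T.succShift) ∈ (toFinsupp (proj δ T x)).support := by
      rw [Finsupp.mem_support_iff] at hA ⊢
      intro h0
      rw [Finsupp.smul_apply, h0, smul_zero] at hcoef
      exact hA hcoef
    have := hmax _ hmem
    rw [hi, hi'] at this
    simp only [Sum.elim_inl, id] at this
    omega
  · intro B hB B' hB' he
    have h1 := isTwist_comp (T := T) (show B.SameBottom T from hB)
    have h2 := isTwist_comp (T := T) (show B'.SameBottom T from hB')
    simp only at he
    rw [he] at h1
    exact IsTwist.injective (SameBottom.through_eq (show B.SameBottom T from hB) ▸ hT) h1 h2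

/-- Up to `low`, `v * idem δ T` equals its projection, and right multiplication by the twist
preserves the image of `proj`. The hypothesis thus makes the projection an eigenvector of the twist.
-/
theorem proj_eq_zero_of_mul (hδ : δ ≠ 0) (hT : 0 < T.through) {v : DAlg K δ n} {r : K}
    (h : proj δ T (v * idem δ T * (twistEl δ T - algebraMap K _ r)) = 0) :
    proj δ T (v * idem δ T) = 0 := by
  have he : v * idem δ T * idem δ T = v * idem δ T := by rw [mul_assoc, idem_mul_idem hδ]
  have h1 := proj_low (low_mul _ (twistEl δ T - algebraMap K _ r) (sub_proj_mem_low he))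
  rw [sub_mul, map_sub, h, zero_sub, neg_eq_zero] at h1
  generalize v * idem δ T = x at *
  refine proj_eq_zero_of_eigen hδ hT (r := r) ?_
  have h2 : proj δ T (proj δ T x * (twistEl δ T - algebraMap K _ r)) =
      proj δ T x * (twistEl δ T - algebraMap K _ r) := by
    clear h h1 he
    rw [mul_sub, map_sub, ← Algebra.commutes, ← Algebra.smul_def, map_smul, proj_proj]
    congr 1
    induction x using induction with
    | zero => simp
    | add x y hx hy => rw [map_add, add_mul, map_add, hx, hy]
    | smul c A =>
      by_cases hA : A.SameBottom T
      · rw [map_smul, proj_of hA, smul_mul_assoc, of_mul_twistEl hδ hA, map_smul, proj_of]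
        exact (sameBottom_comp_mirror hA).symm
      · rw [map_smul, proj_of_not hA]
        simp
  rw [h2, mul_sub, sub_eq_zero, ← Algebra.commutes, ← Algebra.smul_def] at h1
  exact h1

/-- The linear factors are cancelled one at a time; moving the idempotent past a polynomial in the
twist restores the shape that `proj_eq_zero_of_mul` requires. -/
theorem proj_eq_zero_of_mul_prod (hδ : δ ≠ 0) (hT : 0 < T.through) {ι : Type*} (r : ι → K)
    (s : Finset ι) {v : DAlg K δ n}
    (h : proj δ T (v * idem δ T * Polynomial.aeval (twistEl δ T)
      (∏ i ∈ s, (Polynomial.X - Polynomial.C (r i)))) = 0) :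
    proj δ T (v * idem δ T) = 0 := by
  classical
  induction s using Finset.induction_on generalizing v with
  | empty => simpa using h
  | insert a s ha ih =>
    have hl : Polynomial.aeval (twistEl δ T) (Polynomial.X - Polynomial.C (r a)) =
        twistEl δ T - algebraMap K _ (r a) := by simp
    rw [Finset.prod_insert ha, map_mul (Polynomial.aeval (twistEl δ T)), ← mul_assoc, mul_assoc v,
      idem_mul_aeval hδ hT, ← mul_assoc] at h
    have := ih h
    rw [mul_assoc, ← idem_mul_aeval hδ hT, ← mul_assoc, hl] at this
    exact proj_eq_zero_of_mul hδ hT this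

/-! ### The central element -/

theorem rot_pow (k : ℕ) : of δ (rot n) ^ k = of δ (rotBy n k) := by
  induction k with
  | zero =>
    rw [pow_zero, one_def]
    congr 1
    ext x
    · rcases x with i | i <;> simp [Diagram.one, rotBy]
    · rfl
  | succ k ih =>
    have : rot n = rotBy n 1 := rfl
    rw [pow_succ', ih, this, of_mul_of, rotBy_loops, pow_zero, one_smul, rotBy_comp_rotBy]
    norm_num

/-- The full rotation is central. -/
theorem rot_pow_comm (x : DAlg K δ n) : of δ (rot n) ^ n * x = x * of δ (rot n) ^ n := by
  rw [rot_pow]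
  induction x using induction with
  | zero => simp
  | add x y hx hy => rw [add_mul, mul_add, hx, hy]
  | smul c A =>
    rw [smul_mul_assoc, mul_smul_comm, of_mul_of, of_mul_of, rotBy_loops, loops_rotBy, rotBy_comm]

theorem proj_rot_pow_mul (T : Diagram n) (x : DAlg K δ n) :
    proj δ T (of δ (rot n) ^ n * x) = of δ (rot n) ^ n * proj δ T x := by
  rw [rot_pow]
  induction x using induction with
  | zero => simp
  | add x y hx hy => rw [mul_add, map_add, map_add, mul_add, hx, hy]
  | smul c A =>
    rw [mul_smul_comm, of_mul_of, rotBy_loops, pow_zero, one_smul, map_smul, map_smul,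
      mul_smul_comm]
    by_cases hA : A.SameBottom T
    · rw [proj_of hA, proj_of ((sameBottom_fullRot A).symm.trans hA), of_mul_of, rotBy_loops,
        pow_zero, one_smul]
    · rw [proj_of_not hA, proj_of_not fun h => hA ((sameBottom_fullRot A).trans h), mul_zero]

/-- The full rotation of a diagram is its `t`-fold twist, so a left multiplication becomes a right
one. It follows that `u ^ n - q` acts on this bottom half as `X ^ t - q`, whose linear factors are
the `X - r_i`. -/
theorem rot_pow_mul_proj (hδ : δ ≠ 0) (hT : 0 < T.through) (x : DAlg K δ n) :
    of δ (rot n) ^ n * proj δ T x = proj δ T x * twistEl δ T ^ T.through := by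
  rw [rot_pow]
  induction x using induction with
  | zero => simp
  | add x y hx hy => rw [map_add, mul_add, add_mul, hx, hy]
  | smul c A =>
    by_cases hA : A.SameBottom T
    · rw [map_smul, proj_of hA, mul_smul_comm, smul_mul_assoc, of_mul_of, rotBy_loops, pow_zero,
        one_smul, of_mul_twistEl_pow hδ hA, fullRot_eq_twistIter hT hA]
    · rw [map_smul, proj_of_not hA]
      simp

theorem proj_mul_idem (hδ : δ ≠ 0) (x : DAlg K δ n) :
    proj δ T x * idem δ T = proj δ T x := by
  induction x using induction with
  | zero => simp
  | add x y hx hy => rw [map_add, add_mul, hx, hy]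
  | smul c A =>
    by_cases hA : A.SameBottom T
    · rw [map_smul, proj_of hA, smul_mul_assoc, of_mul_idem hδ hA]
    · rw [map_smul, proj_of_not hA]
      simp

theorem proj_idem (T : Diagram n) : proj δ T (idem δ T) = idem δ T := by
  rw [idem, map_smul, proj_of (sameBottom_mirror' _ _)]

end DAlg
end AffineTL

/-! ### The lower ideal and the annihilator of the standard generator -/

namespace AffineTL

open Diagram DAlg Polynomial

section Jones

variable {K : Type*} [Field K] {δ q : K} {n : ℕ} [NeZero n]

theorem toJones_surjective : Function.Surjective (toJones δ q n) := Ideal.Quotient.mk_surjective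

theorem toJones_eq_zero_iff {x : DAlg K δ n} :
    toJones δ q n x = 0 ↔ x ∈ omega δ q n ⊔ idealZero δ n := by
  rw [Ideal.Quotient.eq_zero_iff_mem, TwoSidedIdeal.mem_asIdeal]

theorem rot_sub_mem : of δ (rot n) ^ n - algebraMap K _ q ∈ omega δ q n ⊔ idealZero δ n :=
  TwoSidedIdeal.mem_sup_left (TwoSidedIdeal.subset_span rfl)

theorem rot_sub_comm (x : DAlg K δ n) :
    (of δ (rot n) ^ n - algebraMap K _ q) * x = x * (of δ (rot n) ^ n - algebraMap K _ q) := by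
  rw [sub_mul, mul_sub, rot_pow_comm, Algebra.commutes]

/-- The ideal defining `D_n(q)` consists of multiples of `u ^ n - q`, up to diagrams with fewer
through-strings. -/
theorem exists_sub_mem_low {t : ℕ} (ht : 0 < t) {x : DAlg K δ n}
    (hx : x ∈ omega δ q n ⊔ idealZero δ n) :
    ∃ d, x - (of δ (rot n) ^ n - algebraMap K _ q) * d ∈ low K δ n t := by
  -- This set is a two-sided ideal because `u ^ n - q` is central and `low` is two-sided. It
  -- contains the generators of `I_0`, with `d = 0`, because `0 < t`.
  let S : Set (DAlg K δ n) :=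
    {x | ∃ d, x - (of δ (rot n) ^ n - algebraMap K _ q) * d ∈ low K δ n t}
  let J : TwoSidedIdeal (DAlg K δ n) := TwoSidedIdeal.mk' S ⟨0, by simp⟩
    (by
      rintro x y ⟨d, hd⟩ ⟨d', hd'⟩
      refine ⟨d + d', ?_⟩
      rw [mul_add, add_sub_add_comm]
      exact add_mem hd hd')
    (by
      rintro x ⟨d, hd⟩
      refine ⟨-d, ?_⟩
      rw [mul_neg, ← neg_sub', neg_mem_iff]
      exact hd)
    (by
      rintro a x ⟨d, hd⟩
      refine ⟨a * d, ?_⟩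
      rw [← mul_assoc, rot_sub_comm, mul_assoc, ← mul_sub]
      exact mul_low _ _ hd)
    (by
      rintro x a ⟨d, hd⟩
      refine ⟨d * a, ?_⟩
      rw [← mul_assoc, ← sub_mul]
      exact low_mul _ _ hd)
  have hJ : ∀ x, x ∈ J ↔ x ∈ S := fun x => TwoSidedIdeal.mem_mk' _ _ _ _ _ _ _
  have hle : omega δ q n ⊔ idealZero δ n ≤ J := by
    refine sup_le (TwoSidedIdeal.span_le.2 ?_) (TwoSidedIdeal.span_le.2 ?_)
    · rintro _ rfl
      exact (hJ _).2 ⟨1, by rw [mul_one, sub_self]; exact zero_mem _⟩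
    · rintro _ ⟨A, hA, rfl⟩
      refine (hJ _).2 ⟨0, ?_⟩
      rw [mul_zero, sub_zero]
      exact of_mem_low (hA ▸ ht)
  exact (hJ x).1 (hle hx)

variable {T : Diagram n}

/-- Substituting a chain into a polynomial is evaluating that polynomial at the twist and
multiplying by the first diagram of the chain. -/
theorem sum_chain (hδ : δ ≠ 0) (hT : 0 < T.through) {β : ℕ → Diagram n}
    (hβ : IsTwistChain T.through β) (h0 : (β 0).SameBottom T) (F : K[X]) :
    (F.sum fun k c => c • of δ (β k)) = of δ (β 0) * aeval (twistEl δ T) F := by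
  rw [aeval_def, eval₂_eq_sum, Polynomial.sum, Polynomial.sum, Finset.mul_sum]
  refine Finset.sum_congr rfl fun k _ => ?_
  rw [← Algebra.smul_def, mul_smul_comm, of_mul_twistEl_pow hδ h0, eq_twistIter hT hβ h0]

omit [NeZero n] in
theorem sameBottom_chain {t : ℕ} {β : ℕ → Diagram n} (hβ : IsTwistChain t β) (k : ℕ) :
    (β 0).SameBottom (β k) := by
  induction k with
  | zero => exact fun _ _ => Iff.rfl
  | succ k ih => exact ih.trans (hβ k).2.2.1

theorem proj_mul_sum_chain {β : ℕ → Diagram n} (hβ : IsTwistChain T.through β)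
    (h0 : ¬ (β 0).SameBottom T) (F : K[X]) (a : DAlg K δ n) :
    proj δ T (a * F.sum fun k c => c • of δ (β k)) = 0 := by
  rw [Polynomial.sum, Finset.mul_sum, map_sum]
  refine Finset.sum_eq_zero fun k _ => ?_
  rw [mul_smul_comm, map_smul, proj_mul_of_not (hβ k).1, smul_zero]
  exact fun h => h0 ((sameBottom_chain hβ k).trans h)

variable {r : Fin T.through → K} {j : Fin T.through}

/-- The polynomial `∏_{i ≥ j} (X - r_i)`. -/
noncomputable def tailPoly {t : ℕ} (r : Fin t → K) (j : Fin t) : K[X] :=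
  ∏ i ∈ Finset.Ici j, (X - C (r i))

theorem tailPoly_eq {t : ℕ} (r : Fin t → K) (j : Fin t) :
    tailPoly r j = (X - C (r j)) * cellPoly r j := by
  rw [tailPoly, cellPoly, ← Finset.Ioi_insert, Finset.prod_insert (by simp)]

/-- The generators of the lower ideal with a label `i < j` are thereby multiples of the tail
polynomial at `j`. -/
theorem tailPoly_dvd {t : ℕ} (r : Fin t → K) {i j : Fin t} (h : i < j) :
    tailPoly r j ∣ cellPoly r i := by
  refine Finset.prod_dvd_prod_of_subset _ _ _ fun k hk => ?_
  rw [Finset.mem_Ici] at hk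
  rw [Finset.mem_Ioi]
  exact h.trans_le hk

theorem aeval_tailPoly (w : DAlg K δ n) :
    w * idem δ T * aeval (twistEl δ T) (tailPoly r j) =
      w * idem δ T * (twistEl δ T - algebraMap K _ (r j)) *
        aeval (twistEl δ T) (cellPoly r j) := by
  rw [tailPoly_eq, map_mul, mul_assoc _ (_ - _)]
  simp

/-- Elements mapped to the lower ideal, up to diagrams with another bottom half. -/
theorem proj_of_mem_lowerIdeal (hδ : δ ≠ 0) (hT : 0 < T.through)
    (hr : X ^ T.through - C q = ∏ i, (X - C (r i))) {x : DAlg K δ n}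
    (hx : toJones δ q n x ∈ lowerIdeal δ q n r j) :
    ∃ w, proj δ T x = proj δ T (w * idem δ T * aeval (twistEl δ T) (tailPoly r j)) := by
  -- The elements with the desired property. Only additivity is available, since `proj` does not
  -- commute with left multiplication, so left multiples of the generators are treated directly.
  let G : AddSubgroup (DAlg K δ n) :=
    { carrier := {x | ∃ w, proj δ T x =
        proj δ T (w * idem δ T * aeval (twistEl δ T) (tailPoly r j))}
      zero_mem' := ⟨0, by simp⟩
      add_mem' := by
        rintro x y ⟨w, hw⟩ ⟨w', hw'⟩
        exact ⟨w + w', by rw [map_add, hw, hw', ← map_add, add_mul, add_mul]⟩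
      neg_mem' := by
        rintro x ⟨w, hw⟩
        exact ⟨-w, by rw [map_neg, hw, neg_mul, neg_mul, map_neg]⟩ }
  have hdvd : ∀ (F : K[X]) (v : DAlg K δ n), tailPoly r j ∣ F →
      v * idem δ T * aeval (twistEl δ T) F ∈ G := by
    rintro F v ⟨H, rfl⟩
    refine ⟨v * aeval (twistEl δ T) H, ?_⟩
    rw [mul_comm, map_mul (aeval (twistEl δ T)), mul_assoc v, ← mul_assoc (idem δ T), idem_mul_aeval hδ hT]
    simp only [mul_assoc]
  -- Modulo `low` the relations of `D_n(q)` are multiples `(u ^ n - q) * d`; these project to `proj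
  -- δ T d` times the product of all `X - r_i` evaluated at the twist, a multiple of the tail.
  have hJ : ∀ x, x ∈ omega δ q n ⊔ idealZero δ n → x ∈ G := by
    intro x hx
    obtain ⟨d, hd⟩ := exists_sub_mem_low hT hx
    have h1 := proj_low hd
    rw [map_sub, sub_eq_zero, sub_mul, map_sub, proj_rot_pow_mul, rot_pow_mul_proj hδ hT,
      ← Algebra.smul_def, map_smul] at h1
    have h2 : proj δ T d * idem δ T * aeval (twistEl δ T) (X ^ T.through - C q) ∈ G :=
      hdvd _ _ (by rw [hr]; exact Finset.prod_dvd_prod_of_subset _ _ _ (Finset.subset_univ _))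
    have h3 : proj δ T d * idem δ T * aeval (twistEl δ T) (X ^ T.through - C q) =
        proj δ T x := by
      rw [h1, proj_mul_idem hδ, map_sub, map_pow, aeval_X, aeval_C, mul_sub, ← Algebra.commutes,
        ← Algebra.smul_def]
    rw [h3] at h2
    obtain ⟨w, hw⟩ := h2
    exact ⟨w, by rw [← hw, proj_proj]⟩
  have key : ∃ x' ∈ G, toJones δ q n x' = toJones δ q n x := by
    rw [lowerIdeal] at hx
    generalize toJones δ q n x = y at hx
    -- The lower ideal is additively generated by the left multiples of its generators: low diagrams
    -- and chains with another bottom half project to `0`, and chains with the bottom half of `T`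
    -- give multiples of the tail.
    induction hx using Submodule.closure_induction with
    | zero => exact ⟨0, zero_mem _, map_zero _⟩
    | add ξ η _ _ h1 h2 =>
      obtain ⟨x, hx, rfl⟩ := h1
      obtain ⟨y, hy, rfl⟩ := h2
      exact ⟨x + y, add_mem hx hy, map_add _ _ _⟩
    | smul_mem a ξ hξ =>
      obtain ⟨a, rfl⟩ := toJones_surjective a
      rcases hξ with ⟨A, hA, rfl⟩ | ⟨i, hi, β, hβ, rfl⟩
      · exact ⟨a * of δ A, ⟨0, by rw [proj_low (mul_low _ _ (of_mem_low hA))]; simp⟩,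
          map_mul _ _ _⟩
      · refine ⟨a * (cellPoly r i).sum fun k c => c • of δ (β k), ?_, map_mul _ _ _⟩
        by_cases h0 : (β 0).SameBottom T
        · rw [sum_chain hδ hT hβ h0, ← mul_assoc, ← of_mul_idem hδ h0, ← mul_assoc]
          exact hdvd _ _ (tailPoly_dvd r hi)
        · exact ⟨0, by rw [proj_mul_sum_chain hβ h0]; simp⟩
  obtain ⟨x', hx', he⟩ := key
  have h1 := hJ _ (toJones_eq_zero_iff.1 ((map_sub (toJones δ q n) x x').trans
    (sub_eq_zero.2 he.symm)))
  have h2 := add_mem h1 hx'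
  rwa [sub_add_cancel] at h2

theorem toJones_low {t : ℕ} {r : Fin t → K} {j : Fin t} {x : DAlg K δ n}
    (hx : x ∈ low K δ n t) : toJones δ q n x ∈ lowerIdeal δ q n r j := by
  induction hx using Submodule.span_induction with
  | mem x h =>
    obtain ⟨A, hA, rfl⟩ := h
    exact Submodule.subset_span (Or.inl ⟨A, hA, rfl⟩)
  | zero => rw [map_zero]; exact zero_mem _
  | add x y _ _ hx hy => rw [map_add]; exact add_mem hx hy
  | smul c x _ hx =>
    rw [Algebra.smul_def, map_mul]
    exact Submodule.smul_mem _ _ hx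

/-- For `j` not the first label, `∏_{i ≥ j}` is the cell polynomial of the preceding label, hence
gives a generator of the lower ideal. For the first label it is `X ^ t - q`, and `idem` times its
value at the twist equals `(u ^ n - q)` times `idem`, which is zero in `D_n(q)`. -/
theorem toJones_tailPoly (hδ : δ ≠ 0) (hT : 0 < T.through)
    (hr : X ^ T.through - C q = ∏ i, (X - C (r i))) (w : DAlg K δ n) :
    toJones δ q n (w * idem δ T * aeval (twistEl δ T) (tailPoly r j)) ∈
      lowerIdeal δ q n r j := by
  rw [mul_assoc, map_mul]
  refine Submodule.smul_mem _ _ ?_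
  by_cases hj : ∃ i : Fin T.through, (i : ℕ) + 1 = j
  · obtain ⟨i, hi⟩ := hj
    have hp : tailPoly r j = cellPoly r i := by
      rw [tailPoly, cellPoly]
      congr 1
      ext k
      rw [Finset.mem_Ici, Finset.mem_Ioi, Fin.le_def, Fin.lt_def]
      omega
    have hb : (mirror T (Shift.id n _)).SameBottom T := sameBottom_mirror' _ _
    rw [hp, idem, smul_mul_assoc, ← twistIter_zero T (mirror T (Shift.id n _)),
      ← sum_chain hδ hT (isTwistChain_twistIter hb) hb, Algebra.smul_def, map_mul]
    exact Submodule.smul_mem _ _ (Submodule.subset_span (Or.inr ⟨i, by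
      rw [Fin.lt_def]; omega, _, isTwistChain_twistIter hb, rfl⟩))
  · have hp : tailPoly r j = X ^ T.through - C q := by
      rw [hr, tailPoly]
      congr 1
      ext k
      simp only [Finset.mem_Ici, Finset.mem_univ, iff_true, Fin.le_def]
      have hj0 : (j : ℕ) = 0 := by
        by_contra h
        exact hj ⟨⟨(j : ℕ) - 1, by omega⟩, by simp only; omega⟩
      omega
    have he : idem δ T * aeval (twistEl δ T) (X ^ T.through - C q) =
        (of δ (rot n) ^ n - algebraMap K _ q) * idem δ T := by
      have := rot_pow_mul_proj hδ hT (idem δ T)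
      rw [proj_idem] at this
      rw [map_sub, map_pow, aeval_X, aeval_C, mul_sub, sub_mul, this, Algebra.commutes]
    rw [hp, he, toJones_eq_zero_iff.2 (TwoSidedIdeal.mul_mem_right _ _ _ rot_sub_mem)]
    exact zero_mem _

/-- The annihilator of the generator of a standard module. -/
theorem mem_lowerIdeal_iff (hδ : δ ≠ 0) (hT : 0 < T.through)
    (hr : X ^ T.through - C q = ∏ i, (X - C (r i))) (d : DAlg K δ n) :
    toJones δ q n (d * idem δ T * aeval (twistEl δ T) (cellPoly r j)) ∈ lowerIdeal δ q n r j ↔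
      ∃ w, proj δ T (d * idem δ T) =
        proj δ T (w * idem δ T * (twistEl δ T - algebraMap K _ (r j))) := by
  have hcomm : ∀ w : DAlg K δ n, w * idem δ T * (twistEl δ T - algebraMap K _ (r j)) =
      w * (twistEl δ T - algebraMap K _ (r j)) * idem δ T := fun w => by
    rw [mul_assoc, mul_assoc, mul_sub, sub_mul, idem_mul_twistEl hδ hT, twistEl_mul_idem hδ,
      Algebra.commutes]
  constructor
  · intro h
    obtain ⟨w, hw⟩ := proj_of_mem_lowerIdeal hδ hT hr h
    refine ⟨w, ?_⟩
    rw [aeval_tailPoly, ← sub_eq_zero, ← map_sub, hcomm, ← sub_mul, ← sub_mul] at hw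
    -- Both sides now carry the factor given by `cellPoly r j`, which is cancelled because the twist
    -- has no eigenvectors.
    have := proj_eq_zero_of_mul_prod hδ hT r _ hw
    rwa [sub_mul, map_sub, sub_eq_zero, ← hcomm] at this
  · rintro ⟨w, hw⟩
    rw [hcomm, ← sub_eq_zero, ← map_sub, ← sub_mul] at hw
    -- The difference of the two sides lies in `low`, and multiplying the right-hand side by the
    -- value of `cellPoly r j` produces the tail, which maps into the lower ideal.
    have h1 := sub_proj_mem_low (T := T) (x := (d - w * (twistEl δ T - algebraMap K _ (r j))) *
      idem δ T) (by rw [mul_assoc, idem_mul_idem hδ])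
    rw [hw, sub_zero, sub_mul, ← hcomm] at h1
    have h2 : toJones δ q n _ ∈ lowerIdeal δ q n r j :=
      toJones_low (low_mul _ (aeval (twistEl δ T) (cellPoly r j)) h1)
    have h3 := toJones_tailPoly (j := j) hδ hT hr w
    rw [aeval_tailPoly] at h3
    have h4 := add_mem h2 h3
    rwa [← map_add, sub_mul, sub_add_cancel] at h4

end Jones
end AffineTL

/-! ### Descent of homomorphisms from `D_n` to `D_n(q)` -/

namespace AffineTL

open CategoryTheory Diagram DAlg

section Descent

variable {K : Type u} [Field K] {δ q : K} {n : ℕ} [NeZero n]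

/-- An element of a module of `D_n(q)`, as an element of the corresponding module of `D_n`. -/
def toRes {M : ModuleCat.{u} (JonesAlg δ q n)} (m : M) : restrict M := m

/-- An element of the `D_n`-module given by a module of `D_n(q)`, as an element of the latter. -/
def ofRes {M : ModuleCat.{u} (JonesAlg δ q n)} (m : restrict M) : M := m

theorem restrict_smul (M : ModuleCat.{u} (JonesAlg δ q n)) (d : DAlg K δ n) (m : restrict M) :
    d • m = toRes (toJones δ q n d • ofRes m) := rfl

theorem smul_restrict_of_mem {M : ModuleCat.{u} (JonesAlg δ q n)} {x : DAlg K δ n}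
    (hx : x ∈ omega δ q n ⊔ idealZero δ n) (m : restrict M) : x • m = 0 := by
  rw [restrict_smul, toJones_eq_zero_iff.2 hx]
  exact zero_smul _ _

theorem exists_smul_restrict {M : ModuleCat.{u} (JonesAlg δ q n)} {m : M}
    (hm : ∀ x : M, ∃ r : JonesAlg δ q n, r • m = x) (x : restrict M) :
    ∃ d : DAlg K δ n, d • (toRes m) = x := by
  obtain ⟨r, hr⟩ := hm x
  obtain ⟨d, rfl⟩ := toJones_surjective r
  exact ⟨d, hr⟩

theorem mem_annih_of_mem {M : ModuleCat.{u} (JonesAlg δ q n)} {x : DAlg K δ n}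
    (hx : x ∈ omega δ q n ⊔ idealZero δ n) (m : restrict M) : x ∈ annih (DAlg K δ n) m :=
  mem_annih.2 (smul_restrict_of_mem hx m)

variable {M N : ModuleCat.{u} (JonesAlg δ q n)}

/-- A homomorphism vanishing at `u ^ n - q` vanishes on the ideal defining `D_n(q)`. -/
theorem map_eq_zero_of_mem (hδ : δ ≠ 0) {m : restrict M}
    (φ : annih (DAlg K δ n) m →ₗ[DAlg K δ n] restrict N)
    (hφ : φ ⟨_, mem_annih_of_mem rot_sub_mem m⟩ = 0) {x : DAlg K δ n}
    (hx : x ∈ omega δ q n ⊔ idealZero δ n) (hx' : x ∈ annih (DAlg K δ n) m) : φ ⟨x, hx'⟩ = 0 := by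
  -- As `φ` is only left linear, vanishing at all `x * d` is demanded, which makes the set stable
  -- under right multiplication as well.
  let S : Set (DAlg K δ n) := {x | x ∈ omega δ q n ⊔ idealZero δ n ∧
    ∀ d, ∀ h : x * d ∈ annih (DAlg K δ n) m, φ ⟨x * d, h⟩ = 0}
  have hmem : ∀ {x : DAlg K δ n}, x ∈ omega δ q n ⊔ idealZero δ n → ∀ d,
      x * d ∈ annih (DAlg K δ n) m := fun hx d =>
    mem_annih_of_mem (TwoSidedIdeal.mul_mem_right _ _ _ hx) m
  let J : TwoSidedIdeal (DAlg K δ n) := TwoSidedIdeal.mk' S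
    ⟨zero_mem _, fun d h => by
      rw [← map_zero φ]
      congr 1⟩
    (by
      rintro x y ⟨h1, h2⟩ ⟨h3, h4⟩
      refine ⟨add_mem h1 h3, fun d h => ?_⟩
      have h5 : φ (⟨x * d, hmem h1 d⟩ + ⟨y * d, hmem h3 d⟩) = 0 := by
        rw [map_add, h2, h4, add_zero]
      rw [← h5]
      congr 2
      exact add_mul x y d)
    (by
      rintro x ⟨h1, h2⟩
      refine ⟨neg_mem h1, fun d h => ?_⟩
      rw [← neg_zero, ← h2 d (hmem h1 d), ← map_neg]
      congr 2
      exact neg_mul x d)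
    (by
      rintro a x ⟨h1, h2⟩
      refine ⟨TwoSidedIdeal.mul_mem_left _ _ _ h1, fun d h => ?_⟩
      rw [← smul_zero a, ← h2 d (hmem h1 d), ← map_smul]
      congr 2
      exact mul_assoc a x d)
    (by
      rintro x a ⟨h1, h2⟩
      refine ⟨TwoSidedIdeal.mul_mem_right _ _ _ h1, fun d h => ?_⟩
      rw [← h2 (a * d) (hmem h1 _)]
      congr 2
      exact mul_assoc x a d)
  have hJ : ∀ x, x ∈ J ↔ x ∈ S := fun x => TwoSidedIdeal.mem_mk' _ _ _ _ _ _ _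
  have hle : omega δ q n ⊔ idealZero δ n ≤ J := by
    refine sup_le (TwoSidedIdeal.span_le.2 ?_) (TwoSidedIdeal.span_le.2 ?_)
    · rintro _ rfl
      -- For `z = u ^ n - q`, centrality gives `φ (z d) = φ (d z) = d φ z = 0`.
      refine (hJ _).2 ⟨rot_sub_mem, fun d h => ?_⟩
      rw [← smul_zero d, ← hφ, ← map_smul]
      congr 2
      exact rot_sub_comm d
    · rintro _ ⟨A, hA, rfl⟩
      have h0 : ∀ A : Diagram n, A.through = 0 → of δ A ∈ omega δ q n ⊔ idealZero δ n :=
        fun A hA => TwoSidedIdeal.mem_sup_right (TwoSidedIdeal.subset_span ⟨A, hA, rfl⟩)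
      refine (hJ _).2 ⟨h0 A hA, fun d h => ?_⟩
      -- The idempotent of `A` lies in `I_0` and `A = A * idem δ A`. Hence `φ (A d) = A φ (idem δ A
      -- * d)`, and `A` kills `N`.
      have hi : idem δ A ∈ omega δ q n ⊔ idealZero δ n := by
        rw [idem, Algebra.smul_def]
        exact TwoSidedIdeal.mul_mem_left _ _ _ (h0 _ (by rw [through_mirror, hA]))
      rw [← smul_restrict_of_mem (h0 A hA) (φ ⟨idem δ A * d, hmem hi d⟩), ← map_smul]
      congr 2
      change of δ A * d = of δ A * (idem δ A * d)
      rw [← mul_assoc, of_mul_idem hδ fun _ _ => Iff.rfl]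
  have := ((hJ x).1 (hle hx)).2 1 (by rwa [mul_one])
  rw [← this]
  congr 2
  exact (mul_one x).symm

/-- A homomorphism vanishing at `u ^ n - q` descends to `D_n(q)`. -/
theorem exists_of_ext_subsingleton (hδ : δ ≠ 0) {m : M}
    (hm : ∀ x : M, ∃ r : JonesAlg δ q n, r • m = x) (hext : Subsingleton (Abelian.Ext M N 1))
    (φ : annih (DAlg K δ n) (toRes m) →ₗ[DAlg K δ n] restrict N)
    (hφ : φ ⟨_, mem_annih_of_mem rot_sub_mem _⟩ = 0) :
    ∃ y : restrict N, ∀ l, φ l = (l : DAlg K δ n) • y := by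
  have hlift : ∀ ξ : annih (JonesAlg δ q n) m, Function.surjInv toJones_surjective (ξ : JonesAlg δ q n) ∈
      annih (DAlg K δ n) (toRes m) := by
    intro ξ
    rw [mem_annih, restrict_smul, Function.surjInv_eq toJones_surjective]
    exact mem_annih.1 ξ.2
  -- The value of `φ` depends only on the image in `D_n(q)`, so the map `ψ` defined with arbitrary
  -- lifts is linear.
  have key : ∀ (x y : annih (DAlg K δ n) (toRes m)),
      toJones δ q n x = toJones δ q n y → φ x = φ y := by
    intro x y h
    rw [← sub_eq_zero, ← map_sub]
    have hxy : (x : DAlg K δ n) - y ∈ omega δ q n ⊔ idealZero δ n :=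
      toJones_eq_zero_iff.1 ((map_sub (toJones δ q n) _ _).trans (sub_eq_zero.2 h))
    exact map_eq_zero_of_mem hδ φ hφ hxy (x - y).2
  let ψ : annih (JonesAlg δ q n) m →ₗ[JonesAlg δ q n] N :=
    { toFun := fun ξ => φ ⟨_, hlift ξ⟩
      map_add' := by
        intro ξ η
        refine (key _ (⟨_, hlift ξ⟩ + ⟨_, hlift η⟩) ?_).trans (map_add φ _ _)
        simp only [Submodule.coe_add, map_add, Function.surjInv_eq toJones_surjective]
      map_smul' := by
        intro a ξ
        obtain ⟨a, rfl⟩ := toJones_surjective a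
        refine (key _ (a • ⟨_, hlift ξ⟩) ?_).trans (map_smul φ _ _)
        simp only [Submodule.coe_smul, smul_eq_mul, map_mul,
          Function.surjInv_eq toJones_surjective] }
  obtain ⟨y, hy⟩ := (ext_subsingleton_iff hm).1 hext ψ
  refine ⟨y, fun l => ?_⟩
  have hl : toJones δ q n l ∈ annih (JonesAlg δ q n) m := mem_annih.2 (mem_annih.1 l.2)
  refine (key l ⟨_, hlift ⟨_, hl⟩⟩ ?_).trans (hy ⟨_, hl⟩)
  exact (Function.surjInv_eq toJones_surjective _).symm

/-- A simple module is generated by each of its nonzero elements. -/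
theorem exists_generator (hM : IsSimpleModule (JonesAlg δ q n) M) :
    ∃ m : M, m ≠ 0 ∧ ∀ x : M, ∃ r : JonesAlg δ q n, r • m = x := by
  have := IsSimpleModule.nontrivial (JonesAlg δ q n) M
  obtain ⟨m, hm⟩ := exists_ne (0 : M)
  exact ⟨m, hm, IsSimpleModule.toSpanSingleton_surjective _ hm⟩

/-- Modules with different central characters have no extensions. -/
theorem ext_subsingleton_of_ne {q q' : K} (hq : q ≠ q') {M : ModuleCat.{u} (JonesAlg δ q n)}
    {N : ModuleCat.{u} (JonesAlg δ q' n)} (hM : IsSimpleModule (JonesAlg δ q n) M) :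
    Subsingleton (Abelian.Ext (restrict M) (restrict N) 1) := by
  obtain ⟨m, -, hm⟩ := exists_generator hM
  rw [ext_subsingleton_iff (exists_smul_restrict hm)]
  intro φ
  -- With `z = u ^ n - q`, centrality gives `l φ(z) = z φ(l) = (q' - q) φ(l)`, since `u ^ n` acts on
  -- `N` as `q'`; divide by `q' - q`.
  refine ⟨algebraMap K (DAlg K δ n) (q' - q)⁻¹ • φ ⟨_, mem_annih_of_mem rot_sub_mem _⟩,
    fun l => ?_⟩
  have h1 : (l : DAlg K δ n) • φ ⟨_, mem_annih_of_mem rot_sub_mem _⟩ =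
      algebraMap K (DAlg K δ n) (q' - q) • φ l := by
    have h2 : (of δ (rot n) ^ n - algebraMap K _ q') • φ l = 0 :=
      smul_restrict_of_mem rot_sub_mem _
    have h3 : of δ (rot n) ^ n - algebraMap K (DAlg K δ n) q =
        (of δ (rot n) ^ n - algebraMap K _ q') + algebraMap K _ (q' - q) := by
      rw [map_sub]
      abel
    have h4 : (l : DAlg K δ n) • φ ⟨_, mem_annih_of_mem rot_sub_mem _⟩ =
        (of δ (rot n) ^ n - algebraMap K (DAlg K δ n) q) • φ l := by
      rw [← map_smul, ← map_smul]
      congr 1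
      exact Subtype.ext (rot_sub_comm _).symm
    rw [h4, h3, add_smul, h2, zero_add]
  rw [smul_smul, ← Algebra.commutes, mul_smul, h1, smul_smul, ← map_mul,
    inv_mul_cancel₀ (sub_ne_zero.2 hq.symm), map_one, one_smul]

/-- Extensions of non-isomorphic simple modules come from `D_n(q)`. -/
theorem ext_subsingleton_of_not_iso (hδ : δ ≠ 0) (hM : IsSimpleModule (JonesAlg δ q n) M)
    (hN : IsSimpleModule (JonesAlg δ q n) N)
    (hMN : ¬ Nonempty (restrict M ≃ₗ[DAlg K δ n] restrict N))
    (hext : Subsingleton (Abelian.Ext M N 1)) :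
    Subsingleton (Abelian.Ext (restrict M) (restrict N) 1) := by
  obtain ⟨m, hm0, hm⟩ := exists_generator hM
  rw [ext_subsingleton_iff (exists_smul_restrict hm)]
  intro φ
  refine exists_of_ext_subsingleton hδ hm hext φ ?_
  by_contra hne
  set y := φ ⟨_, mem_annih_of_mem rot_sub_mem _⟩ with hy
  -- With `z = u ^ n - q`: `d y = φ (d z) = z φ(d) = 0`, because `z` acts as zero on `N`.
  have hann : ∀ d : DAlg K δ n, d • (toRes m) = 0 → d • y = 0 := by
    intro d hd
    have h1 : (of δ (rot n) ^ n - algebraMap K _ q) • φ ⟨d, mem_annih.2 hd⟩ = 0 :=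
      smul_restrict_of_mem rot_sub_mem _
    rw [← h1, hy, ← map_smul, ← map_smul]
    congr 1
    exact Subtype.ext (rot_sub_comm _).symm
  have hannR : annih (JonesAlg δ q n) m ≤ annih (JonesAlg δ q n) (ofRes y) := by
    intro ξ hξ
    obtain ⟨d, rfl⟩ := toJones_surjective ξ
    exact mem_annih.2 (hann d (mem_annih.1 hξ))
  let e := LinearMap.quotKerEquivOfSurjective (LinearMap.toSpanSingleton (JonesAlg δ q n) M m) hm
  -- The homomorphism sending `m` to `y`. If `y ≠ 0`, Schur's lemma makes it an isomorphism of
  -- simple modules.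
  let f : M →ₗ[JonesAlg δ q n] N :=
    (Submodule.liftQ (annih (JonesAlg δ q n) m)
      (LinearMap.toSpanSingleton (JonesAlg δ q n) N y) hannR).comp e.symm.toLinearMap
  have hf : f m = y := by
    have : e.symm m = Submodule.Quotient.mk 1 := by
      rw [LinearEquiv.symm_apply_eq]
      exact (one_smul _ m).symm
    change Submodule.liftQ (annih (JonesAlg δ q n) m)
      (LinearMap.toSpanSingleton (JonesAlg δ q n) N y) hannR (e.symm m) = y
    rw [this]
    exact one_smul _ (ofRes y)
  have hbij := LinearMap.bijective_of_ne_zero (f := f) (fun h0 => hne (by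
    rw [← hf, h0]
    rfl))
  let g : restrict M →ₗ[DAlg K δ n] restrict N :=
    { toFun := f
      map_add' := f.map_add
      map_smul' := fun d x => f.map_smul (toJones δ q n d) x }
  exact hMN ⟨LinearEquiv.ofBijective g hbij⟩

end Descent
end AffineTL

/-! ### Simple standard modules and their self-extensions -/

namespace AffineTL

open CategoryTheory Diagram DAlg

section Standard

variable {K : Type u} [Field K] {δ q : K} {n : ℕ} [NeZero n]

/-- A simple standard module has a generator whose annihilator is known. -/
theorem exists_standard_generator (hδ : δ ≠ 0) (hq : q ≠ 0) {M : ModuleCat.{u} (JonesAlg δ q n)}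
    (hM : IsSimpleModule (JonesAlg δ q n) M) (hstd : IsStandard δ q n M) :
    ∃ (T : Diagram n) (r : K) (m : M), 0 < T.through ∧ r ≠ 0 ∧ m ≠ 0 ∧
      (∀ x : M, ∃ a : JonesAlg δ q n, a • m = x) ∧
      ∀ d : DAlg K δ n, d • toRes m = 0 ↔ ∃ w, proj δ T (d * idem δ T) =
        proj δ T (w * idem δ T * (twistEl δ T - algebraMap K _ r)) := by
  obtain ⟨t, r, j, T, hr, rfl, ⟨f⟩⟩ := hstd
  have hT : 0 < T.through := j.pos
  have hb : (mirror T (Shift.id n _)).SameBottom T := sameBottom_mirror' _ _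
  have hmem : (Submodule.Quotient.mk (toJones δ q n (idem δ T *
      Polynomial.aeval (twistEl δ T) (cellPoly r j))) : JonesAlg δ q n ⧸ lowerIdeal δ q n r j) ∈
      standardModule δ q n r j T := by
    rw [idem, smul_mul_assoc, ← twistIter_zero T (mirror T (Shift.id n _)),
      ← sum_chain hδ hT (isTwistChain_twistIter hb) hb, Algebra.smul_def, map_mul, ← smul_eq_mul,
      Submodule.Quotient.mk_smul]
    exact Submodule.smul_mem _ _ (Submodule.subset_span ⟨_, isTwistChain_twistIter hb, hb, rfl⟩)
  have hsmul : ∀ d : DAlg K δ n, toJones δ q n d • (Submodule.Quotient.mk (toJones δ q n (idem δ T *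
      Polynomial.aeval (twistEl δ T) (cellPoly r j))) : JonesAlg δ q n ⧸ lowerIdeal δ q n r j) =
      Submodule.Quotient.mk (toJones δ q n (d * idem δ T *
      Polynomial.aeval (twistEl δ T) (cellPoly r j))) := by
    intro d
    rw [← Submodule.Quotient.mk_smul, smul_eq_mul, ← map_mul, mul_assoc]
  have hm0 : f.symm ⟨_, hmem⟩ ≠ 0 := by
    intro h0
    rw [LinearEquiv.map_eq_zero_iff] at h0
    have h0 := congrArg Subtype.val h0
    -- Each spanning coset of the standard module is a diagram times the chosen generator, so a zero
    -- generator would give the zero module.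
    have hbot : standardModule δ q n r j T = ⊥ := by
      rw [standardModule, Submodule.span_eq_bot]
      rintro _ ⟨β, hβ, hβT, rfl⟩
      rw [subst, sum_chain hδ hT hβ hβT, ← of_mul_idem hδ hβT, ← hsmul]
      exact (congrArg _ h0).trans (smul_zero _)
    have := IsSimpleModule.nontrivial (JonesAlg δ q n) M
    obtain ⟨x, hx⟩ := exists_ne (0 : M)
    apply hx
    rw [← LinearEquiv.map_eq_zero_iff f]
    exact Subtype.ext ((Submodule.mem_bot _).1 (hbot.le (f x).2))
  refine ⟨T, r j, f.symm ⟨_, hmem⟩, hT, ?_, hm0, IsSimpleModule.toSpanSingleton_surjective _ hm0,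
    fun d => ?_⟩
  · intro h0
    -- Evaluating the factorization at `r j` gives `r j ^ t = q`, so a zero root would force `q =
    -- 0`.
    have := congrArg (Polynomial.eval (r j)) hr
    rw [Polynomial.eval_prod, Finset.prod_eq_zero (Finset.mem_univ j) (by simp), h0] at this
    simp only [Polynomial.eval_sub, Polynomial.eval_pow, Polynomial.eval_X, Polynomial.eval_C,
      zero_pow hT.ne', zero_sub, neg_eq_zero] at this
    exact hq this
  · rw [← mem_lowerIdeal_iff hδ hT hr, ← Submodule.Quotient.mk_eq_zero, ← hsmul]
    change toJones δ q n d • f.symm ⟨_, hmem⟩ = 0 ↔ _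
    rw [← map_smul, LinearEquiv.map_eq_zero_iff, Subtype.ext_iff]
    rfl

variable {T : Diagram n} {r : K} {M : Type*} [AddCommGroup M] [Module (DAlg K δ n) M] {m : M}

/-- The twist acts on the generator by the root. -/
theorem twistEl_smul (hδ : δ ≠ 0) (hT : 0 < T.through)
    (hann : ∀ d : DAlg K δ n, d • m = 0 ↔ ∃ w, proj δ T (d * idem δ T) =
        proj δ T (w * idem δ T * (twistEl δ T - algebraMap K _ r))) (k : ℕ) :
    twistEl δ T ^ k • m = algebraMap K (DAlg K δ n) (r ^ k) • m := by
  have h1 : twistEl δ T • m = algebraMap K (DAlg K δ n) r • m := by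
    rw [← sub_eq_zero, ← sub_smul, hann]
    refine ⟨1, ?_⟩
    rw [one_mul, sub_mul, mul_sub, idem_mul_twistEl hδ hT, twistEl_mul_idem hδ,
      Algebra.commutes]
  induction k with
  | zero => rw [pow_zero, pow_zero, map_one]
  | succ k ih =>
    rw [pow_succ, mul_smul, h1, smul_smul, ← Algebra.commutes, mul_smul, ih, smul_smul, ← map_mul,
      pow_succ']

/-- The element `idem - 1` becomes zero when multiplied by `idem` on the right, so the criterion for
the annihilator applies with `w = 0`. -/
theorem idem_smul (hδ : δ ≠ 0)
    (hann : ∀ d : DAlg K δ n, d • m = 0 ↔ ∃ w, proj δ T (d * idem δ T) =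
        proj δ T (w * idem δ T * (twistEl δ T - algebraMap K _ r))) : idem δ T • m = m := by
  rw [← sub_eq_zero]
  conv_lhs => rw [← one_smul (DAlg K δ n) m, smul_smul, mul_one, ← sub_smul]
  rw [hann]
  exact ⟨0, by rw [sub_mul, one_mul, idem_mul_idem hδ]; simp⟩

/-- The idempotent projects onto the line spanned by the generator. -/
theorem exists_idem_smul (hδ : δ ≠ 0) (hT : 0 < T.through) (hr : r ≠ 0)
    (hann : ∀ d : DAlg K δ n, d • m = 0 ↔ ∃ w, proj δ T (d * idem δ T) =
        proj δ T (w * idem δ T * (twistEl δ T - algebraMap K _ r))) (a : DAlg K δ n) :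
    ∃ c : K, idem δ T • a • m = algebraMap K (DAlg K δ n) c • m := by
  induction a using DAlg.induction with
  | zero => exact ⟨0, by simp⟩
  | add x y hx hy =>
    obtain ⟨c, hc⟩ := hx
    obtain ⟨d, hd⟩ := hy
    exact ⟨c + d, by rw [add_smul, smul_add, hc, hd, map_add, add_smul]⟩
  | smul c C =>
    have hE : of δ (mirror T (Shift.id n _)) • m =
        algebraMap K (DAlg K δ n) (δ ^ mirrorLoops T) • m := by
      conv_rhs => rw [← idem_smul hδ hann]
      rw [smul_smul, idem, ← Algebra.smul_def, smul_smul, mul_inv_cancel₀ (pow_ne_zero _ hδ),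
        one_smul]
    have hb : (mirror T (Shift.id n _)).SameBottom T := sameBottom_mirror' _ _
    set E := mirror T (Shift.id n T.BotThrough) with hEdef
    -- The product `E C E` either has too few through-strings and kills `m`, or has both halves of
    -- `E`. In the latter case it and `E` are related by iterated twists, which act on `m` by powers
    -- of `r`.
    have hX : ∃ c : K, of δ (comp (comp E C) E) • m = algebraMap K (DAlg K δ n) c • m := by
      by_cases hlow : (comp (comp E C) E).through < T.through
      · refine ⟨0, ?_⟩
        rw [map_zero, zero_smul, hann]
        exact ⟨0, by rw [proj_low (low_mul _ _ (of_mem_low hlow))]; simp⟩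
      · have hXb : (comp (comp E C) E).SameBottom T :=
          ((hb.symm).trans (sameBottom_comp (by rw [hb.through_eq]; omega))).symm
        have hXt : E.SameTop (comp (comp E C) E) := by
          rw [comp_assoc]
          refine sameTop_comp ?_
          rw [← comp_assoc, hb.through_eq]
          omega
        generalize comp (comp E C) E = X at hXb hXt
        obtain ⟨k, hk | hk⟩ := exists_twistIter (by rwa [hb.through_eq]) hb hXb hXt
        · refine ⟨r ^ k * δ ^ mirrorLoops T, ?_⟩
          rw [← hk, ← of_mul_twistEl_pow hδ hb, mul_smul, twistEl_smul hδ hT hann, smul_smul,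
            ← Algebra.commutes, mul_smul, hE, smul_smul, ← map_mul]
        -- Here `E` is the `k`-fold twist of the product, so the winding number is negative relative
        -- to `E` and `r` has to be inverted.
        · refine ⟨(r ^ k)⁻¹ * δ ^ mirrorLoops T, ?_⟩
          have h1 : algebraMap K (DAlg K δ n) (r ^ k) • of δ X • m =
              algebraMap K (DAlg K δ n) (δ ^ mirrorLoops T) • m := by
            rw [← hE, ← congrArg (of δ) hk, ← of_mul_twistEl_pow hδ hXb, mul_smul, twistEl_smul hδ hT hann,
              smul_smul, smul_smul, Algebra.commutes]
          rw [map_mul, mul_smul, ← h1, smul_smul, ← map_mul, inv_mul_cancel₀ (pow_ne_zero _ hr),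
            map_one, one_smul]
    obtain ⟨b, hb'⟩ := hX
    refine ⟨(δ ^ mirrorLoops T)⁻¹ * (c * (δ ^ E.loops C * ((δ ^ (comp E C).loops E) *
      ((δ ^ mirrorLoops T)⁻¹ * b)))), ?_⟩
    conv_lhs => rw [← idem_smul hδ hann]
    have hprod : idem δ T * ((c • of δ C) * idem δ T) =
        ((δ ^ mirrorLoops T)⁻¹ * (c * (δ ^ E.loops C * ((δ ^ (comp E C).loops E) *
          (δ ^ mirrorLoops T)⁻¹)))) • of δ (comp (comp E C) E) := by
      rw [idem, ← mul_assoc, smul_mul_smul_comm, of_mul_of, smul_smul, smul_mul_smul_comm,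
        of_mul_of, smul_smul]
      congr 1
      ring
    rw [smul_smul, smul_smul, mul_assoc, hprod, Algebra.smul_def, mul_smul, hb', smul_smul,
      ← map_mul]
    congr 2
    ring

/-- The self-extension of a standard module obtained by deforming the root. -/
theorem exists_not_inner (hδ : δ ≠ 0) (hT : 0 < T.through) (hr : r ≠ 0) (hm0 : m ≠ 0)
    (hm : ∀ x : M, ∃ d : DAlg K δ n, d • m = x)
    (hann : ∀ d : DAlg K δ n, d • m = 0 ↔ ∃ w, proj δ T (d * idem δ T) =
        proj δ T (w * idem δ T * (twistEl δ T - algebraMap K _ r))) :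
    ∃ φ : annih (DAlg K δ n) m →ₗ[DAlg K δ n] M, ¬ ∃ y : M, ∀ l, φ l = (l : DAlg K δ n) • y := by
  have hcomm : ∀ w : DAlg K δ n, w * idem δ T * (twistEl δ T - algebraMap K _ r) =
      w * (twistEl δ T - algebraMap K _ r) * idem δ T := fun w => by
    rw [mul_assoc, mul_assoc, mul_sub, sub_mul, idem_mul_twistEl hδ hT, twistEl_mul_idem hδ,
      Algebra.commutes]
  have hw : ∀ l : annih (DAlg K δ n) m, ∃ w, proj δ T (l * idem δ T) =
      proj δ T (w * idem δ T * (twistEl δ T - algebraMap K _ r)) := fun l =>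
    (hann _).1 (mem_annih.1 l.2)
  choose w hw using hw
  -- The product of `w` with the idempotent is unique up to the kernel of `proj`, since `τ - r` can
  -- be cancelled there; so `w • m` depends only on `l`, and linearity follows.
  have key : ∀ (l : annih (DAlg K δ n) m) (v : DAlg K δ n), proj δ T (l * idem δ T) =
      proj δ T (v * idem δ T * (twistEl δ T - algebraMap K _ r)) → w l • m = v • m := by
    intro l v hv
    rw [hw l, ← sub_eq_zero, ← map_sub, ← sub_mul, ← sub_mul] at hv
    rw [← sub_eq_zero, ← sub_smul, hann]
    exact ⟨0, by rw [proj_eq_zero_of_mul hδ hT hv]; simp⟩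
  let φ : annih (DAlg K δ n) m →ₗ[DAlg K δ n] M :=
    { toFun := fun l => w l • m
      map_add' := by
        intro l l'
        rw [← add_smul]
        refine key _ _ ?_
        rw [Submodule.coe_add, add_mul, map_add, hw, hw, ← map_add, ← add_mul, ← add_mul]
      map_smul' := by
        intro a l
        rw [RingHom.id_apply, smul_smul]
        refine key _ _ ?_
        have h1 := hw l
        rw [hcomm, ← sub_eq_zero, ← map_sub, ← sub_mul] at h1
        have h2 := proj_mul_eq_zero (by rw [mul_assoc, idem_mul_idem hδ]) h1 a 1
        rw [Submodule.coe_smul, smul_eq_mul, hcomm, ← sub_eq_zero, ← map_sub, ← sub_mul]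
        rw [mul_one, ← mul_assoc, mul_sub, ← mul_assoc] at h2
        exact h2 }
  refine ⟨φ, ?_⟩
  rintro ⟨y, hy⟩
  -- For `l = τ - r e`, with `τ` the twist element and `e` the idempotent, one may take `w = 1`; the
  -- deformation class then has the value `m` at `l`.
  have hle : (twistEl δ T - algebraMap K _ r * idem δ T) * idem δ T =
      1 * idem δ T * (twistEl δ T - algebraMap K _ r) := by
    rw [sub_mul, mul_assoc, idem_mul_idem hδ, twistEl_mul_idem hδ, one_mul, mul_sub,
      idem_mul_twistEl hδ hT, Algebra.commutes]
  have hl0 : twistEl δ T - algebraMap K _ r * idem δ T ∈ annih (DAlg K δ n) m :=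
    mem_annih.2 ((hann _).2 ⟨1, by rw [hle]⟩)
  have h1 : φ ⟨_, hl0⟩ = m := (key ⟨_, hl0⟩ 1 (by rw [← hle])).trans (one_smul _ _)
  rw [hy] at h1
  obtain ⟨a, rfl⟩ := hm y
  obtain ⟨c, hc⟩ := exists_idem_smul hδ hT hr hann a
  apply hm0
  rw [← h1]
  -- This element factors through the idempotent on the right, the idempotent maps `M` to `K m`, and
  -- the element kills `m`. It therefore kills `y`, which would give `m = 0`.
  have h2 : twistEl δ T - algebraMap K _ r * idem δ T =
      (twistEl δ T - algebraMap K _ r * idem δ T) * idem δ T := by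
    rw [sub_mul, mul_assoc, idem_mul_idem hδ, twistEl_mul_idem hδ]
  change (twistEl δ T - algebraMap K _ r * idem δ T) • a • m = 0
  rw [h2, mul_smul, hc, smul_smul, ← Algebra.commutes, mul_smul, mem_annih.1 hl0, smul_zero]

end Standard

/-- The self-extensions of a simple standard module form a line. -/
theorem ext_self_linearEquiv {K : Type u} [Field K] {δ q : K} {n : ℕ} [NeZero n] (hδ : δ ≠ 0)
    (hq : q ≠ 0) {M : ModuleCat.{u} (JonesAlg δ q n)} (hM : IsSimpleModule (JonesAlg δ q n) M)
    (hstd : IsStandard δ q n M) (hext : Subsingleton (Abelian.Ext M M 1)) :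
    Nonempty (Abelian.Ext (restrict M) (restrict M) 1 ≃ₗ[K] K) := by
  obtain ⟨T, r, m, hT, hr, hm0, hm, hann⟩ := exists_standard_generator hδ hq hM hstd
  have hgen := exists_smul_restrict hm
  obtain ⟨φ₀, h₀⟩ := @exists_not_inner K _ δ n _ T r (restrict M) (restrict M).isAddCommGroup
    (restrict M).isModule (toRes m) hδ hT hr hm0 hgen hann
  have hscalar : ∀ φ : annih (DAlg K δ n) (toRes m) →ₗ[DAlg K δ n] restrict M, ∃ c : K,
      φ ⟨_, mem_annih_of_mem rot_sub_mem _⟩ = algebraMap K (DAlg K δ n) c • toRes m := by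
    intro φ
    set y := φ ⟨_, mem_annih_of_mem rot_sub_mem _⟩ with hy
    -- The element `idem - 1` annihilates the generator, so by centrality it sends `y` to `(u ^ n -
    -- q)` times the value of `φ` at `idem - 1`, which is zero. Thus `y` lies in the image of the
    -- idempotent, a line.
    have h1 : idem δ T • y = y := by
      rw [← sub_eq_zero]
      conv_lhs => rw [← one_smul (DAlg K δ n) y, smul_smul, mul_one, ← sub_smul]
      have hd : (idem δ T - 1) • toRes m = 0 := by
        rw [sub_smul, idem_smul hδ hann, one_smul, sub_self]
      have h2 : (of δ (rot n) ^ n - algebraMap K _ q) • φ ⟨_, mem_annih.2 hd⟩ = 0 :=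
        smul_restrict_of_mem rot_sub_mem _
      rw [← h2, hy, ← map_smul, ← map_smul]
      congr 1
      exact Subtype.ext (rot_sub_comm _).symm
    obtain ⟨a, ha⟩ := hgen y
    obtain ⟨c, hc⟩ := exists_idem_smul hδ hT hr hann a
    exact ⟨c, by rw [← h1, ← ha]; exact hc⟩
  obtain ⟨c₀, hc₀⟩ := hscalar φ₀
  -- Otherwise `φ₀` would descend to `D_n(q)` and be inner there, since the self-extensions over
  -- `D_n(q)` vanish.
  have hc₀0 : c₀ ≠ 0 := by
    rintro rfl
    rw [map_zero, zero_smul] at hc₀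
    exact h₀ (exists_of_ext_subsingleton hδ hm hext φ₀ hc₀)
  refine ext_linearEquiv hgen φ₀ h₀ fun φ => ?_
  obtain ⟨c, hc⟩ := hscalar φ
  -- The multiple of `φ₀` is chosen so that the difference vanishes at `u ^ n - q`; the difference
  -- then descends and is inner.
  let ψ : annih (DAlg K δ n) (toRes m) →ₗ[DAlg K δ n] restrict M :=
    { toFun := fun l => φ l - algebraMap K (DAlg K δ n) (c / c₀) • φ₀ l
      map_add' := fun x y => by
        rw [map_add, map_add, smul_add]
        abel
      map_smul' := fun a x => by
        rw [map_smul, map_smul, RingHom.id_apply, smul_sub, smul_smul, smul_smul,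
          Algebra.commutes] }
  obtain ⟨y, hy⟩ := exists_of_ext_subsingleton hδ hm hext ψ (by
    change φ _ - _ • φ₀ _ = 0
    rw [hc, hc₀, smul_smul, ← map_mul, div_mul_cancel₀ _ hc₀0, sub_self])
  refine ⟨c / c₀, y, fun l => ?_⟩
  rw [← hy l]
  change φ l = _ + (φ l - _)
  abel

end AffineTL

theorem theorem3p4p2 {K : Type u} [Field K] [IsAlgClosed K] (v : K) (hv : v ≠ 0)
    (hδ : v + v⁻¹ ≠ 0) (n : ℕ) [NeZero n] (hn : 3 ≤ n) :
    (∀ (q : K), q ≠ 0 → ∀ M : ModuleCat.{u} (JonesAlg (v + v⁻¹) q n),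
      IsStandard (v + v⁻¹) q n M → IsSimpleModule (JonesAlg (v + v⁻¹) q n) M →
      Subsingleton (CategoryTheory.Abelian.Ext M M 1) →
      Nonempty (CategoryTheory.Abelian.Ext (restrict M) (restrict M) 1 ≃ₗ[K] K)) ∧
    (∀ (q q' : K), q ≠ 0 → q' ≠ 0 → ∀ (M : ModuleCat.{u} (JonesAlg (v + v⁻¹) q n))
      (M' : ModuleCat.{u} (JonesAlg (v + v⁻¹) q' n)),
      IsStandard (v + v⁻¹) q n M → IsSimpleModule (JonesAlg (v + v⁻¹) q n) M →
      IsStandard (v + v⁻¹) q' n M' → IsSimpleModule (JonesAlg (v + v⁻¹) q' n) M' →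
      ¬ Nonempty (restrict M ≃ₗ[DAlg K (v + v⁻¹) n] restrict M') → q ≠ q' →
      Subsingleton (CategoryTheory.Abelian.Ext (restrict M) (restrict M') 1)) ∧
    (∀ (q : K), q ≠ 0 → ∀ M M' : ModuleCat.{u} (JonesAlg (v + v⁻¹) q n),
      IsStandard (v + v⁻¹) q n M → IsSimpleModule (JonesAlg (v + v⁻¹) q n) M →
      IsStandard (v + v⁻¹) q n M' → IsSimpleModule (JonesAlg (v + v⁻¹) q n) M' →
      ¬ Nonempty (restrict M ≃ₗ[DAlg K (v + v⁻¹) n] restrict M') →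
      Subsingleton (CategoryTheory.Abelian.Ext M M' 1) →
      Subsingleton (CategoryTheory.Abelian.Ext (restrict M) (restrict M') 1)) :=
  ⟨fun _ hq _ hstd hM hext => ext_self_linearEquiv hδ hq hM hstd hext,
    fun _ _ _ _ _ _ _ hM _ _ _ hne => ext_subsingleton_of_ne hne hM,
    fun _ _ _ _ _ hM _ hM' hiso hext => ext_subsingleton_of_not_iso hδ hM hM' hiso hext⟩
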